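/- **Conventions.** Let $\mathcal G$ be a graph of groups whose underlying graph is finite and connected, with vertex groups $G_v$, edge groups $G_e$, and an injective homomorphism from each edge group to the vertex group at each of the two ends of the edge. Assume that all $G_v$ and $G_e$ are finitely generated free groups. Let $G\cong\pi_1(\mathcal G)$ be its fundamental group, formed with respect to a spanning tree, so that every vertex group has a canonical image in $G$; these images form the collection $\mathcal V=\{V_v\}$ of *vertex groups of $G$*. * $\mathcal G$ is *algebraically clean* if, for each edge $e$, both edge homomorphisms map $G_e$ onto a free factor of the corresponding vertex group. * $\mathcal G$ is *geometrically clean* if it arises from a graph of spaces with the same underlying graph in which every vertex space and every edge space is a connected graph (a Hausdorff CW complex of dimension at most $1$) and every attaching map is a topological embedding (not necessarily taking vertices to vertices). Here "arises" means that $G_v$ and $G_e$ are identified with the fundamental groups of the vertex and edge spaces so that the edge homomorphisms become the homomorphisms induced by the attaching maps, after a change of base point along some path. * $\mathcal V$ has *finite commensurable depth* in $G$ if there is a bound on the lengths $d$ of strictly increasing chains $L_1<\dots<L_d$ of subgroups of $G$ in which each $L_i$ is an intersection of finitely many conjugates of elements of $\mathcal V$. * $(G,\mathcal V)$ has *finite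 stature* if for each vertex $v$ there are only finitely many $V_v$-conjugacy classes of infinite subgroups of the form $V_v\cap C$, where $C$ is an intersection of (possibly infinitely many) $G$-conjugates of elements of $\mathcal V$. **Proposition.** 1. If $\mathcal G$ is algebraically clean, then $\mathcal V$ has finite commensurable depth in $G$. 2. If $\mathcal G$ is geometrically clean, then $(G,\mathcal V)$ has finite stature. -/

import Mathlib

universe u₁ u₂ u₃ u₄ u₅ u₆

/-! ### Families of subgroups: finite stature and commensurable depth -/

section Subgroups

variable {G : Type*} [Group G] {ι : Type*}

/-- The conjugate `g H g⁻¹`. -/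
def conjSubgroup (g : G) (H : Subgroup G) : Subgroup G :=
  H.map (MulAut.conj g).toMonoidHom

/-- The `H`-conjugacy class of a subgroup `K`: all `h K h⁻¹` with `h ∈ H`. -/
def conjClassUnder (H K : Subgroup G) : Set (Subgroup G) :=
  {L | ∃ h ∈ H, L = conjSubgroup h K}

/-- The infinite subgroups of the form `H μ ∩ C`, where `C` is an intersection of (possibly
infinitely many) `G`-conjugates of members of the family `H`. -/
def statureSubgroups (H : ι → Subgroup G) (μ : ι) : Set (Subgroup G) :=
  {K | Infinite K ∧
    ∃ A : Set (ι × G), K = H μ ⊓ ⨅ p ∈ A, conjSubgroup p.2 (H p.1)}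

/-- `(G, {H i})` has finite stature: for each `μ` there are only finitely many `H μ`-conjugacy
classes of infinite subgroups `H μ ∩ C`, with `C` an intersection of conjugates of the `H i`. -/
def HasFiniteStature (H : ι → Subgroup G) : Prop :=
  ∀ μ, (conjClassUnder (H μ) '' statureSubgroups H μ).Finite

/-- `L` is an intersection of finitely many (at least one) conjugates of members of `H`. -/
def IsFiniteConjInter (H : ι → Subgroup G) (L : Subgroup G) : Prop :=
  ∃ A : Finset (ι × G), A.Nonempty ∧ L = ⨅ p ∈ A, conjSubgroup p.2 (H p.1)

/-- The commensurable depth of the family `H` in `G`: the supremum of the lengths `d` of strictly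
increasing chains `L₁ < ⋯ < L_d` of intersections of finitely many conjugates of members of `H`. -/
noncomputable def commensurableDepth (H : ι → Subgroup G) : ℕ∞ :=
  ⨆ (d : ℕ) (_ : ∃ L : Fin d → Subgroup G, StrictMono L ∧ ∀ i, IsFiniteConjInter H (L i)), (d : ℕ∞)

def HasFiniteCommensurableDepth (H : ι → Subgroup G) : Prop :=
  commensurableDepth H < ⊤

/-- `A` is a free factor of `G`: there is a subgroup `B` such that the natural homomorphism from
the free product `A * B` to `G` is an isomorphism. -/
def IsFreeFactor (A : Subgroup G) : Prop :=
  ∃ B : Subgroup G, Function.Bijective (Monoid.Coprod.lift A.subtype B.subtype)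

end Subgroups

/-! ### Graphs of groups -/

/-- A graph of groups. The underlying graph has vertex set `V` and edge set `E` (loops and multiple
edges are allowed); each edge `e` carries an orientation from `src e` to `tgt e`. -/
structure GraphOfGroups (V : Type u₁) (E : Type u₂) where
  src : E → V
  tgt : E → V
  vert : V → Type u₃
  edge : E → Type u₄
  [vertGroup : ∀ v, Group (vert v)]
  [edgeGroup : ∀ e, Group (edge e)]
  toSrc : ∀ e, edge e →* vert (src e)
  toTgt : ∀ e, edge e →* vert (tgt e)
  toSrc_injective : ∀ e, Function.Injective (toSrc e)
  toTgt_injective : ∀ e, Function.Injective (toTgt e)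

attribute [instance] GraphOfGroups.vertGroup GraphOfGroups.edgeGroup

/-- A graph of spaces over the graph with edges `e` going from `src e` to `tgt e`: nonempty
path-connected vertex and edge spaces, and two continuous attaching maps for each edge. -/
structure GraphOfSpaces {V : Type u₁} {E : Type u₂} (src tgt : E → V) where
  vert : V → Type u₅
  edge : E → Type u₆
  [vertTop : ∀ v, TopologicalSpace (vert v)]
  [edgeTop : ∀ e, TopologicalSpace (edge e)]
  [vertConn : ∀ v, PathConnectedSpace (vert v)]
  [edgeConn : ∀ e, PathConnectedSpace (edge e)]
  toSrc : ∀ e, C(edge e, vert (src e))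
  toTgt : ∀ e, C(edge e, vert (tgt e))

attribute [instance] GraphOfSpaces.vertTop GraphOfSpaces.edgeTop
  GraphOfSpaces.vertConn GraphOfSpaces.edgeConn

/-- A topological space is a graph if it is a (Hausdorff) CW complex of dimension at most one. -/
def IsTopologicalGraph (X : Type*) [TopologicalSpace X] : Prop :=
  T2Space X ∧ ∃ cw : Topology.CWComplex (Set.univ : Set X), ∀ n, 2 ≤ n → IsEmpty (cw.cell n)

namespace GraphOfGroups

variable {V : Type u₁} {E : Type u₂} (𝒢 : GraphOfGroups.{u₁, u₂, u₃, u₄} V E)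

/-- The set of edges `T` is a spanning tree of the underlying graph: it contains no loops and no
multiple edges, and the simple graph on all of `V` that it spans is a tree. -/
def IsSpanningTree (T : Set E) : Prop :=
  (∀ e ∈ T, 𝒢.src e ≠ 𝒢.tgt e) ∧
  Set.InjOn (fun e => s(𝒢.src e, 𝒢.tgt e)) T ∧
  (SimpleGraph.fromEdgeSet ((fun e => s(𝒢.src e, 𝒢.tgt e)) '' T)).IsTree

/-- The free product of all vertex groups and of the free group on the edges. -/
abbrev FreeProd : Type _ :=
  Monoid.Coprod (Monoid.CoprodI 𝒢.vert) (FreeGroup E)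

/-- A vertex group element in the free product. -/
def elt {v : V} (g : 𝒢.vert v) : 𝒢.FreeProd := Monoid.Coprod.inl (Monoid.CoprodI.of g)

/-- The stable letter of an edge in the free product. -/
def letter (e : E) : 𝒢.FreeProd := Monoid.Coprod.inr (FreeGroup.of e)

/-- The relators of the fundamental group relative to `T`: those of the relations
`t_e⁻¹ (toSrc e a) t_e = toTgt e a` for each edge `e` and each `a` in its edge group, and
`t_e = 1` for `e ∈ T`. -/
def relators (T : Set E) : Set 𝒢.FreeProd :=
  {r | ∃ (e : E) (a : 𝒢.edge e),
    r = (𝒢.letter e)⁻¹ * 𝒢.elt (𝒢.toSrc e a) * 𝒢.letter e * (𝒢.elt (𝒢.toTgt e a))⁻¹} ∪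
  {r | ∃ e ∈ T, r = 𝒢.letter e}

/-- The fundamental group of the graph of groups, relative to the spanning tree `T`. -/
abbrev FundGroup (T : Set E) : Type _ :=
  𝒢.FreeProd ⧸ Subgroup.normalClosure (𝒢.relators T)

/-- The natural homomorphism from a vertex group to the fundamental group. -/
def vertexHom (T : Set E) (v : V) : 𝒢.vert v →* 𝒢.FundGroup T :=
  (QuotientGroup.mk' (Subgroup.normalClosure (𝒢.relators T))).comp
    (Monoid.Coprod.inl.comp Monoid.CoprodI.of)

/-- The vertex groups, as subgroups of a group `G` which splits as the graph of groups `𝒢`, that is,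
which is identified through `φ` with the fundamental group of `𝒢`. -/
def vertexGroup {G : Type*} [Group G] {T : Set E} (φ : 𝒢.FundGroup T ≃* G) (v : V) : Subgroup G :=
  (φ.toMonoidHom.comp (𝒢.vertexHom T v)).range

/-- All vertex and edge groups are finitely generated free groups. -/
def IsFGFree : Prop :=
  (∀ v, IsFreeGroup (𝒢.vert v) ∧ Group.FG (𝒢.vert v)) ∧
  (∀ e, IsFreeGroup (𝒢.edge e) ∧ Group.FG (𝒢.edge e))

/-- Each edge group embeds as a free factor of each of its vertex groups. -/
def IsAlgebraicallyClean : Prop :=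
  ∀ e, IsFreeFactor (𝒢.toSrc e).range ∧ IsFreeFactor (𝒢.toTgt e).range

/-- The graph of groups `𝒢` arises from the graph of spaces `𝒳`: for some choice of basepoints, and
of paths joining the images of the basepoints of edge spaces to the basepoints of vertex spaces, the
groups of `𝒢` are identified with the fundamental groups of the spaces of `𝒳` in such a way that the
edge homomorphisms become the homomorphisms induced by the attaching maps. -/
def ArisesFrom (𝒳 : GraphOfSpaces.{u₁, u₂, u₅, u₆} 𝒢.src 𝒢.tgt) : Prop :=
  ∃ (x : ∀ v, 𝒳.vert v) (y : ∀ e, 𝒳.edge e)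
    (p : ∀ e, Path (𝒳.toSrc e (y e)) (x (𝒢.src e)))
    (q : ∀ e, Path (𝒳.toTgt e (y e)) (x (𝒢.tgt e)))
    (α : ∀ v, 𝒢.vert v ≃* FundamentalGroup (𝒳.vert v) (x v))
    (β : ∀ e, 𝒢.edge e ≃* FundamentalGroup (𝒳.edge e) (y e)),
    ∀ (e : E) (a : 𝒢.edge e),
      α (𝒢.src e) (𝒢.toSrc e a) =
        FundamentalGroup.fundamentalGroupMulEquivOfPath (p e)
          (FundamentalGroup.map (𝒳.toSrc e) (y e) (β e a)) ∧
      α (𝒢.tgt e) (𝒢.toTgt e a) =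
        FundamentalGroup.fundamentalGroupMulEquivOfPath (q e)
          (FundamentalGroup.map (𝒳.toTgt e) (y e) (β e a))

/-- The graph of groups arises from a graph of spaces whose vertex and edge spaces are graphs and
whose attaching maps are topological embeddings. -/
def IsGeometricallyClean : Prop :=
  ∃ 𝒳 : GraphOfSpaces.{u₁, u₂, u₅, u₆} 𝒢.src 𝒢.tgt,
    𝒢.ArisesFrom 𝒳 ∧
    (∀ v, IsTopologicalGraph (𝒳.vert v)) ∧
    (∀ e, IsTopologicalGraph (𝒳.edge e)) ∧
    (∀ e, Topology.IsEmbedding (𝒳.toSrc e) ∧ Topology.IsEmbedding (𝒳.toTgt e))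

end GraphOfGroups

/-! Both parts are reduced to a statement inside a single vertex group. Every element g of the
fundamental group is represented by a reduced path p of the graph of groups from v to w. By the
normal form theorem, the preimage in G_v of the conjugate of G_w by g is the subgroup `p.sub` of
elements that can be pushed along p. It is built from the full group G_w by repeating two
operations: transport across an edge (preimage in the edge group, then image at the other end) and
conjugation. Hence any class of subgroups of the vertex groups that contains the full groups and is
stable under these operations contains all such preimages (`comap_conjSubgroup_mem`). The normal
form itself comes from Britton's lemma in one HNN extension of a wreath product, which receives the
fundamental group and sends reduced paths to reduced words.

For algebraically clean graphs the class consists of the subgroups A of F whose inclusion has the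
left lifting property against surjective homomorphisms (`IsLifting`). Free factors of free groups
have it, it is transitive, and it passes from A in F to A ∩ B in B by an induction argument with
wreath products, so it survives finite intersections. Such an A is a retract of F of finite rank. If
A < B, restriction Hom(B, Q) → Hom(A, Q) is onto for every finite Q, and by residual finiteness not
injective for some Q. Counting homomorphisms gives rank A < rank B, so chains are bounded by the
largest rank of a vertex group plus one.

For geometrically clean graphs the class consists of the subgroups carried by a subset of the vertex
space (`IsCarried`). Reading edges along loops at a vertex embeds the fundamental group of a graph
in the free group on its edges, without choosing a maximal tree, and carried subgroups become
preimages of conjugates of subgroups generated by sets of letters. These conjugates are closed under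
arbitrary intersections (`isLetterConj_sInf`). Pulled back to a finitely generated subgroup, the
nontrivial ones form finitely many conjugacy classes (`exists_finite_comap_classes`), because a
conjugator can be taken to be a prefix of a word of the subgroup, and only finitely many letters
matter. -/

section

/-! ### Conjugates of subgroups. -/

section ConjSubgroup

variable {G : Type*} [Group G]

theorem mem_conjSubgroup {g x : G} {H : Subgroup G} : x ∈ conjSubgroup g H ↔ g⁻¹ * x * g ∈ H := by
  constructor
  · rintro ⟨y, hy, rfl⟩
    simpa [mul_assoc] using hy
  · intro h
    exact ⟨_, h, by simp [mul_assoc]⟩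

theorem conjSubgroup_one (H : Subgroup G) : conjSubgroup 1 H = H := by
  ext x; simp [mem_conjSubgroup]

theorem conjSubgroup_mul (g h : G) (H : Subgroup G) :
    conjSubgroup (g * h) H = conjSubgroup g (conjSubgroup h H) := by
  ext x; simp [mem_conjSubgroup, mul_assoc]

theorem conjSubgroup_eq_self {g : G} {H : Subgroup G} (hg : g ∈ H) : conjSubgroup g H = H := by
  ext x
  rw [mem_conjSubgroup, Subgroup.mul_mem_cancel_right _ hg,
    Subgroup.mul_mem_cancel_left _ (H.inv_mem hg)]

theorem conjSubgroup_comap {Γ : Type*} [Group Γ] (W : Γ →* G) (g : Γ) (H : Subgroup G) :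
    (conjSubgroup (W g) H).comap W = conjSubgroup g (H.comap W) := by
  ext x; simp [mem_conjSubgroup]

theorem map_conjSubgroup {Γ : Type*} [Group Γ] (W : Γ →* G) (g : Γ) (H : Subgroup Γ) :
    (conjSubgroup g H).map W = conjSubgroup (W g) (H.map W) := by
  simp only [conjSubgroup, Subgroup.map_map]
  congr 1
  ext x
  simp

end ConjSubgroup

/-! ### Subgroups of a free group generated by letters, and their conjugates. -/

namespace FreeGroup

variable {α : Type*}

/-- Undo one cancellation at a time: a prefix ending before the cancelled pair is unchanged, and a
longer one has the pair reinserted, which does not alter its group element. -/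
theorem exists_prefix_of_red {L M M' : List (α × Bool)} (h : Red L M) (hM : M' <+: M) :
    ∃ L', L' <+: L ∧ mk L' = mk M' := by
  induction h generalizing M' with
  | refl => exact ⟨M', hM, rfl⟩
  | tail _ hstep ih =>
    cases hstep with
    | @not A B x b =>
      obtain ⟨t, ht⟩ := hM
      rcases List.append_eq_append_iff.1 ht with ⟨a, rfl, rfl⟩ | ⟨c, rfl, rfl⟩
      · exact ih ⟨a ++ (x, b) :: (x, !b) :: B, by simp⟩
      · obtain ⟨L', h1, h2⟩ := ih (M' := A ++ (x, b) :: (x, !b) :: c) ⟨t, by simp⟩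
        exact ⟨L', h1, h2.trans (Quot.sound Red.Step.not)⟩

theorem IsReduced.toWord_mk [DecidableEq α] {L : List (α × Bool)} (h : IsReduced L) :
    (mk L).toWord = L := by
  rw [FreeGroup.toWord_mk, h.reduce_eq]

/-- The standard free factor generated by a set of letters. -/
def letterSubgroup (S : Set α) : Subgroup (FreeGroup α) := Subgroup.closure (of '' S)

theorem mk_mem_letterSubgroup {S : Set α} {L : List (α × Bool)} (h : ∀ x ∈ L, x.1 ∈ S) :
    mk L ∈ letterSubgroup S := by
  induction L with
  | nil => exact one_mem _
  | cons x L ih =>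
    have : mk (x :: L) = mk [x] * mk L := by rw [mul_mk]; rfl
    rw [this]
    refine mul_mem ?_ (ih fun y hy => h y (List.mem_cons_of_mem _ hy))
    have hx : of x.1 ∈ letterSubgroup S := Subgroup.subset_closure ⟨_, h x (by simp), rfl⟩
    obtain ⟨a, b⟩ := x
    cases b
    · exact inv_mem hx
    · exact hx

theorem letterSubgroup_mono {S T : Set α} (h : S ⊆ T) : letterSubgroup S ≤ letterSubgroup T :=
  Subgroup.closure_mono (Set.image_mono h)

theorem letterSubgroup_empty : letterSubgroup (∅ : Set α) = ⊥ := by simp [letterSubgroup]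

variable [DecidableEq α]

theorem fst_mem_of_mem_toWord {S : Set α} {g : FreeGroup α} (h : g ∈ letterSubgroup S) :
    ∀ x ∈ g.toWord, x.1 ∈ S := by
  induction h using Subgroup.closure_induction with
  | mem x hx => obtain ⟨a, ha, rfl⟩ := hx; simpa using ha
  | one => simp
  | mul x y _ _ hx hy =>
    intro z hz
    rcases List.mem_append.1 ((toWord_mul_sublist x y).subset hz) with h | h
    · exact hx z h
    · exact hy z h
  | inv x _ hx =>
    intro z hz
    rw [toWord_inv, invRev, List.mem_reverse, List.mem_map] at hz
    obtain ⟨w, hw, rfl⟩ := hz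
    exact hx w hw

theorem mem_letterSubgroup {S : Set α} {g : FreeGroup α} :
    g ∈ letterSubgroup S ↔ ∀ x ∈ g.toWord, x.1 ∈ S :=
  ⟨fst_mem_of_mem_toWord, fun h => by
    have := mk_mem_letterSubgroup h
    rwa [mk_toWord] at this⟩

theorem letterSubgroup_univ : letterSubgroup (Set.univ : Set α) = ⊤ := by
  ext g; simp [mem_letterSubgroup]

/-- Nothing cancels, since the last letter of `z` is outside `S` while all letters of `b` are in
`S`. -/
theorem toWord_conj {S : Set α} {z b : FreeGroup α} (hz : ∀ x ∈ z.toWord.getLast?, x.1 ∉ S)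
    (hb : b ∈ letterSubgroup S) (hb1 : b ≠ 1) :
    (z * b * z⁻¹).toWord = z.toWord ++ b.toWord ++ invRev z.toWord := by
  have hbw := fst_mem_of_mem_toWord hb
  have hne : b.toWord ≠ [] := by rwa [Ne, toWord_eq_nil_iff]
  have h1 : ∀ {c : FreeGroup α}, c ∈ letterSubgroup S → IsReduced (z.toWord ++ c.toWord) := by
    intro c hc
    refine List.isChain_append.2 ⟨isReduced_toWord, isReduced_toWord, fun x hx y hy hxy => ?_⟩
    exact absurd (hxy ▸ fst_mem_of_mem_toWord hc y (List.mem_of_mem_head? hy)) (hz x hx)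
  have h2 : IsReduced (b.toWord ++ invRev z.toWord) := by
    have h3 := (h1 (inv_mem hb)).reduce_eq
    apply IsReduced.of_reduce_eq
    have h4 : b.toWord ++ invRev z.toWord = invRev (z.toWord ++ (b⁻¹).toWord) := by
      simp only [toWord_inv, invRev_append, invRev_invRev]
    rw [h4, reduce_invRev, h3]
  have h := (h1 hb).append_overlap h2 hne
  rw [← h.toWord_mk, ← mul_mk, ← mul_mk, mk_toWord, mk_toWord, ← inv_mk, mk_toWord]

/-- Each coset of a standard free factor has a representative not ending in its letters. -/
theorem exists_reduced_rep (S : Set α) (z : FreeGroup α) :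
    ∃ A B, z.toWord = A ++ B ∧ (∀ x ∈ B, x.1 ∈ S) ∧ ∀ x ∈ A.getLast?, x.1 ∉ S := by
  classical
  refine ⟨z.toWord.rdropWhile (fun x => x.1 ∈ S), z.toWord.rtakeWhile (fun x => x.1 ∈ S),
    (List.rdropWhile_append_rtakeWhile ..).symm, fun x hx => by
      simpa using List.mem_rtakeWhile_imp hx, fun x hx => ?_⟩
  have hne : z.toWord.rdropWhile (fun x => decide (x.1 ∈ S)) ≠ [] := by
    rintro h; simp [h] at hx
  rw [List.getLast?_eq_some_getLast hne, Option.mem_some_iff] at hx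
  subst hx
  have := List.rdropWhile_last_not (fun x : α × Bool => decide (x.1 ∈ S)) z.toWord hne
  simpa using this

theorem exists_conjSubgroup_eq (S : Set α) (z : FreeGroup α) :
    ∃ z', (∀ x ∈ z'.toWord.getLast?, x.1 ∉ S) ∧
      conjSubgroup z (letterSubgroup S) = conjSubgroup z' (letterSubgroup S) := by
  obtain ⟨A, B, hAB, hB, hA⟩ := exists_reduced_rep S z
  have hAr : IsReduced A := (isReduced_toWord (x := z)).infix ⟨[], B, by simp [hAB]⟩
  refine ⟨mk A, by rwa [hAr.toWord_mk], ?_⟩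
  have : z = mk A * mk B := by rw [mul_mk, ← hAB, mk_toWord]
  rw [this, conjSubgroup_mul, conjSubgroup_eq_self (mk_mem_letterSubgroup hB)]

/-- If the standard free factor on `S₁` meets the conjugate by `z` of that on `S₂`, then the word
of `z` is the product of a word in `S₁` and a word in `S₂`. -/
theorem exists_split {S₁ S₂ : Set α} {z b : FreeGroup α} (hb : b ∈ letterSubgroup S₂) (hb1 : b ≠ 1)
    (hz : z * b * z⁻¹ ∈ letterSubgroup S₁) :
    ∃ A B, z.toWord = A ++ B ∧ (∀ x ∈ A, x.1 ∈ S₁) ∧ ∀ x ∈ B, x.1 ∈ S₂ := by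
  classical
  set A := z.toWord.takeWhile (fun x => x.1 ∈ S₁) with hA
  set R := z.toWord.dropWhile (fun x => x.1 ∈ S₁) with hR
  have hAR : z.toWord = A ++ R := List.takeWhile_append_dropWhile.symm
  have hA1 : ∀ x ∈ A, x.1 ∈ S₁ := fun x hx => by simpa using List.mem_takeWhile_imp hx
  have hRr : IsReduced R := (isReduced_toWord (x := z)).infix ⟨A, [], by simp [hAR]⟩
  obtain ⟨C, B, hCB, hB, hC⟩ := exists_reduced_rep S₂ (mk R)
  rw [hRr.toWord_mk] at hCB
  have hCr : IsReduced C := hRr.infix ⟨[], B, by simp [hCB]⟩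
  rcases C with - | ⟨c, C⟩
  · exact ⟨A, B, by rw [hAR, hCB]; rfl, hA1, hB⟩
  -- After the `S₁`-prefix and the `S₂`-suffix are removed, a nonempty middle `c :: C` would give a
  -- reduced conjugate starting with `c`, which is not in `S₁`.
  exfalso
  have hc : c.1 ∉ S₁ := by
    have h0 : R ≠ [] := by simp [hCB]
    have := List.head_dropWhile_not (p := fun x : α × Bool => decide (x.1 ∈ S₁)) h0
    have h2 : R.head h0 = c := by simp [hCB]
    simp only [← hR, h2] at this
    simpa using this
  set r := mk (c :: C) with hr
  set b' := mk B * b * (mk B)⁻¹ with hb'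
  have hBm : mk B ∈ letterSubgroup S₂ := mk_mem_letterSubgroup hB
  have hAm : mk A ∈ letterSubgroup S₁ := mk_mem_letterSubgroup hA1
  have hb'm : b' ∈ letterSubgroup S₂ := mul_mem (mul_mem hBm hb) (inv_mem hBm)
  have hb'1 : b' ≠ 1 := fun h => hb1 (conj_eq_one_iff.1 h)
  have hzz : z = mk A * (r * mk B) := by
    rw [hr, mul_mk, mul_mk, ← hCB, ← hAR, mk_toWord]
  have hmem : r * b' * r⁻¹ ∈ letterSubgroup S₁ := by
    have : r * b' * r⁻¹ = (mk A)⁻¹ * (z * b * z⁻¹) * mk A := by rw [hzz, hb']; group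
    rw [this]
    exact mul_mem (mul_mem (inv_mem hAm) hz) hAm
  have hw := toWord_conj (z := r) (by rwa [hr, hCr.toWord_mk]) hb'm hb'1
  exact hc (fst_mem_of_mem_toWord hmem c (by rw [hw, hr, hCr.toWord_mk]; simp))

/-- A conjugate of a standard free factor. -/
def IsLetterConj (H : Subgroup (FreeGroup α)) : Prop :=
  ∃ z S, H = conjSubgroup z (letterSubgroup S)

/-- A nontrivial `γ` in the intersection has every normalized conjugator `z H` as a prefix of its
word. Take the longest, `z H₀ = z H · U`: then `U` is a prefix of a word in `S H`, so `z H₀` serves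
as conjugator for every `H`, and the letter sets are simply intersected. -/
theorem isLetterConj_sInf {𝓗 : Set (Subgroup (FreeGroup α))} (h : ∀ H ∈ 𝓗, IsLetterConj H) :
    IsLetterConj (sInf 𝓗) := by
  rcases Set.eq_empty_or_nonempty 𝓗 with rfl | hne
  · exact ⟨1, Set.univ, by rw [letterSubgroup_univ, conjSubgroup_one, sInf_empty]⟩
  by_cases hbot : sInf 𝓗 = ⊥
  · exact ⟨1, ∅, by rw [letterSubgroup_empty, conjSubgroup_one, hbot]⟩
  obtain ⟨γ, hγ, hγ1⟩ := (Subgroup.bot_or_exists_ne_one _).resolve_left hbot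
  have h' : ∀ H ∈ 𝓗, ∃ z S, (∀ x ∈ z.toWord.getLast?, x.1 ∉ S) ∧
      H = conjSubgroup z (letterSubgroup S) := by
    intro H hH
    obtain ⟨z, S, rfl⟩ := h H hH
    obtain ⟨z', h1, h2⟩ := exists_conjSubgroup_eq S z
    exact ⟨z', S, h1, h2⟩
  choose! z S hz hzS using h'
  have hword : ∀ H ∈ 𝓗, ∃ b ∈ letterSubgroup (S H),
      γ.toWord = (z H).toWord ++ b.toWord ++ invRev (z H).toWord := by
    intro H hH
    have hγH := Subgroup.mem_sInf.1 hγ H hH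
    rw [hzS H hH, mem_conjSubgroup] at hγH
    refine ⟨_, hγH, ?_⟩
    rw [← toWord_conj (hz H hH) hγH]
    · congr 1; group
    · intro h0
      apply hγ1
      have : γ = z H * ((z H)⁻¹ * γ * z H) * (z H)⁻¹ := by group
      rw [this, h0]; group
  obtain ⟨H₀, hH₀, hmax⟩ : ∃ H₀ ∈ 𝓗, ∀ H ∈ 𝓗, (z H).toWord.length ≤ (z H₀).toWord.length := by
    have hfin : ((fun H => (z H).toWord.length) '' 𝓗).Finite := by
      refine (Set.finite_Iic γ.toWord.length).subset ?_
      rintro _ ⟨H, hH, rfl⟩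
      obtain ⟨b, -, hb⟩ := hword H hH
      simp [hb]
    obtain ⟨_, ⟨H₀, hH₀, rfl⟩, hmax⟩ := Set.exists_max_image _ id hfin (hne.image _)
    exact ⟨H₀, hH₀, fun H hH => hmax _ ⟨H, hH, rfl⟩⟩
  have hall : ∀ H ∈ 𝓗, H = conjSubgroup (z H₀) (letterSubgroup (S H)) := by
    intro H hH
    obtain ⟨b, hb, hbw⟩ := hword H hH
    obtain ⟨b₀, -, hbw₀⟩ := hword H₀ hH₀
    have hp : (z H).toWord <+: (z H₀).toWord :=
      List.prefix_of_prefix_length_le (l₃ := γ.toWord) ⟨_, by rw [hbw, List.append_assoc]⟩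
        ⟨_, by rw [hbw₀, List.append_assoc]⟩ (hmax H hH)
    obtain ⟨U, hU⟩ := hp
    rw [hbw, ← hU] at hbw₀
    have hbU : b.toWord = U ++ b₀.toWord ++ invRev U := by
      rw [invRev_append] at hbw₀
      have h1 : (z H).toWord ++ (b.toWord ++ invRev (z H).toWord) =
          (z H).toWord ++ ((U ++ b₀.toWord ++ invRev U) ++ invRev (z H).toWord) := by
        simpa only [List.append_assoc] using hbw₀
      exact List.append_cancel_right (List.append_cancel_left h1)
    have hUm : mk U ∈ letterSubgroup (S H) := mk_mem_letterSubgroup fun x hx =>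
      fst_mem_of_mem_toWord hb x (by simp [hbU, hx])
    have : z H₀ = z H * mk U := by
      rw [← mk_toWord (x := z H₀), ← hU, ← mul_mk, mk_toWord]
    rw [this, conjSubgroup_mul, conjSubgroup_eq_self hUm, ← hzS H hH]
  refine ⟨z H₀, ⋂ H ∈ 𝓗, S H, ?_⟩
  ext x
  rw [Subgroup.mem_sInf, mem_conjSubgroup, mem_letterSubgroup]
  constructor
  · intro hx y hy
    refine Set.mem_iInter₂.2 fun H hH => ?_
    have := hx H hH
    rw [hall H hH, mem_conjSubgroup] at this
    exact fst_mem_of_mem_toWord this y hy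
  · intro hx H hH
    rw [hall H hH, mem_conjSubgroup, mem_letterSubgroup]
    exact fun y hy => Set.mem_iInter₂.1 (hx y hy) H hH

/-- The preimages in a finitely generated group of the conjugates of standard free factors under an
injective homomorphism fall, apart from the trivial group, into finitely many conjugacy classes. -/
theorem exists_finite_comap_classes {Γ : Type*} [Group Γ] [hfg : Group.FG Γ] (W : Γ →* FreeGroup α)
    (hW : Function.Injective W) :
    ∃ R : Set (Subgroup Γ), R.Finite ∧ ∀ H, IsLetterConj H → H.comap W ≠ ⊥ →
      ∃ g, ∃ r ∈ R, H.comap W = conjSubgroup g r := by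
  obtain ⟨s, hs⟩ := Group.FG.out (G := Γ)
  -- The prefixes of the images of the generators and their inverses. Up to left translation by the
  -- image of `Γ`, they account for all prefixes of words of that image.
  set K : Set (FreeGroup α) := insert 1 (⋃ x ∈ s, ((fun p => mk p) '' {p | p <+: (W x).toWord} ∪
    (fun p => mk p) '' {p | p <+: (W x⁻¹).toWord})) with hK
  have hpre : ∀ L : List (α × Bool), {p | p <+: L}.Finite := fun L =>
    (L.inits.finite_toSet).subset fun p hp => by simpa using hp
  have hKfin : K.Finite := by
    refine Set.Finite.insert _ (Set.Finite.biUnion s.finite_toSet fun x _ => ?_)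
    exact ((hpre _).image _).union ((hpre _).image _)
  have hcover : ∀ γ : Γ, ∀ p, p <+: (W γ).toWord → ∃ g, ∃ k ∈ K, mk p = W g * k := by
    have step : ∀ x y : Γ, (∀ p, p <+: (W x).toWord → mk p ∈ K) →
        (∀ p, p <+: (W y).toWord → ∃ g, ∃ k ∈ K, mk p = W g * k) →
        ∀ p, p <+: (W (x * y)).toWord → ∃ g, ∃ k ∈ K, mk p = W g * k := by
      intro x y hx hy p hp
      rw [_root_.map_mul, toWord_mul] at hp
      obtain ⟨L', hL', hLp⟩ := exists_prefix_of_red reduce.red hp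
      rw [← hLp]
      obtain ⟨t, ht⟩ := hL'
      rcases List.append_eq_append_iff.1 ht with ⟨a, ha, -⟩ | ⟨c, rfl, hc⟩
      · exact ⟨1, _, hx L' ⟨a, ha.symm⟩, by simp⟩
      · obtain ⟨g, k, hk, hgk⟩ := hy c ⟨t, hc.symm⟩
        refine ⟨x * g, k, hk, ?_⟩
        rw [← mul_mk, mk_toWord, hgk, _root_.map_mul, mul_assoc]
    intro γ
    have hγ : γ ∈ Subgroup.closure (s : Set Γ) := by rw [hs]; trivial
    induction hγ using Subgroup.closure_induction_left with
    | one =>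
      intro p hp
      have : p = [] := by simpa using hp
      exact ⟨1, 1, Set.mem_insert _ _, by simp [this, one_eq_mk]⟩
    | mul_left x hx y hy ih =>
      exact step x y (fun p hp => Set.mem_insert_of_mem _
        (Set.mem_biUnion hx (Or.inl ⟨p, hp, rfl⟩))) ih
    | inv_mul_cancel x hx y hy ih =>
      exact step x⁻¹ y (fun p hp => Set.mem_insert_of_mem _
        (Set.mem_biUnion hx (Or.inr ⟨p, hp, rfl⟩))) ih
  -- A finite alphabet containing the letters of `K` and of the whole image of `W`.
  obtain ⟨T, hTfin, hTK, hTW⟩ : ∃ T : Set α, T.Finite ∧ (∀ k ∈ K, k ∈ letterSubgroup T) ∧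
      ∀ γ, W γ ∈ letterSubgroup T := by
    refine ⟨⋃ g ∈ K ∪ W '' s, {a | ∃ x ∈ g.toWord, x.1 = a},
      Set.Finite.biUnion (hKfin.union (s.finite_toSet.image _)) fun g _ => ?_, ?_, ?_⟩
    · refine ((g.toWord.map Prod.fst).finite_toSet).subset ?_
      rintro a ⟨x, hx, rfl⟩
      exact List.mem_map_of_mem hx
    · exact fun k hk => mem_letterSubgroup.2 fun x hx =>
        Set.mem_biUnion (Or.inl hk) ⟨x, hx, rfl⟩
    · intro γ
      have : (⊤ : Subgroup Γ) ≤ (letterSubgroup (⋃ g ∈ K ∪ W '' s,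
          {a | ∃ x ∈ g.toWord, x.1 = a})).comap W := by
        rw [← hs, Subgroup.closure_le]
        exact fun x hx => mem_letterSubgroup.2 fun y hy =>
          Set.mem_biUnion (Or.inr ⟨x, hx, rfl⟩) ⟨y, hy, rfl⟩
      exact this trivial
  refine ⟨⋃ k ∈ K, (fun S => (conjSubgroup k (letterSubgroup S)).comap W) '' 𝒫 T,
    Set.Finite.biUnion hKfin fun k _ => hTfin.powerset.image _, ?_⟩
  rintro _ ⟨z, S, rfl⟩ hne
  obtain ⟨z', hz', hzz⟩ := exists_conjSubgroup_eq S z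
  rw [hzz] at hne ⊢
  obtain ⟨γ, hγ, hγ1⟩ := (Subgroup.bot_or_exists_ne_one _).resolve_left hne
  rw [Subgroup.mem_comap, mem_conjSubgroup] at hγ
  have hw := toWord_conj hz' hγ fun h0 => hγ1 (hW (by
    have : W γ = z' * (z'⁻¹ * W γ * z') * z'⁻¹ := by group
    rw [this, h0]; simp))
  have hw' : z' * (z'⁻¹ * W γ * z') * z'⁻¹ = W γ := by group
  rw [hw'] at hw
  -- A nontrivial element of the preimage has `z'` as a prefix of its image, so `z'` is `W g * k`
  -- with `k` in the finite set `K`; conjugation by `g` takes place in `Γ`.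
  obtain ⟨g, k, hk, hgk⟩ := hcover γ z'.toWord ⟨_, by rw [hw, List.append_assoc]⟩
  rw [mk_toWord] at hgk
  refine ⟨g, _, Set.mem_biUnion hk ⟨S ∩ T, Set.inter_subset_right, rfl⟩, ?_⟩
  rw [hgk, conjSubgroup_mul, conjSubgroup_comap]
  congr 1
  -- Letters of `S` outside `T` are irrelevant, since `k⁻¹ * W x * k` is a word in `T`.
  ext x
  simp only [Subgroup.mem_comap, mem_conjSubgroup]
  refine ⟨fun h => mem_letterSubgroup.2 fun y hy => ⟨fst_mem_of_mem_toWord h y hy, ?_⟩,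
    fun h => letterSubgroup_mono Set.inter_subset_left h⟩
  exact fst_mem_of_mem_toWord (mul_mem (mul_mem (inv_mem (hTK k hk)) (hTW x)) (hTK k hk)) y hy

end FreeGroup

end

/-! ### One-dimensional complexes: cut points and radial paths. -/

section

open scoped unitInterval

/-- The homotopy class of a path. -/
abbrev Path.cls {X : Type*} [TopologicalSpace X] {x y : X} (γ : Path x y) :
    Path.Homotopic.Quotient x y := Path.Homotopic.Quotient.mk γ

/-- The combinatorial data of a one-dimensional CW complex: characteristic maps of the edges,
extended constantly to the real line, the set of vertices, and the weak topology. -/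
structure TopGraph (X E : Type*) [TopologicalSpace X] where
  char : E → ℝ → X
  verts : Set X
  continuous_char : ∀ e, Continuous (char e)
  char_of_nonpos : ∀ e t, t ≤ 0 → char e t = char e 0
  char_of_one_le : ∀ e t, 1 ≤ t → char e t = char e 1
  zero_mem : ∀ e, char e 0 ∈ verts
  one_mem : ∀ e, char e 1 ∈ verts
  char_notMem : ∀ e, ∀ t ∈ Set.Ioo (0 : ℝ) 1, char e t ∉ verts
  char_inj : ∀ e e', ∀ t ∈ Set.Ioo (0 : ℝ) 1, ∀ t' ∈ Set.Ioo (0 : ℝ) 1,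
    char e t = char e' t' → e = e' ∧ t = t'
  cover : ∀ x, x ∈ verts ∨ ∃ e, ∃ t ∈ Set.Ioo (0 : ℝ) 1, char e t = x
  isOpen_of_preimage : ∀ A : Set X, (∀ e, IsOpen (char e ⁻¹' A)) → IsOpen A

namespace TopGraph

open Path.Homotopic (Quotient)

variable {X E : Type*} [TopologicalSpace X] (Γ : TopGraph X E)

theorem char_mem_verts_iff {e : E} {t : ℝ} : Γ.char e t ∈ Γ.verts ↔ t ∉ Set.Ioo (0 : ℝ) 1 := by
  refine ⟨fun h ht => Γ.char_notMem e t ht h, fun h => ?_⟩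
  rcases le_or_gt t 0 with h0 | h0
  · rw [Γ.char_of_nonpos e t h0]; exact Γ.zero_mem e
  rcases le_or_gt 1 t with h1 | h1
  · rw [Γ.char_of_one_le e t h1]; exact Γ.one_mem e
  · exact absurd ⟨h0, h1⟩ h

theorem preimage_char_image (e e' : E) (A : Set ℝ) (hA : A ⊆ Set.Ioo (0 : ℝ) 1) :
    Γ.char e' ⁻¹' (Γ.char e '' A) = {t | t ∈ A ∧ e = e'} := by
  ext t
  constructor
  · rintro ⟨s, hs, hst⟩
    have ht : t ∈ Set.Ioo (0 : ℝ) 1 := by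
      by_contra h
      rw [← Γ.char_mem_verts_iff (e := e'), ← hst] at h
      exact Γ.char_notMem e s (hA hs) h
    obtain ⟨rfl, rfl⟩ := Γ.char_inj _ _ s (hA hs) t ht hst
    exact ⟨hs, rfl⟩
  · rintro ⟨ht, rfl⟩
    exact ⟨t, ht, rfl⟩

theorem isOpen_char_image (e : E) {A : Set ℝ} (hA : A ⊆ Set.Ioo (0 : ℝ) 1) (hAo : IsOpen A) :
    IsOpen (Γ.char e '' A) := by
  refine Γ.isOpen_of_preimage _ fun e' => ?_
  rw [Γ.preimage_char_image e e' A hA]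
  by_cases h : e = e' <;> simp [h, hAo]

/-- The preimage in each edge is a union of at most two closed rays. Since all sets of vertices are
closed, the vertices form a discrete subspace. -/
theorem isClosed_of_subset_verts {A : Set X} (hA : A ⊆ Γ.verts) : IsClosed A := by
  rw [← isOpen_compl_iff]
  refine Γ.isOpen_of_preimage _ fun e => ?_
  rw [Set.preimage_compl, isOpen_compl_iff]
  have : Γ.char e ⁻¹' A = {t | t ≤ 0 ∧ Γ.char e 0 ∈ A} ∪ {t | 1 ≤ t ∧ Γ.char e 1 ∈ A} := by
    ext t
    simp only [Set.mem_preimage, Set.mem_union, Set.mem_ofPred_eq]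
    constructor
    · intro h
      have := Γ.char_mem_verts_iff.1 (hA h)
      rcases le_or_gt t 0 with h0 | h0
      · exact Or.inl ⟨h0, Γ.char_of_nonpos e t h0 ▸ h⟩
      · have h1 : 1 ≤ t := by
          by_contra h1
          exact this ⟨h0, not_le.1 h1⟩
        exact Or.inr ⟨h1, Γ.char_of_one_le e t h1 ▸ h⟩
    · rintro (⟨h0, h⟩ | ⟨h0, h⟩)
      · rwa [Γ.char_of_nonpos e t h0]
      · rwa [Γ.char_of_one_le e t h0]
  rw [this]
  refine IsClosed.union ?_ ?_
  · by_cases h : Γ.char e 0 ∈ A <;> simp [h]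
    exact isClosed_Iic
  · by_cases h : Γ.char e 1 ∈ A <;> simp [h]
    exact isClosed_Ici

/-- A choice of one interior point in each edge. -/
def IsCut (m : E → ℝ) : Prop := ∀ e, m e ∈ Set.Ioo (0 : ℝ) 1

/-- The complement of the cut points. -/
def cutCompl (m : E → ℝ) : Set X := {x | ∀ e, x ≠ Γ.char e (m e)}

theorem char_mem_cutCompl {m : E → ℝ} (hm : IsCut m) {e : E} {t : ℝ} :
    Γ.char e t ∈ Γ.cutCompl m ↔ t ≠ m e := by
  constructor
  · rintro h rfl
    exact h e rfl
  · intro h e' he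
    have : t ∈ Γ.char e ⁻¹' (Γ.char e' '' {m e'}) := ⟨_, rfl, he.symm⟩
    rw [Γ.preimage_char_image _ _ _ (by simpa using hm e')] at this
    obtain ⟨rfl, rfl⟩ := this
    exact h rfl

theorem isOpen_cutCompl {m : E → ℝ} (hm : IsCut m) : IsOpen (Γ.cutCompl m) := by
  refine Γ.isOpen_of_preimage _ fun e => ?_
  have : Γ.char e ⁻¹' Γ.cutCompl m = {m e}ᶜ := by
    ext t; simp [Γ.char_mem_cutCompl hm]
  rw [this]
  exact isOpen_compl_singleton

/-- The open edge. -/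
def openEdge (e : E) : Set X := Γ.char e '' Set.Ioo (0 : ℝ) 1

theorem isOpen_openEdge (e : E) : IsOpen (Γ.openEdge e) :=
  Γ.isOpen_char_image e subset_rfl isOpen_Ioo

open Classical in
/-- The radial path from a point to the vertex on the same side of the cut. -/
noncomputable def radFun (m : E → ℝ) (x : X) : C(I, X) :=
  if h : ∃ q : E × ℝ, q.2 ∈ Set.Ioo (0 : ℝ) 1 ∧ Γ.char q.1 q.2 = x then
    if h.choose.2 ≤ m h.choose.1 then
      ⟨fun s => Γ.char h.choose.1 ((1 - s) * h.choose.2), (Γ.continuous_char _).comp (by fun_prop)⟩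
    else
      ⟨fun s => Γ.char h.choose.1 ((1 - s) * h.choose.2 + s),
        (Γ.continuous_char _).comp (by fun_prop)⟩
  else ContinuousMap.const I x

theorem radFun_of_mem_verts (m : E → ℝ) {x : X} (hx : x ∈ Γ.verts) (s : I) :
    Γ.radFun m x s = x := by
  rw [radFun, dif_neg]
  · rfl
  · rintro ⟨q, hq, rfl⟩
    exact Γ.char_notMem _ _ hq hx

theorem radFun_char {m : E → ℝ} (hm : IsCut m) (e : E) (t : ℝ) (s : I) :
    Γ.radFun m (Γ.char e t) s =
      if t ≤ m e then Γ.char e ((1 - s) * t) else Γ.char e ((1 - s) * t + s) := by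
  have hs0 : (0 : ℝ) ≤ s := s.2.1
  have hs1 : (0 : ℝ) ≤ 1 - s := by linarith [s.2.2]
  have hme := hm e
  by_cases ht : t ∈ Set.Ioo (0 : ℝ) 1
  · have h : ∃ q : E × ℝ, q.2 ∈ Set.Ioo (0 : ℝ) 1 ∧ Γ.char q.1 q.2 = Γ.char e t := ⟨(e, t), ht, rfl⟩
    obtain ⟨h1, h2⟩ := Γ.char_inj _ _ _ h.choose_spec.1 _ ht h.choose_spec.2
    rw [radFun, dif_pos h]
    simp only [h1, h2]
    split_ifs <;> rfl
  · rw [Γ.radFun_of_mem_verts m (Γ.char_mem_verts_iff.2 ht)]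
    rcases le_or_gt t 0 with h0 | h0
    · rw [if_pos (h0.trans hme.1.le), Γ.char_of_nonpos e t h0, Γ.char_of_nonpos e _
        (mul_nonpos_of_nonneg_of_nonpos hs1 h0)]
    · have h1 : 1 ≤ t := by
        by_contra h1
        exact ht ⟨h0, not_le.1 h1⟩
      rw [if_neg (not_le.2 (hme.2.trans_le h1)), Γ.char_of_one_le e t h1,
        Γ.char_of_one_le e ((1 - s) * t + s) (by nlinarith)]

theorem radFun_zero {m : E → ℝ} (hm : IsCut m) (x : X) : Γ.radFun m x 0 = x := by
  rcases Γ.cover x with hx | ⟨e, t, -, rfl⟩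
  · exact Γ.radFun_of_mem_verts m hx 0
  · simp [Γ.radFun_char hm]

/-- The vertex on the same side of the cut. -/
noncomputable def nbr (m : E → ℝ) (x : X) : X := Γ.radFun m x 1

theorem nbr_char {m : E → ℝ} (hm : IsCut m) (e : E) (t : ℝ) :
    Γ.nbr m (Γ.char e t) = if t ≤ m e then Γ.char e 0 else Γ.char e 1 := by
  simp [nbr, Γ.radFun_char hm]

theorem nbr_of_mem_verts (m : E → ℝ) {x : X} (hx : x ∈ Γ.verts) : Γ.nbr m x = x :=
  Γ.radFun_of_mem_verts m hx 1

theorem nbr_mem_verts {m : E → ℝ} (hm : IsCut m) (x : X) : Γ.nbr m x ∈ Γ.verts := by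
  rcases Γ.cover x with hx | ⟨e, t, -, rfl⟩
  · rwa [Γ.nbr_of_mem_verts m hx]
  · rw [Γ.nbr_char hm]
    split_ifs
    exacts [Γ.zero_mem e, Γ.one_mem e]

/-- Taking values in the function space `C(I, X)` means that continuity is tested on `X`, where the
weak topology applies, and not on `X × I`. -/
theorem continuousOn_radFun {m : E → ℝ} (hm : IsCut m) :
    ContinuousOn (Γ.radFun m) (Γ.cutCompl m) := by
  refine (continuousOn_open_iff (Γ.isOpen_cutCompl hm)).2 fun W hW =>
    Γ.isOpen_of_preimage _ fun e => ?_
  let g₀ : C(ℝ, C(I, X)) := ContinuousMap.curry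
    ⟨fun q : ℝ × I => Γ.char e ((1 - q.2) * q.1), (Γ.continuous_char e).comp (by fun_prop)⟩
  let g₁ : C(ℝ, C(I, X)) := ContinuousMap.curry
    ⟨fun q : ℝ × I => Γ.char e ((1 - q.2) * q.1 + q.2), (Γ.continuous_char e).comp (by fun_prop)⟩
  have h0 : ∀ t ≤ m e, Γ.radFun m (Γ.char e t) = g₀ t := fun t ht => by
    ext s; rw [Γ.radFun_char hm, if_pos ht]; rfl
  have h1 : ∀ t, m e < t → Γ.radFun m (Γ.char e t) = g₁ t := fun t ht => by
    ext s; rw [Γ.radFun_char hm, if_neg (not_le.2 ht)]; rfl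
  have : Γ.char e ⁻¹' (Γ.cutCompl m ∩ Γ.radFun m ⁻¹' W) =
      (Set.Iio (m e) ∩ g₀ ⁻¹' W) ∪ (Set.Ioi (m e) ∩ g₁ ⁻¹' W) := by
    ext t
    simp only [Set.mem_preimage, Set.mem_inter_iff, Γ.char_mem_cutCompl hm, Set.mem_union,
      Set.mem_Iio, Set.mem_Ioi]
    rcases lt_trichotomy t (m e) with h | h | h
    · simp [h, h.ne, h.not_gt, h0 t h.le]
    · simp [h]
    · simp [h, h.ne', h.not_gt, h1 t h]
  rw [this]
  exact (isOpen_Iio.inter (hW.preimage g₀.continuous)).union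
    (isOpen_Ioi.inter (hW.preimage g₁.continuous))

/-- The radial path. -/
noncomputable def rad {m : E → ℝ} (hm : IsCut m) (x : X) : Path x (Γ.nbr m x) where
  toContinuousMap := Γ.radFun m x
  source' := Γ.radFun_zero hm x
  target' := rfl

/-- A path of vertices is constant. -/
theorem path_eq_of_mem_verts {x y : X} (γ : Path x y) (h : ∀ t, γ t ∈ Γ.verts) (t : I) : γ t = x := by
  have hpre : IsPreconnected (Set.range γ) := isPreconnected_range γ.continuous
  have hsub : ∀ A ⊆ Set.range γ, IsClosed A := fun A hA =>
    Γ.isClosed_of_subset_verts (hA.trans (Set.range_subset_iff.2 h))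
  by_contra hne
  obtain ⟨z, -, hz1, hz2⟩ := isPreconnected_closed_iff.1 hpre {x} (Set.range γ \ {x})
    (hsub _ (by simp)) (hsub _ Set.sdiff_subset)
    (fun z hz => by by_cases h : z = x <;> simp [h, hz]) ⟨x, ⟨0, γ.source⟩, rfl⟩
    ⟨γ t, ⟨t, rfl⟩, ⟨t, rfl⟩, hne⟩
  exact hz2.2 hz1

/-- A path avoiding the cut points is homotopic to the radial path to a vertex followed by the
reverse of a radial path. -/
theorem exists_trans_rad {m : E → ℝ} (hm : IsCut m) {x y : X} (γ : Path x y)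
    (h : ∀ t, γ t ∈ Γ.cutCompl m) :
    ∃ c : Path (Γ.nbr m x) (Γ.nbr m y), (∀ t, c t = Γ.nbr m x) ∧
      γ.cls.trans (Γ.rad hm y).cls = (Γ.rad hm x).cls.trans c.cls := by
  rcases γ with ⟨f, rfl, rfl⟩
  change ∀ t, f t ∈ _ at h
  have hG : Continuous fun t => Γ.radFun m (f t) :=
    (Γ.continuousOn_radFun hm).comp_continuous f.continuous h
  have hG' : Continuous fun q : I × I => Γ.radFun m (f q.2) q.1 :=
    (continuous_eval (F := C(I, X))).comp ((hG.comp continuous_snd).prodMk continuous_fst)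
  let g : C(I, X) := ⟨fun t => Γ.nbr m (f t),
    hG'.comp (by fun_prop : Continuous fun t : I => ((1 : I), t))⟩
  let H : f.Homotopy g :=
    { toFun := fun q => Γ.radFun m (f q.2) q.1
      continuous_toFun := hG'
      map_zero_left := fun t => Γ.radFun_zero hm (f t)
      map_one_left := fun t => rfl }
  let c : Path (Γ.nbr m (f 0)) (Γ.nbr m (f 1)) := ⟨g, rfl, rfl⟩
  refine ⟨c, Γ.path_eq_of_mem_verts c fun t => Γ.nbr_mem_verts hm _, ?_⟩
  have hh := Path.Homotopic.map_trans_evalAt H Path.id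
  rw [← Path.Homotopic.Quotient.mk_trans, ← Path.Homotopic.Quotient.mk_trans,
    Path.Homotopic.Quotient.eq]
  exact hh

/-- The path along an edge between two parameters. -/
def seg (e : E) (a b : ℝ) : Path (Γ.char e a) (Γ.char e b) :=
  (Path.segment a b).map (Γ.continuous_char e)

theorem seg_trans (e : E) (a b c : ℝ) :
    (Γ.seg e a b).cls.trans (Γ.seg e b c).cls = (Γ.seg e a c).cls := by
  rw [← Path.Homotopic.Quotient.mk_trans, Path.Homotopic.Quotient.eq, seg, seg, ← Path.map_trans]
  exact (SimplyConnectedSpace.paths_homotopic _ (Path.segment a c)).map ⟨_, Γ.continuous_char e⟩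

/-- The parameter line is simply connected, so only the end parameters matter. -/
theorem cls_map_char (e : E) {a b : ℝ} (τ : Path a b) :
    (τ.map (Γ.continuous_char e)).cls = (Γ.seg e a b).cls :=
  Path.Homotopic.Quotient.eq.2
    ((SimplyConnectedSpace.paths_homotopic τ (Path.segment a b)).map ⟨_, Γ.continuous_char e⟩)

/-- A path in an open edge comes from a path of parameters. -/
theorem exists_eq_map_char (e : E) {x y : X} (γ : Path x y) (h : ∀ t, γ t ∈ Γ.openEdge e) :
    ∃ τ : C(I, ℝ), (∀ t, τ t ∈ Set.Ioo (0 : ℝ) 1) ∧ ∀ t, γ t = Γ.char e (τ t) := by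
  choose τ hτ hγ using h
  refine ⟨⟨τ, continuous_def.2 fun A hA => ?_⟩, hτ, fun t => (hγ t).symm⟩
  have : τ ⁻¹' A = γ ⁻¹' (Γ.char e '' (A ∩ Set.Ioo 0 1)) := by
    ext t
    simp only [Set.mem_preimage, ← hγ t]
    constructor
    · exact fun h => ⟨_, ⟨h, hτ t⟩, rfl⟩
    · rintro ⟨s, ⟨hs, hs'⟩, hst⟩
      rwa [← (Γ.char_inj _ _ _ hs' _ (hτ t) hst).2]
  rw [this]
  exact (Γ.isOpen_char_image e Set.inter_subset_right (hA.inter isOpen_Ioo)).preimage γ.continuous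

/-- A loop that avoids the vertices is nullhomotopic. -/
theorem cls_eq_refl_of_notMem_verts {x : X} (γ : Path x x) (h : ∀ t, γ t ∉ Γ.verts) :
    γ.cls = .refl x := by
  have hmem : ∀ t, ∃ e, γ t ∈ Γ.openEdge e := fun t => (Γ.cover (γ t)).resolve_left (h t)
  obtain ⟨e, he⟩ := hmem 0
  have hpre : IsPreconnected (Set.range γ) := isPreconnected_range γ.continuous
  have hsub : Set.range γ ⊆ Γ.openEdge e := by
    refine hpre.subset_left_of_subset_union (Γ.isOpen_openEdge e)
      (isOpen_iUnion fun e' : {e' // e' ≠ e} => Γ.isOpen_openEdge e') ?_ ?_ ⟨_, ⟨0, rfl⟩, he⟩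
    · rw [Set.disjoint_left]
      rintro _ ⟨t, ht, rfl⟩ h'
      obtain ⟨⟨e', hne⟩, s, hs, hst⟩ := Set.mem_iUnion.1 h'
      exact hne (Γ.char_inj _ _ _ hs _ ht hst).1
    · rintro _ ⟨t, rfl⟩
      obtain ⟨e', he'⟩ := hmem t
      by_cases h : e' = e
      · exact Or.inl (h ▸ he')
      · exact Or.inr (Set.mem_iUnion.2 ⟨⟨e', h⟩, he'⟩)
  obtain ⟨τ, hτ, hγ⟩ := Γ.exists_eq_map_char e γ fun t => hsub ⟨t, rfl⟩
  have h0 : Γ.char e (τ 0) = x := by rw [← hγ, γ.source]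
  subst h0
  have h1 : τ 1 = τ 0 := (Γ.char_inj e e _ (hτ 1) _ (hτ 0) (by rw [← hγ 1, γ.target])).2
  have hγ' : γ = Path.map (⟨τ, rfl, h1⟩ : Path (τ 0) (τ 0)) (Γ.continuous_char e) := by
    ext t; exact hγ t
  rw [hγ', cls_map_char, ← Γ.cls_map_char e (Path.refl _)]
  rfl

end TopGraph

end

/-! ### Edge walks read along paths. -/

section

open scoped unitInterval

namespace Path.Homotopic.Quotient

variable {X : Type*} [TopologicalSpace X] {x y z w : X}

theorem symm_trans_cancel (a : Path.Homotopic.Quotient x y) (b : Path.Homotopic.Quotient y z) :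
    a.symm.trans (a.trans b) = b := by
  rw [← trans_assoc, symm_trans, refl_trans]

theorem trans_symm_cancel (a : Path.Homotopic.Quotient x y) (b : Path.Homotopic.Quotient x z) :
    a.trans (a.symm.trans b) = b := by
  rw [← trans_assoc, trans_symm, refl_trans]

theorem symm_trans_rev (a : Path.Homotopic.Quotient x y) (b : Path.Homotopic.Quotient y z) :
    (a.trans b).symm = b.symm.trans a.symm := by
  induction a using Quotient.ind
  induction b using Quotient.ind
  rw [← mk_trans, ← mk_symm, Path.trans_symm]
  rfl

theorem symm_symm' (a : Path.Homotopic.Quotient x y) : a.symm.symm = a := by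
  induction a using Quotient.ind
  rw [← mk_symm, ← mk_symm, Path.symm_symm]

theorem symm_refl (x : X) : (refl x).symm = refl x := rfl

theorem trans_left_cancel (a : Path.Homotopic.Quotient x y) {b c : Path.Homotopic.Quotient y z}
    (h : a.trans b = a.trans c) : b = c := by
  rw [← symm_trans_cancel a b, h, symm_trans_cancel]

theorem trans_right_cancel (a : Path.Homotopic.Quotient y z) {b c : Path.Homotopic.Quotient x y}
    (h : b.trans a = c.trans a) : b = c := by
  have := congrArg (fun q => q.trans a.symm) h
  simpa [trans_assoc, trans_symm, trans_refl] using this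

end Path.Homotopic.Quotient

/-- Induction over a subdivision of a path subordinate to an open cover. -/
theorem Path.cls_induction_cover {X ι : Type*} [TopologicalSpace X] {U : ι → Set X}
    (hU : ∀ i, IsOpen (U i)) (hcov : ∀ x, ∃ i, x ∈ U i) (S : Set X)
    (Φ : ∀ ⦃x y : X⦄, Path.Homotopic.Quotient x y → Prop)
    (htrans : ∀ ⦃x y z : X⦄ (a : Path.Homotopic.Quotient x y) (b : Path.Homotopic.Quotient y z),
      Φ a → Φ b → Φ (a.trans b))
    (hpiece : ∀ ⦃x y : X⦄ (γ : Path x y) (i : ι), Set.range γ ⊆ S → Set.range γ ⊆ U i → Φ γ.cls)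
    {x y : X} (γ : Path x y) (hγ : Set.range γ ⊆ S) : Φ γ.cls := by
  obtain ⟨t, ht0, htm, ⟨n, hn⟩, ht⟩ := exists_monotone_Icc_subset_open_cover_unitInterval
    (fun i => (hU i).preimage γ.continuous)
    (fun s _ => Set.mem_iUnion.2 (hcov (γ s)))
  have key : ∀ k, Φ (γ.subpath 0 (t k)).cls := by
    intro k
    induction k with
    | zero =>
      rw [ht0, Path.subpath_self]
      obtain ⟨i, hi⟩ := hcov (γ 0)
      refine hpiece _ i ?_ ?_
      · rintro _ ⟨s, rfl⟩; exact hγ ⟨0, rfl⟩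
      · rintro _ ⟨s, rfl⟩; exact hi
    | succ k ih =>
      obtain ⟨i, hi⟩ := ht k
      have h2 : Φ (γ.subpath (t k) (t (k + 1))).cls := by
        have hr := Path.range_subpath_of_le γ _ _ (htm k.le_succ)
        refine hpiece _ i ?_ ?_
        · rw [hr]; exact (Set.image_subset_range _ _).trans hγ
        · rw [hr]; rintro _ ⟨s, hs, rfl⟩; exact hi hs
      have h3 := htrans _ _ ih h2
      rwa [← Path.Homotopic.Quotient.mk_trans,
        Path.Homotopic.Quotient.eq.2 ⟨Path.Homotopy.subpathTransSubpath γ 0 (t k) (t (k + 1))⟩] at h3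
  have h1 := key n
  rw [hn n le_rfl, Path.subpath_zero_one] at h1
  rcases γ with ⟨f, rfl, rfl⟩
  exact h1

namespace TopGraph

open Path.Homotopic.Quotient

variable {X E : Type*} [TopologicalSpace X] (Γ : TopGraph X E)

/-- The initial vertex of an oriented edge. -/
def start (q : E × Bool) : X := Γ.char q.1 (if q.2 then 0 else 1)

/-- The terminal vertex of an oriented edge. -/
def fin (q : E × Bool) : X := Γ.char q.1 (if q.2 then 1 else 0)

theorem fin_mem_verts (q : E × Bool) : Γ.fin q ∈ Γ.verts := by
  rcases q with ⟨e, - | -⟩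
  exacts [Γ.zero_mem e, Γ.one_mem e]

/-- A list of oriented edges is a walk between two vertices. -/
def IsWalk : X → List (E × Bool) → X → Prop
  | u, [], u' => u = u'
  | u, q :: L, u' => u = Γ.start q ∧ IsWalk (Γ.fin q) L u'

theorem isWalk_append {u u' : X} {L L' : List (E × Bool)} :
    Γ.IsWalk u (L ++ L') u' ↔ ∃ v, Γ.IsWalk u L v ∧ Γ.IsWalk v L' u' := by
  induction L generalizing u with
  | nil => simp [IsWalk]
  | cons q L ih => simp [IsWalk, ih, and_assoc]

/-- Deleting a backtrack does not disconnect a walk; hence the reduced word of a walk is again a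
walk with the same ends. -/
theorem IsWalk.red {u u' : X} {L L' : List (E × Bool)} (h : Γ.IsWalk u L u')
    (hr : FreeGroup.Red L L') : Γ.IsWalk u L' u' := by
  induction hr with
  | refl => exact h
  | tail _ hstep ih =>
    cases hstep with
    | @not A B e b =>
      rw [isWalk_append] at ih ⊢
      obtain ⟨v, h1, rfl, h2, h3⟩ := ih
      refine ⟨_, h1, ?_⟩
      have : Γ.start (e, b) = Γ.fin (e, !b) := by cases b <;> rfl
      rwa [this]

theorem IsWalk.mem_verts {u u' : X} (hu : u ∈ Γ.verts) {L : List (E × Bool)}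
    (h : Γ.IsWalk u L u') : u' ∈ Γ.verts := by
  induction L generalizing u with
  | nil => exact h ▸ hu
  | cons q L ih => exact ih (Γ.fin_mem_verts q) h.2

variable {m : E → ℝ} (hm : IsCut m) {x₀ : X} (p : ∀ x, Path x₀ x)

/-- The class of a path from the base point to `x` arriving through the vertex near `x`. -/
noncomputable def base (x : X) : Path.Homotopic.Quotient x₀ x :=
  (p (Γ.nbr m x)).cls.trans (Γ.rad hm x).cls.symm

theorem base_eq {x z : X} (hz : Γ.nbr m x = z) (r : Path x z)
    (hr : ∀ s, r s = Γ.radFun m x s) : Γ.base hm p x = (p z).cls.trans r.cls.symm := by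
  subst hz
  have : r = Γ.rad hm x := by ext s; exact hr s
  rw [this, base]

theorem base_of_mem_verts {x : X} (hx : x ∈ Γ.verts) : Γ.base hm p x = (p x).cls := by
  rw [Γ.base_eq hm p (Γ.nbr_of_mem_verts m hx) (Path.refl x)
    fun s => (Γ.radFun_of_mem_verts m hx s).symm]
  exact trans_refl _

theorem base_char_of_le {e : E} {t : ℝ} (ht : t ≤ m e) :
    Γ.base hm p (Γ.char e t) = (p (Γ.char e 0)).cls.trans (Γ.seg e 0 t).cls := by
  let τ : Path t 0 := ⟨⟨fun s : I => (1 - (s : ℝ)) * t, by fun_prop⟩, by simp, by simp⟩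
  rw [Γ.base_eq hm p (by rw [Γ.nbr_char hm, if_pos ht]) (τ.map (Γ.continuous_char e))
    fun s => by rw [Γ.radFun_char hm, if_pos ht]; rfl, ← mk_symm, ← Γ.cls_map_char e τ.symm]
  rfl

theorem base_char_of_lt {e : E} {t : ℝ} (ht : m e < t) :
    Γ.base hm p (Γ.char e t) = (p (Γ.char e 1)).cls.trans (Γ.seg e 1 t).cls := by
  let τ : Path t 1 := ⟨⟨fun s : I => (1 - (s : ℝ)) * t + s, by fun_prop⟩, by simp, by simp⟩
  rw [Γ.base_eq hm p (by rw [Γ.nbr_char hm, if_neg (not_le.2 ht)]) (τ.map (Γ.continuous_char e))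
    fun s => by rw [Γ.radFun_char hm, if_neg (not_le.2 ht)]; rfl, ← mk_symm,
    ← Γ.cls_map_char e τ.symm]
  rfl

/-- The loop at the base point obtained by closing up a path; it is inverted so as to be
multiplicative for the composition of paths. -/
noncomputable def val {x y : X} (c : Path.Homotopic.Quotient x y) : FundamentalGroup X x₀ :=
  ((Γ.base hm p y).trans c.symm).trans (Γ.base hm p x).symm

theorem val_trans {x y z : X} (a : Path.Homotopic.Quotient x y)
    (b : Path.Homotopic.Quotient y z) :
    Γ.val hm p (a.trans b) = Γ.val hm p a * Γ.val hm p b := by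
  simp only [val, FundamentalGroup.mul_def, trans_assoc, symm_trans_rev, symm_trans_cancel]

theorem val_refl (x : X) : Γ.val hm p (refl x) = 1 := by
  simp only [val, FundamentalGroup.one_def, symm_refl, trans_assoc, refl_trans, trans_symm]

theorem val_symm {x y : X} (a : Path.Homotopic.Quotient x y) :
    Γ.val hm p a.symm = (Γ.val hm p a)⁻¹ := by
  rw [eq_inv_iff_mul_eq_one, ← val_trans, symm_trans, val_refl]

/-- `val` only composes the reversed class with fixed invertible classes. -/
theorem val_injective {x y : X} {a b : Path.Homotopic.Quotient x y}
    (h : Γ.val hm p a = Γ.val hm p b) : a = b := by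
  have := trans_left_cancel _ (trans_right_cancel _ h)
  rw [← symm_symm' a, this, symm_symm']

/-- The loop at the base point through a given edge. -/
noncomputable def edgeLoop (e : E) : FundamentalGroup X x₀ :=
  ((p (Γ.char e 1)).cls.trans (Γ.seg e 0 1).cls.symm).trans (p (Γ.char e 0)).cls.symm

/-- The homomorphism from the free group on the edges sending each edge to its loop. -/
noncomputable def loopHom : FreeGroup E →* FundamentalGroup X x₀ :=
  FreeGroup.lift (Γ.edgeLoop p)

/-- Contracting radially away from the cuts turns the path into a path of vertices, which is
constant. -/
theorem val_of_cutCompl {x y : X} (γ : Path x y) (h : ∀ t, γ t ∈ Γ.cutCompl m) :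
    Γ.nbr m x = Γ.nbr m y ∧ Γ.val hm p γ.cls = 1 := by
  obtain ⟨c, hc, hcγ⟩ := Γ.exists_trans_rad hm γ h
  have hxy : Γ.nbr m x = Γ.nbr m y := by rw [← hc 1, c.target]
  refine ⟨hxy, ?_⟩
  have hγ : γ.cls = (Γ.rad hm x).cls.trans (c.cls.trans (Γ.rad hm y).cls.symm) := by
    rw [← trans_assoc, ← hcγ, trans_assoc, trans_symm, trans_refl]
  have hc' : ∀ {a b : X} (q : Path a b), (∀ t, q t = a) →
      (p b).cls.trans (q.cls.symm.trans (p a).cls.symm) = refl x₀ := by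
    intro a b q hq
    have hab : a = b := by rw [← hq 1, q.target]
    subst hab
    have : q = Path.refl a := by ext t; exact hq t
    rw [this]
    exact (congrArg _ (refl_trans _)).trans (trans_symm _)
  rw [val, hγ]
  simp only [base, symm_trans_rev, symm_symm', trans_assoc, symm_trans_cancel]
  exact hc' c hc

theorem seg_self (e : E) (a : ℝ) : (Γ.seg e a a).cls = Path.Homotopic.Quotient.refl _ := by
  rw [← Γ.cls_map_char e (Path.refl a)]
  rfl

theorem seg_symm (e : E) (a b : ℝ) : (Γ.seg e a b).cls.symm = (Γ.seg e b a).cls := by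
  rw [← mk_symm, ← Γ.cls_map_char e (Path.segment a b).symm]
  rfl

theorem seg_trans_assoc (e : E) (a b c : ℝ) {z : X}
    (q : Path.Homotopic.Quotient (Γ.char e c) z) :
    (Γ.seg e a b).cls.trans ((Γ.seg e b c).cls.trans q) = (Γ.seg e a c).cls.trans q := by
  rw [← trans_assoc, seg_trans]

/-- Only the sides of the cut on which the two ends lie matter. If they differ, one letter is read,
and the intermediate value theorem puts the cut point on the path. -/
theorem val_of_openEdge {x y : X} (γ : Path x y) (e : E) (h : ∀ t, γ t ∈ Γ.openEdge e) :
    ∃ L, Γ.IsWalk (Γ.nbr m x) L (Γ.nbr m y) ∧ (∀ q ∈ L, Γ.char q.1 (m q.1) ∈ Set.range γ) ∧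
      Γ.loopHom p (FreeGroup.mk L) = Γ.val hm p γ.cls := by
  obtain ⟨τ, hτ, hγ⟩ := Γ.exists_eq_map_char e γ h
  obtain rfl : Γ.char e (τ 0) = x := by rw [← hγ, γ.source]
  obtain rfl : Γ.char e (τ 1) = y := by rw [← hγ, γ.target]
  have hγ' : γ = Path.map (⟨τ, rfl, rfl⟩ : Path (τ 0) (τ 1)) (Γ.continuous_char e) := by
    ext t; exact hγ t
  have hseg : γ.cls = (Γ.seg e (τ 0) (τ 1)).cls := by rw [hγ', cls_map_char]
  have hcross : m e ∈ Set.uIcc (τ 0) (τ 1) → Γ.char e (m e) ∈ Set.range γ := by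
    intro hme
    obtain ⟨t, -, ht⟩ := intermediate_value_uIcc (f := τ) (a := 0) (b := 1)
      τ.continuous.continuousOn hme
    exact ⟨t, by rw [hγ, ht]⟩
  have hval : ∀ {a b : ℝ} {q : Path.Homotopic.Quotient x₀ (Γ.char e a)}
      {q' : Path.Homotopic.Quotient x₀ (Γ.char e b)},
      Γ.base hm p (Γ.char e (τ 0)) = q.trans (Γ.seg e a (τ 0)).cls →
      Γ.base hm p (Γ.char e (τ 1)) = q'.trans (Γ.seg e b (τ 1)).cls →
      Γ.val hm p γ.cls = (q'.trans (Γ.seg e b a).cls).trans q.symm := by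
    intro a b q q' h0 h1
    rw [val, hseg, h0, h1]
    simp only [symm_trans_rev, seg_symm, trans_assoc, seg_trans_assoc]
  rcases le_or_gt (τ 0) (m e) with h0 | h0 <;> rcases le_or_gt (τ 1) (m e) with h1 | h1
  · refine ⟨[], by simp [IsWalk, Γ.nbr_char hm, h0, h1], by simp, ?_⟩
    rw [hval (Γ.base_char_of_le hm p h0) (Γ.base_char_of_le hm p h1), seg_self, trans_refl,
      trans_symm]
    exact _root_.map_one _
  · refine ⟨[(e, true)], by simp [IsWalk, Γ.nbr_char hm, h0, not_le.2 h1, start, fin],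
      by simpa using hcross (Set.mem_uIcc.2 (Or.inl ⟨h0, h1.le⟩)), ?_⟩
    rw [hval (Γ.base_char_of_le hm p h0) (Γ.base_char_of_lt hm p h1), ← seg_symm]
    exact FreeGroup.lift_apply_of
  · refine ⟨[(e, false)], by simp [IsWalk, Γ.nbr_char hm, h1, not_le.2 h0, start, fin],
      by simpa using hcross (Set.mem_uIcc.2 (Or.inr ⟨h1, h0.le⟩)), ?_⟩
    rw [hval (Γ.base_char_of_lt hm p h0) (Γ.base_char_of_le hm p h1)]
    have : FreeGroup.mk [(e, false)] = (FreeGroup.of e)⁻¹ := rfl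
    rw [this, _root_.map_inv, loopHom, FreeGroup.lift_apply_of, edgeLoop, FundamentalGroup.inv_def]
    simp only [symm_trans_rev, symm_symm', trans_assoc]
  · refine ⟨[], by simp [IsWalk, Γ.nbr_char hm, not_le.2 h0, not_le.2 h1], by simp, ?_⟩
    rw [hval (Γ.base_char_of_lt hm p h0) (Γ.base_char_of_lt hm p h1), seg_self, trans_refl,
      trans_symm]
    exact _root_.map_one _

/-- Subdivide so that each piece avoids all cuts or stays in one open edge. A letter is read only
where the path meets the cut point of its edge, and the choice of cut points is still free. -/
theorem exists_walk_val {x y : X} (γ : Path x y) :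
    ∃ L, Γ.IsWalk (Γ.nbr m x) L (Γ.nbr m y) ∧ (∀ q ∈ L, Γ.char q.1 (m q.1) ∈ Set.range γ) ∧
      Γ.loopHom p (FreeGroup.mk L) = Γ.val hm p γ.cls := by
  refine Path.cls_induction_cover (U := fun i : Option E => i.elim (Γ.cutCompl m) Γ.openEdge)
    ?_ ?_ (Set.range γ) (fun x y c => ∃ L, Γ.IsWalk (Γ.nbr m x) L (Γ.nbr m y) ∧
      (∀ q ∈ L, Γ.char q.1 (m q.1) ∈ Set.range γ) ∧
      Γ.loopHom p (FreeGroup.mk L) = Γ.val hm p c) ?_ ?_ γ subset_rfl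
  · rintro (- | e)
    exacts [Γ.isOpen_cutCompl hm, Γ.isOpen_openEdge e]
  · intro x
    by_cases hx : x ∈ Γ.cutCompl m
    · exact ⟨none, hx⟩
    · simp only [cutCompl, Set.mem_ofPred_eq, not_forall, not_not] at hx
      obtain ⟨e, he⟩ := hx
      exact ⟨some e, m e, hm e, he.symm⟩
  · rintro x y z a b ⟨L, h1, h2, h3⟩ ⟨L', h1', h2', h3'⟩
    refine ⟨L ++ L', Γ.isWalk_append.2 ⟨_, h1, h1'⟩, fun q hq => ?_, ?_⟩
    · rcases List.mem_append.1 hq with h | h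
      exacts [h2 q h, h2' q h]
    · rw [← FreeGroup.mul_mk, _root_.map_mul, h3, h3', val_trans]
  · rintro x y δ (- | e) h1 h2
    · obtain ⟨h3, h4⟩ := Γ.val_of_cutCompl hm p δ (Set.range_subset_iff.1 h2)
      exact ⟨[], h3, by simp, by rw [h4]; exact _root_.map_one _⟩
    · obtain ⟨L, h3, h4, h5⟩ := Γ.val_of_openEdge hm p δ e (Set.range_subset_iff.1 h2)
      exact ⟨L, h3, fun q hq => h1 (h4 q hq), h5⟩

end TopGraph

end

/-! ### The covering with fiber the free group on the edges, and its monodromy. -/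

section

open scoped unitInterval

namespace TopGraph

open Path.Homotopic.Quotient

variable {X E : Type*} [TopologicalSpace X] (Γ : TopGraph X E)

/-- The midpoints of the edges. -/
noncomputable def mid : E → ℝ := fun _ => 1 / 2

theorem isCut_mid : IsCut (mid (E := E)) := fun _ => by norm_num [mid]

open Classical in
/-- The letter of the edge containing a point, if that point lies on its second half. -/
noncomputable def side (x : X) : FreeGroup E :=
  if h : ∃ q : E × ℝ, q.2 ∈ Set.Ioo (0 : ℝ) 1 ∧ Γ.char q.1 q.2 = x then
    if h.choose.2 ≤ 1 / 2 then 1 else FreeGroup.of h.choose.1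
  else 1

theorem side_char (e : E) {t : ℝ} (ht : t ∈ Set.Ioo (0 : ℝ) 1) :
    Γ.side (Γ.char e t) = if t ≤ 1 / 2 then 1 else FreeGroup.of e := by
  have h : ∃ q : E × ℝ, q.2 ∈ Set.Ioo (0 : ℝ) 1 ∧ Γ.char q.1 q.2 = Γ.char e t := ⟨(e, t), ht, rfl⟩
  obtain ⟨h1, h2⟩ := Γ.char_inj _ _ _ h.choose_spec.1 _ ht h.choose_spec.2
  rw [side, dif_pos h]
  simp only [h1, h2]

/-- The base sets of the two charts of the covering: the complement of the midpoints and the union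
of the open edges. -/
def chartSet (i : Bool) : Set X := if i then Γ.cutCompl mid else ⋃ e, Γ.openEdge e

theorem char_mem_chartSet_true {e : E} {t : ℝ} : Γ.char e t ∈ Γ.chartSet true ↔ t ≠ 1 / 2 :=
  Γ.char_mem_cutCompl isCut_mid

theorem char_mem_chartSet_false {e : E} {t : ℝ} :
    Γ.char e t ∈ Γ.chartSet false ↔ t ∈ Set.Ioo (0 : ℝ) 1 := by
  constructor
  · intro h
    obtain ⟨e', s, hs, hst⟩ := Set.mem_iUnion.1 h
    by_contra ht
    rw [← Γ.char_mem_verts_iff (e := e), ← hst] at ht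
    exact Γ.char_notMem _ _ hs ht
  · exact fun h => Set.mem_iUnion.2 ⟨e, t, h, rfl⟩

theorem isOpen_chartSet (i : Bool) : IsOpen (Γ.chartSet i) := by
  cases i
  · exact isOpen_iUnion Γ.isOpen_openEdge
  · exact Γ.isOpen_cutCompl isCut_mid

/-- The discrete topology on the fiber. -/
local instance : TopologicalSpace (FreeGroup E) := ⊥

local instance : DiscreteTopology (FreeGroup E) := ⟨rfl⟩

theorem continuousOn_side : ContinuousOn Γ.side (Γ.chartSet true ∩ Γ.chartSet false) := by
  refine (continuousOn_open_iff ((Γ.isOpen_chartSet _).inter (Γ.isOpen_chartSet _))).2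
    fun W _ => Γ.isOpen_of_preimage _ fun e => ?_
  have : Γ.char e ⁻¹' (Γ.chartSet true ∩ Γ.chartSet false ∩ Γ.side ⁻¹' W) =
      {t | t ∈ Set.Ioo (0 : ℝ) (1 / 2) ∧ 1 ∈ W} ∪
        {t | t ∈ Set.Ioo (1 / 2 : ℝ) 1 ∧ FreeGroup.of e ∈ W} := by
    ext t
    simp only [Set.mem_preimage, Set.mem_inter_iff, char_mem_chartSet_true,
      char_mem_chartSet_false, Set.mem_union, Set.mem_ofPred_eq]
    constructor
    · rintro ⟨⟨h1, h2⟩, h3⟩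
      rw [Γ.side_char e h2] at h3
      rcases lt_or_gt_of_ne h1 with h | h
      · exact Or.inl ⟨⟨h2.1, h⟩, by rwa [if_pos h.le] at h3⟩
      · exact Or.inr ⟨⟨h, h2.2⟩, by rwa [if_neg (not_le.2 h)] at h3⟩
    · rintro (⟨h, h3⟩ | ⟨h, h3⟩)
      · have h2 : t ∈ Set.Ioo (0 : ℝ) 1 := ⟨h.1, h.2.trans (by norm_num)⟩
        exact ⟨⟨h.2.ne, h2⟩, by rwa [Γ.side_char e h2, if_pos h.2.le]⟩
      · have h2 : t ∈ Set.Ioo (0 : ℝ) 1 := ⟨lt_trans (by norm_num) h.1, h.2⟩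
        exact ⟨⟨h.1.ne', h2⟩, by rwa [Γ.side_char e h2, if_neg (not_le.2 h.1)]⟩
  rw [this]
  refine IsOpen.union ?_ ?_
  · by_cases h : (1 : FreeGroup E) ∈ W <;> simp [h]
    exact isOpen_Ioo
  · by_cases h : FreeGroup.of e ∈ W <;> simp [h]
    exact isOpen_Ioo

/-- The transition from the reference chart to the chart `i`. -/
noncomputable def weight (i : Bool) (x : X) : FreeGroup E := if i then 1 else (Γ.side x)⁻¹

open Classical in
/-- The covering of the graph with fiber the free group on the edges, on which crossing the midpoint
of an edge multiplies by its letter. -/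
noncomputable def coveringCore : FiberBundleCore Bool X (FreeGroup E) where
  baseSet := Γ.chartSet
  isOpen_baseSet := Γ.isOpen_chartSet
  indexAt x := decide (x ∈ Γ.chartSet true)
  mem_baseSet_at x := by
    by_cases h : x ∈ Γ.chartSet true
    · simp [h]
    · simp only [h, decide_false]
      have h' : ¬ ∀ e, x ≠ Γ.char e (mid e) := h
      simp only [not_forall, not_not] at h'
      obtain ⟨e, he⟩ := h'
      exact Set.mem_iUnion.2 ⟨e, _, isCut_mid e, he.symm⟩
  -- The transition is a quotient of weights, so the cocycle identities are formal. Only the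
  -- continuity of `side` on the overlap of the charts carries content.
  coordChange i j x v := v * (Γ.weight i x)⁻¹ * Γ.weight j x
  coordChange_self i x _ v := by group
  coordChange_comp i j k x _ v := by group
  continuousOn_coordChange i j := by
    have hmul : Continuous fun q : FreeGroup E × FreeGroup E => q.1 * q.2 :=
      continuous_of_discreteTopology
    have key : ContinuousOn (fun x => (Γ.weight i x)⁻¹ * Γ.weight j x)
        (Γ.chartSet i ∩ Γ.chartSet j) := by
      have hinv : Continuous fun q : FreeGroup E => q⁻¹ := continuous_of_discreteTopology
      rcases i with - | - <;> rcases j with - | -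
      · simpa [weight] using continuousOn_const
      · rw [Set.inter_comm]
        simpa [weight] using Γ.continuousOn_side
      · simpa [weight, Function.comp_def] using hinv.comp_continuousOn Γ.continuousOn_side
      · simpa [weight] using continuousOn_const
    simp only [mul_assoc]
    exact hmul.comp_continuousOn (continuousOn_snd.prodMk
      (key.comp continuousOn_fst fun q hq => hq.1))

theorem isCoveringMap_proj : IsCoveringMap Γ.coveringCore.proj :=
  FiberBundle.isCoveringMap (F := FreeGroup E) (E := Γ.coveringCore.Fiber)

/-- The monodromy of a path class, in the reference coordinates. -/
noncomputable def mono {x y : X} (c : Path.Homotopic.Quotient x y) (f : FreeGroup E) :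
    FreeGroup E :=
  (Γ.isCoveringMap_proj.monodromy c ⟨(⟨x, f⟩ : Γ.coveringCore.TotalSpace), rfl⟩).1.2

theorem monodromy_eq {x y : X} (c : Path.Homotopic.Quotient x y) (f : FreeGroup E) :
    Γ.isCoveringMap_proj.monodromy c ⟨(⟨x, f⟩ : Γ.coveringCore.TotalSpace), rfl⟩ =
      ⟨(⟨y, Γ.mono c f⟩ : Γ.coveringCore.TotalSpace), rfl⟩ := by
  rw [mono]
  generalize Γ.isCoveringMap_proj.monodromy c ⟨(⟨x, f⟩ : Γ.coveringCore.TotalSpace), rfl⟩ = q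
  obtain ⟨⟨y', g⟩, h⟩ := q
  have h' : y' = y := h
  subst h'
  rfl

theorem mono_trans {x y z : X} (a : Path.Homotopic.Quotient x y)
    (b : Path.Homotopic.Quotient y z) (f : FreeGroup E) :
    Γ.mono (a.trans b) f = Γ.mono b (Γ.mono a f) := by
  rw [mono, IsCoveringMap.monodromy_trans_apply, monodromy_eq]
  rfl

theorem mono_refl (x : X) (f : FreeGroup E) :
    Γ.mono (Path.Homotopic.Quotient.refl x) f = f := by
  rw [mono, IsCoveringMap.monodromy_refl]
  rfl

/-- The lift of an edge to the covering. -/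
noncomputable def edgeLift (e : E) (f : FreeGroup E) (t : ℝ) : Γ.coveringCore.TotalSpace :=
  ⟨Γ.char e t, if t ≤ 1 / 2 then f else f * FreeGroup.of e⟩

/-- The jump of the coordinate past the midpoint is exactly the change of chart: in the chart of the
open edges the lift is constantly `f`. -/
theorem continuous_edgeLift (e : E) (f : FreeGroup E) : Continuous (Γ.edgeLift e f) := by
  have hloc : ∀ (i : Bool) (A : Set ℝ) (v : FreeGroup E), (∀ t ∈ A, Γ.char e t ∈ Γ.chartSet i) →
      (∀ t ∈ A, Γ.coveringCore.coordChange i (Γ.coveringCore.indexAt (Γ.char e t)) (Γ.char e t) v =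
        if t ≤ 1 / 2 then f else f * FreeGroup.of e) → ContinuousOn (Γ.edgeLift e f) A := by
    intro i A v h1 h2
    have h3 : ContinuousOn (fun t => (Γ.coveringCore.localTriv i).toOpenPartialHomeomorph.symm
        (Γ.char e t, v)) A := by
      refine (Γ.coveringCore.localTriv i).toOpenPartialHomeomorph.continuousOn_symm.comp
        ((Γ.continuous_char e).prodMk continuous_const).continuousOn fun t ht => ?_
      exact (Γ.coveringCore.mem_localTriv_target i _).2 (h1 t ht)
    refine h3.congr fun t ht => ?_
    change _ = (Γ.coveringCore.localTriv i).toOpenPartialHomeomorph.symm (Γ.char e t, v)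
    rw [FiberBundleCore.localTriv_symm_apply]
    exact (congrArg _ (h2 t ht)).symm
  have hidx : ∀ t, t ≠ 1 / 2 → Γ.coveringCore.indexAt (Γ.char e t) = true := fun t ht => by
    simpa [coveringCore] using Γ.char_mem_chartSet_true.2 ht
  have hidx' : ∀ t, t = 1 / 2 → Γ.coveringCore.indexAt (Γ.char e t) = false := fun t ht => by
    simp only [coveringCore, decide_eq_false_iff_not, char_mem_chartSet_true]
    exact not_not.2 ht
  rw [continuous_iff_continuousAt]
  intro t
  rcases lt_trichotomy t (1 / 2) with h | h | h
  · refine (hloc true (Set.Iio (1 / 2)) f (fun s hs => Γ.char_mem_chartSet_true.2 (ne_of_lt hs))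
      fun s hs => ?_).continuousAt (isOpen_Iio.mem_nhds h)
    rw [hidx s (ne_of_lt hs), if_pos (le_of_lt hs)]
    simp [coveringCore, weight]
  · refine (hloc false (Set.Ioo 0 1) f (fun s hs => Γ.char_mem_chartSet_false.2 hs)
      fun s hs => ?_).continuousAt (isOpen_Ioo.mem_nhds (by rw [h]; norm_num))
    rcases lt_trichotomy s (1 / 2) with h1 | h1 | h1
    · rw [hidx s h1.ne, if_pos h1.le]
      simp only [coveringCore, weight, Γ.side_char e hs, if_pos h1.le]
      simp
    · rw [hidx' s h1, if_pos h1.le]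
      simp only [coveringCore, weight, Γ.side_char e hs, if_pos h1.le]
      simp
    · rw [hidx s h1.ne', if_neg (not_le.2 h1)]
      simp only [coveringCore, weight, Γ.side_char e hs, if_neg (not_le.2 h1)]
      simp
  · refine (hloc true (Set.Ioi (1 / 2)) (f * FreeGroup.of e)
      (fun s hs => Γ.char_mem_chartSet_true.2 (ne_of_gt hs))
      fun s hs => ?_).continuousAt (isOpen_Ioi.mem_nhds h)
    rw [hidx s (ne_of_gt hs), if_neg (not_le.2 hs)]
    simp [coveringCore, weight]

theorem mono_seg (e : E) (f : FreeGroup E) :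
    Γ.mono (Γ.seg e 0 1).cls f = f * FreeGroup.of e := by
  let γ : Path (Γ.edgeLift e f 0) (Γ.edgeLift e f 1) :=
    (Path.segment (0 : ℝ) 1).map (Γ.continuous_edgeLift e f)
  have h := Γ.isCoveringMap_proj.monodromy_map γ.cls
  have h0 : Γ.edgeLift e f 0 = ⟨Γ.char e 0, f⟩ := by simp [edgeLift]
  have h1 : Γ.edgeLift e f 1 = ⟨Γ.char e 1, f * FreeGroup.of e⟩ :=
    congrArg (Bundle.TotalSpace.mk (Γ.char e 1)) (if_neg (by norm_num))
  have h2 : (γ.cls.map ⟨Γ.coveringCore.proj, Γ.isCoveringMap_proj.continuous⟩) =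
    (Γ.seg e 0 1).cls := rfl
  rw [h2] at h
  have h3 := Γ.monodromy_eq (Γ.seg e 0 1).cls f
  have h4 : (⟨Γ.edgeLift e f 0, rfl⟩ : Γ.coveringCore.proj ⁻¹' {Γ.char e 0}) =
    ⟨⟨Γ.char e 0, f⟩, rfl⟩ := Subtype.ext h0
  have h5 : (⟨Γ.edgeLift e f 1, rfl⟩ : Γ.coveringCore.proj ⁻¹' {Γ.char e 1}) =
    ⟨⟨Γ.char e 1, f * FreeGroup.of e⟩, rfl⟩ := Subtype.ext h1
  have h6 := (h3.symm.trans (congrArg _ h4.symm)).trans (h.trans h5)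
  have h7 := congrArg Subtype.val h6
  exact eq_of_heq (Bundle.TotalSpace.mk.inj h7).2

theorem mono_seg_symm (e : E) (f : FreeGroup E) :
    Γ.mono (Γ.seg e 1 0).cls f = f * (FreeGroup.of e)⁻¹ := by
  have h := Γ.mono_trans (Γ.seg e 0 1).cls (Γ.seg e 1 0).cls (f * (FreeGroup.of e)⁻¹)
  rw [seg_trans, seg_self, mono_refl, mono_seg, inv_mul_cancel_right] at h
  exact h.symm

end TopGraph

end

/-! ### Words of path classes. -/

section

open scoped unitInterval

namespace TopGraph

open Path.Homotopic.Quotient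

variable {X E : Type*} [TopologicalSpace X] (Γ : TopGraph X E)

/-- The word in the free group on the edges read along a path class. -/
noncomputable def word {x y : X} (c : Path.Homotopic.Quotient x y) : FreeGroup E := Γ.mono c 1

theorem val_seg {m : E → ℝ} (hm : IsCut m) {x₀ : X} (p : ∀ x, Path x₀ x) (e : E) :
    Γ.val hm p (Γ.seg e 0 1).cls = Γ.loopHom p (FreeGroup.of e) := by
  rw [val, Γ.base_of_mem_verts hm p (Γ.zero_mem e), Γ.base_of_mem_verts hm p (Γ.one_mem e),
    loopHom, FreeGroup.lift_apply_of, edgeLoop]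

theorem exists_edge_path (q : E × Bool) :
    ∃ δ : Path (Γ.start q) (Γ.fin q), Set.range δ ⊆ Γ.char q.1 '' Set.Icc 0 1 ∧
      (∀ f, Γ.mono δ.cls f = f * FreeGroup.mk [q]) ∧
      ∀ (m : E → ℝ) (hm : IsCut m) (x₀ : X) (p : ∀ x, Path x₀ x),
        Γ.val hm p δ.cls = Γ.loopHom p (FreeGroup.mk [q]) := by
  have hr : ∀ (e : E) {a b : ℝ}, a ∈ Set.Icc (0 : ℝ) 1 → b ∈ Set.Icc (0 : ℝ) 1 →
      Set.range (Γ.seg e a b) ⊆ Γ.char e '' Set.Icc 0 1 := by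
    rintro e a b ha hb _ ⟨t, rfl⟩
    refine ⟨Path.segment a b t, ?_, rfl⟩
    have h := (convex_Icc (𝕜 := ℝ) (0 : ℝ) 1).segment_subset ha hb
    rw [← Path.range_segment] at h
    exact h ⟨t, rfl⟩
  rcases q with ⟨e, - | -⟩
  · refine ⟨(Γ.seg e 1 0 : Path (Γ.char e 1) (Γ.char e 0)), hr e (by simp) (by simp),
      fun f => Γ.mono_seg_symm e f, fun m hm x₀ p => ?_⟩
    have h : Γ.val hm p (Γ.seg e 1 0).cls = Γ.loopHom p (FreeGroup.of e)⁻¹ := by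
      rw [← seg_symm, val_symm, val_seg, ← _root_.map_inv]
    exact h
  · exact ⟨(Γ.seg e 0 1 : Path (Γ.char e 0) (Γ.char e 1)), hr e (by simp) (by simp),
      fun f => Γ.mono_seg e f, fun m hm x₀ p => Γ.val_seg hm p e⟩

/-- One path serves for every cut and every choice of base paths, so that results obtained with
different cuts can be compared. -/
theorem exists_path_of_isWalk' {L : List (E × Bool)} {u u' : X} (h : Γ.IsWalk u L u') :
    ∃ δ : Path u u', (∀ Y : Set X, u ∈ Y → (∀ q ∈ L, Γ.char q.1 '' Set.Icc 0 1 ⊆ Y) →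
        Set.range δ ⊆ Y) ∧
      (∀ f, Γ.mono δ.cls f = f * FreeGroup.mk L) ∧
      ∀ (m : E → ℝ) (hm : IsCut m) (x₀ : X) (p : ∀ x, Path x₀ x),
        Γ.val hm p δ.cls = Γ.loopHom p (FreeGroup.mk L) := by
  induction L generalizing u with
  | nil =>
    obtain rfl : u = u' := h
    refine ⟨Path.refl u, ?_, fun f => ?_, fun m hm x₀ p => ?_⟩
    · rintro Y hu - _ ⟨t, rfl⟩
      exact hu
    · exact (Γ.mono_refl u f).trans (mul_one f).symm
    · exact (Γ.val_refl hm p u).trans (_root_.map_one _).symm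
  | cons q L ih =>
    obtain ⟨rfl, hL⟩ := h
    obtain ⟨δ, h1, h2, h3⟩ := ih hL
    obtain ⟨ε, h1', h2', h3'⟩ := Γ.exists_edge_path q
    have hcons : FreeGroup.mk (q :: L) = FreeGroup.mk [q] * FreeGroup.mk L := rfl
    refine ⟨ε.trans δ, fun Y hu hY => ?_, fun f => ?_, fun m hm x₀ p => ?_⟩
    · have hε : Set.range ε ⊆ Y := h1'.trans (hY q (by simp))
      rw [Path.trans_range]
      exact Set.union_subset hε (h1 Y (hε ⟨1, ε.target⟩) fun q' hq' => hY q' (by simp [hq']))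
    · refine (Γ.mono_trans ε.cls δ.cls f).trans ?_
      rw [h2', h2, hcons, mul_assoc]
    · refine (Γ.val_trans hm p ε.cls δ.cls).trans ?_
      rw [h3', h3, hcons, _root_.map_mul]

theorem char_image_Icc_subset {K : Set X} (hK : IsClosed K) {e : E}
    (h : ∀ t ∈ Set.Ioo (0 : ℝ) 1, Γ.char e t ∈ K) : Γ.char e '' Set.Icc 0 1 ⊆ K := by
  rintro _ ⟨t, ht, rfl⟩
  have : closure (Set.Ioo (0 : ℝ) 1) ⊆ Γ.char e ⁻¹' K :=
    closure_minimal h (hK.preimage (Γ.continuous_char e))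
  rw [closure_Ioo (by norm_num)] at this
  exact this ht

/-- A walk is realized by a path in any set containing its origin and its edges. -/
theorem exists_path_of_isWalk {L : List (E × Bool)} {u u' : X} (h : Γ.IsWalk u L u') {Y : Set X}
    (hu : u ∈ Y) (hY : ∀ q ∈ L, Γ.char q.1 '' Set.Icc 0 1 ⊆ Y) :
    ∃ δ : Path u u', Set.range δ ⊆ Y ∧ Γ.word δ.cls = FreeGroup.mk L := by
  obtain ⟨δ, h1, h2, -⟩ := Γ.exists_path_of_isWalk' h
  exact ⟨δ, h1 Y hu hY, by rw [word, h2, one_mul]⟩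

variable [T2Space X] [PathConnectedSpace X]

/-- A path is homotopic to the walk it reads with respect to any cut. The cut here is adapted to `γ`
so that only edges completely covered by `γ` are read. -/
theorem exists_walk' {u u' : X} (hu : u ∈ Γ.verts) (hu' : u' ∈ Γ.verts) (γ : Path u u') :
    ∃ L, Γ.IsWalk u L u' ∧ (∀ q ∈ L, Γ.char q.1 '' Set.Icc 0 1 ⊆ Set.range γ) ∧
      (∀ f, Γ.mono γ.cls f = f * FreeGroup.mk L) ∧
      ∀ (x₀ : X) (p : ∀ x, Path x₀ x), Γ.val isCut_mid p γ.cls = Γ.loopHom p (FreeGroup.mk L) := by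
  classical
  -- The cut point of an edge is put off `γ` whenever `γ` misses some interior point of it; the
  -- value 1/2 is used only for edges whose interior is covered.
  let m : E → ℝ := fun e => if h : ∃ t ∈ Set.Ioo (0 : ℝ) 1, Γ.char e t ∉ Set.range γ then h.choose
    else 1 / 2
  have hm : IsCut m := by
    intro e
    by_cases h : ∃ t ∈ Set.Ioo (0 : ℝ) 1, Γ.char e t ∉ Set.range γ
    · simp only [m, dif_pos h]
      exact h.choose_spec.1
    · simp only [m, dif_neg h]
      norm_num
  have hsub : ∀ e, Γ.char e (m e) ∈ Set.range γ → Γ.char e '' Set.Icc 0 1 ⊆ Set.range γ := by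
    intro e he
    refine Γ.char_image_Icc_subset (isCompact_range γ.continuous).isClosed ?_
    by_contra! h
    simp only [m, dif_pos h] at he
    exact h.choose_spec.2 he
  let p : ∀ x, Path u x := fun x => PathConnectedSpace.somePath u x
  obtain ⟨L, h1, h2, h3⟩ := Γ.exists_walk_val hm p γ
  rw [Γ.nbr_of_mem_verts m hu, Γ.nbr_of_mem_verts m hu'] at h1
  obtain ⟨δ, -, h4, h5⟩ := Γ.exists_path_of_isWalk' h1
  have hγ : γ.cls = δ.cls := Γ.val_injective hm p (by rw [← h3, h5])
  exact ⟨L, h1, fun q hq => hsub _ (h2 q hq), fun f => by rw [hγ, h4],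
    fun x₀ p => by rw [hγ, h5]⟩

/-- A path between vertices reads the word of a walk along edges that it covers. -/
theorem exists_walk {u u' : X} (hu : u ∈ Γ.verts) (hu' : u' ∈ Γ.verts) (γ : Path u u') :
    ∃ L, Γ.IsWalk u L u' ∧ (∀ q ∈ L, Γ.char q.1 '' Set.Icc 0 1 ⊆ Set.range γ) ∧
      Γ.word γ.cls = FreeGroup.mk L := by
  obtain ⟨L, h1, h2, h3, -⟩ := Γ.exists_walk' hu hu' γ
  exact ⟨L, h1, h2, by rw [word, h3, one_mul]⟩

theorem word_trans {x y z : X} (hy : y ∈ Γ.verts) (hz : z ∈ Γ.verts)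
    (a : Path.Homotopic.Quotient x y) (b : Path.Homotopic.Quotient y z) :
    Γ.word (a.trans b) = Γ.word a * Γ.word b := by
  obtain ⟨a, rfl⟩ := Path.Homotopic.Quotient.mk_surjective a
  obtain ⟨b, rfl⟩ := Path.Homotopic.Quotient.mk_surjective b
  obtain ⟨L, -, -, h1, -⟩ := Γ.exists_walk' hy hz b
  rw [word, mono_trans, h1, word, word, h1, one_mul]

/-- `word` is a homotopy invariant by monodromy, and it determines `val` through `loopHom`; `val` in
turn determines the class. -/
theorem word_injective {x y : X} (hx : x ∈ Γ.verts) (hy : y ∈ Γ.verts)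
    {a b : Path.Homotopic.Quotient x y} (h : Γ.word a = Γ.word b) : a = b := by
  obtain ⟨a, rfl⟩ := Path.Homotopic.Quotient.mk_surjective a
  obtain ⟨b, rfl⟩ := Path.Homotopic.Quotient.mk_surjective b
  obtain ⟨L, -, -, h1, h2⟩ := Γ.exists_walk' hx hy a
  obtain ⟨L', -, -, h1', h2'⟩ := Γ.exists_walk' hx hy b
  rw [word, word, h1, h1', one_mul, one_mul] at h
  refine Γ.val_injective isCut_mid (fun z => PathConnectedSpace.somePath x z) ?_
  rw [h2, h2', h]

end TopGraph

end

/-! ### From CW complexes of dimension at most one to combinatorial graphs. -/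

section

/-- The parametrization of the one-dimensional ball by the unit interval, extended constantly. -/
noncomputable def ballParam (t : ℝ) : Fin 1 → ℝ := fun _ => 2 * max 0 (min 1 t) - 1

theorem continuous_ballParam : Continuous ballParam := by
  unfold ballParam
  fun_prop

theorem norm_ballParam (t : ℝ) : ‖ballParam t‖ = |2 * max 0 (min 1 t) - 1| := by
  rw [← Real.norm_eq_abs]
  exact pi_norm_const (ι := Fin 1) (2 * max 0 (min 1 t) - 1)

theorem ballParam_of_mem {t : ℝ} (ht : t ∈ Set.Icc (0 : ℝ) 1) :
    ballParam t = fun _ => 2 * t - 1 := by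
  unfold ballParam
  rw [min_eq_right ht.2, max_eq_right ht.1]

theorem ballParam_mem_closedBall (t : ℝ) : ballParam t ∈ Metric.closedBall 0 1 := by
  rw [mem_closedBall_zero_iff, norm_ballParam, abs_le]
  have h1 : max 0 (min 1 t) ≤ 1 := max_le zero_le_one (min_le_left _ _)
  have h2 : 0 ≤ max 0 (min 1 t) := le_max_left _ _
  constructor <;> linarith

theorem ballParam_mem_ball {t : ℝ} (ht : t ∈ Set.Ioo (0 : ℝ) 1) :
    ballParam t ∈ Metric.ball 0 1 := by
  rw [mem_ball_zero_iff, norm_ballParam, abs_lt, min_eq_right ht.2.le, max_eq_right ht.1.le]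
  constructor <;> linarith [ht.1, ht.2]

theorem exists_ballParam_eq {y : Fin 1 → ℝ} (hy : y ∈ Metric.closedBall 0 1) :
    ∃ t ∈ Set.Icc (0 : ℝ) 1, ballParam t = y := by
  have h0 : |y 0| ≤ 1 := by
    rw [mem_closedBall_zero_iff] at hy
    exact (norm_le_pi_norm y 0).trans hy
  have ht : (y 0 + 1) / 2 ∈ Set.Icc (0 : ℝ) 1 := by
    constructor <;> linarith [(abs_le.1 h0).1, (abs_le.1 h0).2]
  refine ⟨(y 0 + 1) / 2, ht, ?_⟩
  rw [ballParam_of_mem ht]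
  ext i
  rw [Subsingleton.elim i 0]
  ring

/-- A CW complex of dimension at most one, as a combinatorial graph with the weak topology. -/
theorem IsTopologicalGraph.exists_topGraph {X : Type u₅} [TopologicalSpace X]
    (h : IsTopologicalGraph X) : ∃ E : Type u₅, Nonempty (TopGraph X E) := by
  obtain ⟨hT2, cw, hcw⟩ := h
  have hcont : ∀ e : cw.cell 1, Continuous fun t => cw.map 1 e (ballParam t) := fun e =>
    (cw.continuousOn 1 e).comp_continuous continuous_ballParam ballParam_mem_closedBall
  have hvert : ∀ (e : cw.cell 1) (y : Fin 1 → ℝ), y ∈ Metric.sphere 0 1 →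
      cw.map 1 e y ∈ Set.range fun j : cw.cell 0 => cw.map 0 j 0 := by
    intro e y hy
    obtain ⟨I, hI⟩ := cw.mapsTo' 1 e
    have h1 := hI hy
    simp only [Set.mem_iUnion] at h1
    obtain ⟨m, hm, j, -, w, -, hw⟩ := h1
    -- The boundary of a 1-cell is covered by cells of dimension below one.
    obtain rfl : m = 0 := by omega
    exact ⟨j, by rw [← hw, Subsingleton.elim w 0]⟩
  have hdisj : ∀ {n n' : ℕ} {i : cw.cell n} {i' : cw.cell n'} {y : Fin n → ℝ} {y' : Fin n' → ℝ},
      y ∈ Metric.ball 0 1 → y' ∈ Metric.ball 0 1 → cw.map n i y = cw.map n' i' y' →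
      (⟨n, i⟩ : Σ n, cw.cell n) = ⟨n', i'⟩ := by
    intro n n' i i' y y' hy hy' heq
    by_contra hne
    exact Set.disjoint_left.1 (cw.pairwiseDisjoint' (Set.mem_univ _) (Set.mem_univ _) hne)
      ⟨y, hy, rfl⟩ ⟨y', hy', heq.symm⟩
  refine ⟨cw.cell 1, ⟨{
    char := fun e t => cw.map 1 e (ballParam t)
    verts := Set.range fun j : cw.cell 0 => cw.map 0 j 0
    continuous_char := hcont
    char_of_nonpos := fun e t ht => ?_
    char_of_one_le := fun e t ht => ?_
    zero_mem := fun e => hvert e _ ?_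
    one_mem := fun e => hvert e _ ?_
    char_notMem := ?_
    char_inj := ?_
    cover := ?_
    isOpen_of_preimage := ?_ }⟩⟩
  · congr 1
    unfold ballParam
    rw [min_eq_right (ht.trans zero_le_one), max_eq_left ht]
    norm_num
  · congr 1
    unfold ballParam
    rw [min_eq_left ht]
    norm_num
  · rw [mem_sphere_zero_iff_norm, norm_ballParam]
    norm_num
  · rw [mem_sphere_zero_iff_norm, norm_ballParam]
    norm_num
  · rintro e t ht ⟨j, hj⟩
    have := hdisj (by simp) (ballParam_mem_ball ht) hj
    simp at this
  · intro e e' t ht t' ht' heq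
    have h1 := hdisj (ballParam_mem_ball ht) (ballParam_mem_ball ht') heq
    obtain rfl : e = e' := eq_of_heq (Sigma.mk.inj h1).2
    refine ⟨rfl, ?_⟩
    have h2 := (cw.map 1 e).injOn (by rw [cw.source_eq]; exact ballParam_mem_ball ht)
      (by rw [cw.source_eq]; exact ballParam_mem_ball ht') heq
    rw [ballParam_of_mem ⟨ht.1.le, ht.2.le⟩, ballParam_of_mem ⟨ht'.1.le, ht'.2.le⟩] at h2
    have : 2 * t - 1 = 2 * t' - 1 := congrFun h2 0
    linarith
  · intro x
    have hx : x ∈ ⋃ (n : ℕ) (j : cw.cell n), cw.map n j '' Metric.closedBall 0 1 := by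
      rw [cw.union']
      trivial
    simp only [Set.mem_iUnion] at hx
    obtain ⟨n, j, y, hy, rfl⟩ := hx
    match n, j, y, hy with
    | 0, j, y, _ => exact Or.inl ⟨j, by rw [Subsingleton.elim y 0]⟩
    | 1, j, y, hy =>
      obtain ⟨t, ht, rfl⟩ := exists_ballParam_eq hy
      by_cases h : t ∈ Set.Ioo (0 : ℝ) 1
      · exact Or.inr ⟨j, t, h, rfl⟩
      · refine Or.inl (hvert j _ ?_)
        obtain rfl | rfl : t = 0 ∨ t = 1 := by
          by_contra! h'
          exact h ⟨lt_of_le_of_ne ht.1 h'.1.symm, lt_of_le_of_ne ht.2 h'.2⟩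
        all_goals
          rw [mem_sphere_zero_iff_norm, norm_ballParam]
          norm_num
    | n + 2, j, _, _ => exact ((hcw (n + 2) (by omega)).false j).elim
  · intro A hA
    rw [← isClosed_compl_iff]
    refine cw.closed' _ (Set.subset_univ _) fun n j => ?_
    match n, j with
    | 0, j =>
      refine Set.Subsingleton.isClosed fun x hx x' hx' => ?_
      obtain ⟨-, y, -, rfl⟩ := hx
      obtain ⟨-, y', -, rfl⟩ := hx'
      rw [Subsingleton.elim y y']
    | 1, j =>
      -- The trace on a closed 1-cell is the image of a compact set of parameters, hence closed.
      have : Aᶜ ∩ cw.map 1 j '' Metric.closedBall 0 1 =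
          (fun t => cw.map 1 j (ballParam t)) ''
            (Set.Icc 0 1 ∩ (fun t => cw.map 1 j (ballParam t)) ⁻¹' Aᶜ) := by
        ext x
        constructor
        · rintro ⟨hx, y, hy, rfl⟩
          obtain ⟨t, ht, rfl⟩ := exists_ballParam_eq hy
          exact ⟨t, ⟨ht, hx⟩, rfl⟩
        · rintro ⟨t, ⟨-, ht⟩, rfl⟩
          exact ⟨ht, _, ballParam_mem_closedBall t, rfl⟩
      rw [this]
      exact ((isCompact_Icc.inter_right ((hA j).isClosed_compl)).image (hcont j)).isClosed
    | n + 2, j => exact ((hcw (n + 2) (by omega)).false j).elim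

end

/-! ### Loops inside subsets and change of base point. -/

section

open scoped unitInterval

namespace Path.Homotopic.Quotient

variable {X Y : Type*} [TopologicalSpace X] [TopologicalSpace Y]

/-- Change of base point of a loop along a path. -/
noncomputable def conjLoop {x y : X} (z : Path.Homotopic.Quotient x y)
    (c : Path.Homotopic.Quotient x x) : Path.Homotopic.Quotient y y := (z.symm.trans c).trans z

theorem conjLoop_trans {x y z : X} (a : Path.Homotopic.Quotient x y)
    (b : Path.Homotopic.Quotient y z) (c : Path.Homotopic.Quotient x x) :
    conjLoop (a.trans b) c = conjLoop b (conjLoop a c) := by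
  simp only [conjLoop, symm_trans_rev, trans_assoc]

theorem conjLoop_refl {x : X} (c : Path.Homotopic.Quotient x x) : conjLoop (refl x) c = c := by
  rw [conjLoop, trans_refl, symm_refl, refl_trans]

theorem conjLoop_symm_conjLoop {x y : X} (z : Path.Homotopic.Quotient x y)
    (c : Path.Homotopic.Quotient x x) : conjLoop z.symm (conjLoop z c) = c := by
  rw [← conjLoop_trans, trans_symm, conjLoop_refl]

theorem conjLoop_conjLoop_symm {x y : X} (z : Path.Homotopic.Quotient x y)
    (c : Path.Homotopic.Quotient y y) : conjLoop z (conjLoop z.symm c) = c := by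
  rw [← conjLoop_trans, symm_trans, conjLoop_refl]

theorem conjLoop_injective {x y : X} (z : Path.Homotopic.Quotient x y) :
    Function.Injective (conjLoop z) :=
  Function.LeftInverse.injective (conjLoop_symm_conjLoop z)

theorem conjLoop_apply_refl {x y : X} (z : Path.Homotopic.Quotient x y) :
    conjLoop z (refl x) = refl y := by
  rw [conjLoop, trans_refl, symm_trans]

/-- The product of the fundamental group composes loops in the reverse order, so `h⁻¹ * g * h` runs
along `h`, `g` and then `h` reversed. -/
theorem conjLoop_inv_mul_mul {x y : X} (z : Path.Homotopic.Quotient x y)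
    (g h : FundamentalGroup X x) :
    conjLoop z (h⁻¹ * g * h : FundamentalGroup X x) =
      conjLoop ((h : Path.Homotopic.Quotient x x).symm.trans z) g := by
  rw [conjLoop_trans, FundamentalGroup.mul_def, FundamentalGroup.mul_def,
    FundamentalGroup.inv_def]
  simp only [conjLoop, symm_symm', trans_assoc]

theorem fundamentalGroupMulEquivOfPath_apply {x y : X} (p : Path x y) (c : FundamentalGroup X x) :
    FundamentalGroup.fundamentalGroupMulEquivOfPath p c = conjLoop p.cls c := by
  rw [conjLoop, trans_assoc]
  rfl

theorem map_trans (f : C(X, Y)) {x y z : X} (a : Path.Homotopic.Quotient x y)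
    (b : Path.Homotopic.Quotient y z) : (a.trans b).map f = (a.map f).trans (b.map f) := by
  obtain ⟨a, rfl⟩ := mk_surjective a
  obtain ⟨b, rfl⟩ := mk_surjective b
  rw [← mk_trans, ← mk_map, ← mk_map, ← mk_map, ← mk_trans, Path.map_trans]

theorem map_symm (f : C(X, Y)) {x y : X} (a : Path.Homotopic.Quotient x y) :
    a.symm.map f = (a.map f).symm := by
  obtain ⟨a, rfl⟩ := mk_surjective a
  rfl

theorem map_conjLoop (f : C(X, Y)) {x y : X} (z : Path.Homotopic.Quotient x y)
    (c : Path.Homotopic.Quotient x x) : (conjLoop z c).map f = conjLoop (z.map f) (c.map f) := by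
  simp only [conjLoop, map_trans, map_symm]

/-- A path class has a representative inside a given set. -/
def IsIn (A : Set X) {x y : X} (c : Path.Homotopic.Quotient x y) : Prop :=
  ∃ δ : Path x y, Set.range δ ⊆ A ∧ δ.cls = c

theorem IsIn.trans {A : Set X} {x y z : X} {a : Path.Homotopic.Quotient x y}
    {b : Path.Homotopic.Quotient y z} (ha : IsIn A a) (hb : IsIn A b) : IsIn A (a.trans b) := by
  obtain ⟨δ, h, rfl⟩ := ha
  obtain ⟨ε, h', rfl⟩ := hb
  exact ⟨δ.trans ε, by rw [Path.trans_range]; exact Set.union_subset h h', rfl⟩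

theorem IsIn.symm {A : Set X} {x y : X} {a : Path.Homotopic.Quotient x y} (ha : IsIn A a) :
    IsIn A a.symm := by
  obtain ⟨δ, h, rfl⟩ := ha
  exact ⟨δ.symm, by rwa [Path.symm_range], rfl⟩

theorem IsIn.conjLoop {A : Set X} {x y : X} {z : Path.Homotopic.Quotient x y}
    {c : Path.Homotopic.Quotient x x} (hz : IsIn A z) (hc : IsIn A c) : IsIn A (conjLoop z c) :=
  (hz.symm.trans hc).trans hz

theorem isIn_conjLoop_iff {A : Set X} {x y : X} {z : Path.Homotopic.Quotient x y}
    {c : Path.Homotopic.Quotient x x} (hz : IsIn A z) :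
    IsIn A (Quotient.conjLoop z c) ↔ IsIn A c := by
  refine ⟨fun h => ?_, hz.conjLoop⟩
  have := hz.symm.conjLoop h
  rwa [conjLoop_symm_conjLoop] at this

theorem isIn_univ {x y : X} (c : Path.Homotopic.Quotient x y) : IsIn Set.univ c := by
  obtain ⟨δ, rfl⟩ := mk_surjective c
  exact ⟨δ, Set.subset_univ _, rfl⟩

theorem IsIn.map (f : C(X, Y)) {A : Set X} {x y : X} {c : Path.Homotopic.Quotient x y}
    (hc : IsIn A c) : IsIn (f '' A) (c.map f) := by
  obtain ⟨δ, h, rfl⟩ := hc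
  refine ⟨δ.map f.continuous, ?_, rfl⟩
  rintro _ ⟨t, rfl⟩
  exact ⟨δ t, h ⟨t, rfl⟩, rfl⟩

theorem IsIn.exists_map {f : C(X, Y)} (hf : Topology.IsEmbedding f) {A : Set X} {x y : X}
    {c : Path.Homotopic.Quotient (f x) (f y)} (hc : IsIn (f '' A) c) :
    ∃ c' : Path.Homotopic.Quotient x y, IsIn A c' ∧ c'.map f = c := by
  obtain ⟨δ, h, rfl⟩ := hc
  choose g hgA hg using fun t => h ⟨t, rfl⟩
  have hcont : Continuous g := hf.continuous_iff.2 (by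
    have : f ∘ g = δ := funext hg
    rw [this]; exact δ.continuous)
  refine ⟨Path.cls ⟨⟨g, hcont⟩, hf.injective ?_, hf.injective ?_⟩, ⟨_, ?_, rfl⟩, ?_⟩
  · exact (hg 0).trans δ.source
  · exact (hg 1).trans δ.target
  · rintro _ ⟨t, rfl⟩
    exact hgA t
  · rw [← mk_map]
    congr 1
    ext t
    exact hg t

theorem isIn_singleton_iff {x : X} {c : Path.Homotopic.Quotient x x} :
    IsIn {x} c ↔ c = refl x := by
  constructor
  · rintro ⟨δ, h, rfl⟩
    have : δ = Path.refl x := by ext t; exact h ⟨t, rfl⟩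
    rw [this]
    rfl
  · rintro rfl
    exact ⟨Path.refl x, by simp, rfl⟩

theorem IsIn.left_mem {A : Set X} {x y : X} {c : Path.Homotopic.Quotient x y} (hc : IsIn A c) :
    x ∈ A := by
  obtain ⟨δ, h, -⟩ := hc
  exact h ⟨0, δ.source⟩

theorem IsIn.right_mem {A : Set X} {x y : X} {c : Path.Homotopic.Quotient x y} (hc : IsIn A c) :
    y ∈ A := hc.symm.left_mem

theorem exists_isIn_of_mem_range {x y : X} (γ : Path x y) {z : X} (hz : z ∈ Set.range γ) :
    ∃ c : Path.Homotopic.Quotient x z, IsIn (Set.range γ) c := by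
  obtain ⟨t, rfl⟩ := hz
  have h := Path.range_subpath γ 0 t
  refine ⟨((γ.subpath 0 t).cast γ.source.symm rfl).cls, _, ?_, rfl⟩
  change Set.range (γ.subpath 0 t) ⊆ _
  rw [h]
  exact Set.image_subset_range _ _

end Path.Homotopic.Quotient

namespace TopGraph

open Path.Homotopic.Quotient

variable {X E : Type*} [TopologicalSpace X] (Γ : TopGraph X E)

/-- The edges whose closure lies in a given set. -/
def edgesIn (A : Set X) : Set E := {e | Γ.char e '' Set.Icc 0 1 ⊆ A}

theorem IsWalk.mem_of_edgesIn {u u' : X} {L : List (E × Bool)} (h : Γ.IsWalk u L u') {A : Set X}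
    (hu' : u' ∈ A) (hL : ∀ q ∈ L, q.1 ∈ Γ.edgesIn A) : u ∈ A := by
  rcases L with - | ⟨q, L⟩
  · exact (show u = u' from h) ▸ hu'
  · rw [h.1]
    refine hL q (by simp) ⟨_, ?_, rfl⟩
    split_ifs <;> simp

theorem exists_mem_verts [Nonempty X] : ∃ u, u ∈ Γ.verts := by
  obtain ⟨x⟩ := ‹Nonempty X›
  rcases Γ.cover x with h | ⟨e, -⟩
  exacts [⟨x, h⟩, ⟨_, Γ.zero_mem e⟩]

/-- A nontrivial loop in a set can be moved to a vertex within that set. -/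
theorem exists_isIn_vert {x : X} {A : Set X} {c : Path.Homotopic.Quotient x x} (hA : IsIn A c)
    (hc : c ≠ refl x) :
    ∃ u ∈ Γ.verts, ∃ d : Path.Homotopic.Quotient x u, IsIn A d := by
  obtain ⟨γ, h, rfl⟩ := hA
  by_cases hv : ∀ t, γ t ∉ Γ.verts
  · exact absurd (Γ.cls_eq_refl_of_notMem_verts γ hv) hc
  · push Not at hv
    obtain ⟨t, ht⟩ := hv
    obtain ⟨d, δ, hd, rfl⟩ := exists_isIn_of_mem_range γ ⟨t, rfl⟩
    exact ⟨_, ht, δ.cls, δ, hd.trans h, rfl⟩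

theorem word_refl (u : X) : Γ.word (refl u) = 1 := Γ.mono_refl u 1

variable [T2Space X] [PathConnectedSpace X]

/-- A path in `A` reads only edges it covers, which lie in `A`. Conversely the reduced word of the
class is still a walk between the same vertices, and it can be realized in `A`. -/
theorem isIn_iff_word {u u' : X} (hu : u ∈ Γ.verts) (hu' : u' ∈ Γ.verts) {A : Set X} (huA : u ∈ A)
    {c : Path.Homotopic.Quotient u u'} :
    IsIn A c ↔ Γ.word c ∈ FreeGroup.letterSubgroup (Γ.edgesIn A) := by
  classical
  constructor
  · rintro ⟨δ, h, rfl⟩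
    obtain ⟨L, -, h2, h3⟩ := Γ.exists_walk hu hu' δ
    rw [h3]
    exact FreeGroup.mk_mem_letterSubgroup fun q hq => (h2 q hq).trans h
  · intro h
    obtain ⟨γ, rfl⟩ := mk_surjective c
    obtain ⟨L, h1, -, h3⟩ := Γ.exists_walk hu hu' γ
    have h4 : Γ.IsWalk u (Γ.word γ.cls).toWord u' := by
      rw [h3, FreeGroup.toWord_mk]
      exact h1.red Γ FreeGroup.reduce.red
    obtain ⟨δ, h5, h6⟩ := Γ.exists_path_of_isWalk h4 huA fun q hq =>
      FreeGroup.fst_mem_of_mem_toWord h q hq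
    exact ⟨δ, h5, Γ.word_injective hu hu' (by rw [h6, FreeGroup.mk_toWord])⟩

/-- A single reduced word has its letters in both edge sets; no connectedness of `A ∩ B` is
required. -/
theorem isIn_inter {u u' : X} (hu : u ∈ Γ.verts) (hu' : u' ∈ Γ.verts) {A B : Set X}
    {c : Path.Homotopic.Quotient u u'} (hA : IsIn A c) (hB : IsIn B c) : IsIn (A ∩ B) c := by
  classical
  have huA := hA.left_mem
  have huB := hB.left_mem
  rw [Γ.isIn_iff_word hu hu' huA] at hA
  rw [Γ.isIn_iff_word hu hu' huB] at hB
  have huAB : u ∈ A ∩ B := ⟨huA, huB⟩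
  rw [Γ.isIn_iff_word hu hu' huAB, FreeGroup.mem_letterSubgroup]
  exact fun q hq => Set.subset_inter (FreeGroup.fst_mem_of_mem_toWord hA q hq)
    (FreeGroup.fst_mem_of_mem_toWord hB q hq)

theorem word_symm {u u' : X} (hu : u ∈ Γ.verts) (hu' : u' ∈ Γ.verts)
    (c : Path.Homotopic.Quotient u u') : Γ.word c.symm = (Γ.word c)⁻¹ := by
  rw [eq_inv_iff_mul_eq_one, ← Γ.word_trans hu hu', symm_trans, word_refl]

theorem word_conjLoop {u u' : X} (hu : u ∈ Γ.verts) (hu' : u' ∈ Γ.verts)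
    (z : Path.Homotopic.Quotient u u') (c : Path.Homotopic.Quotient u u) :
    Γ.word (conjLoop z c) = (Γ.word z)⁻¹ * Γ.word c * Γ.word z := by
  rw [conjLoop, Γ.word_trans hu hu', Γ.word_trans hu hu, Γ.word_symm hu hu']

/-- If conjugation along `z` carries a nontrivial loop in `A` to a loop in `B`, then `z` factors
through a point of `A ∩ B`. -/
theorem exists_factor {u u' : X} (hu : u ∈ Γ.verts) (hu' : u' ∈ Γ.verts) {A B : Set X}
    {z : Path.Homotopic.Quotient u u'} {c : Path.Homotopic.Quotient u u} (hA : IsIn A c)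
    (hB : IsIn B (conjLoop z c)) (hc : c ≠ refl u) :
    ∃ w ∈ Γ.verts, ∃ (a : Path.Homotopic.Quotient u w) (b : Path.Homotopic.Quotient w u'),
      IsIn A a ∧ IsIn B b ∧ z = a.trans b := by
  classical
  have huA := hA.left_mem
  have huB := hB.left_mem
  rw [Γ.isIn_iff_word hu hu huA] at hA
  have hB' := hB
  rw [Γ.isIn_iff_word hu' hu' huB] at hB'
  -- The reduced word of `z` splits into letters of `A` followed by letters of `B`; the vertex
  -- reached between the two parts is the point sought.
  obtain ⟨L, L', hLL', hL, hL'⟩ := FreeGroup.exists_split (z := Γ.word z) hB'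
    (fun h => by
      rw [← Γ.word_refl] at h
      have := Γ.word_injective hu' hu' h
      rw [← conjLoop_apply_refl z] at this
      exact hc (conjLoop_injective z this))
    (by rw [Γ.word_conjLoop hu hu']; simpa [mul_assoc] using hA)
  obtain ⟨γ, rfl⟩ := mk_surjective z
  obtain ⟨M, h1, -, h3⟩ := Γ.exists_walk hu hu' γ
  have h4 : Γ.IsWalk u (Γ.word γ.cls).toWord u' := by
    rw [h3, FreeGroup.toWord_mk]
    exact h1.red Γ FreeGroup.reduce.red
  rw [hLL', isWalk_append] at h4
  obtain ⟨w, h5, h6⟩ := h4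
  have hwv : w ∈ Γ.verts := h5.mem_verts Γ hu
  obtain ⟨α, h7, h8⟩ := Γ.exists_path_of_isWalk h5 huA hL
  obtain ⟨β, h9, h10⟩ := Γ.exists_path_of_isWalk h6 (h6.mem_of_edgesIn Γ huB hL') hL'
  refine ⟨w, hwv, α.cls, β.cls, ⟨α, h7, rfl⟩, ⟨β, h9, rfl⟩, Γ.word_injective hu hu' ?_⟩
  rw [Γ.word_trans hwv hu', h8, h10, FreeGroup.mul_mk, ← hLL', FreeGroup.mk_toWord]

end TopGraph

end

/-! ### Subgroups carried by subsets, and their transport across edges. -/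

section

open scoped unitInterval

open Path.Homotopic.Quotient in
/-- A subgroup consisting of the elements represented, after moving the base point along a fixed
path, by loops in a fixed subset. -/
def IsCarried {H X : Type*} [Group H] [TopologicalSpace X] {x : X}
    (α : H →* FundamentalGroup X x) (K : Subgroup H) : Prop :=
  ∃ (A : Set X) (y : X) (z : Path.Homotopic.Quotient x y), y ∈ A ∧
    ∀ g, g ∈ K ↔ IsIn A (conjLoop z (α g))

namespace IsCarried

open Path.Homotopic.Quotient

variable {H X : Type*} [Group H] [TopologicalSpace X] {x : X} {α : H →* FundamentalGroup X x}

theorem top (α : H →* FundamentalGroup X x) : IsCarried α ⊤ :=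
  ⟨Set.univ, x, .refl x, trivial, fun _ => iff_of_true trivial (isIn_univ _)⟩

theorem bot (hα : Function.Injective α) : IsCarried α ⊥ := by
  refine ⟨{x}, x, .refl x, rfl, fun g => ?_⟩
  rw [conjLoop_refl, isIn_singleton_iff, Subgroup.mem_bot]
  exact ⟨fun h => by rw [h]; exact _root_.map_one α,
    fun h => hα (Eq.trans h (_root_.map_one α).symm)⟩

theorem conj {K : Subgroup H} (hK : IsCarried α K) (h : H) : IsCarried α (conjSubgroup h K) := by
  obtain ⟨A, y, z, hy, hz⟩ := hK
  refine ⟨A, y, (α h : Path.Homotopic.Quotient x x).symm.trans z, hy, fun g => ?_⟩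
  rw [mem_conjSubgroup, hz, _root_.map_mul, _root_.map_mul, _root_.map_inv, conjLoop_inv_mul_mul]

/-- A nontrivial loop meets a vertex, so the base point can be slid to one within `A`. -/
theorem exists_vert {E : Type*} (Γ : TopGraph X E) (hα : Function.Injective α) {K : Subgroup H}
    (hK : IsCarried α K) (hbot : K ≠ ⊥) :
    ∃ (A : Set X) (u : X) (z : Path.Homotopic.Quotient x u), u ∈ Γ.verts ∧ u ∈ A ∧
      ∀ g, g ∈ K ↔ IsIn A (conjLoop z (α g)) := by
  obtain ⟨A, y, z, hy, hz⟩ := hK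
  obtain ⟨g, hg, hg1⟩ := (Subgroup.bot_or_exists_ne_one K).resolve_left hbot
  obtain ⟨u, hu, d, hd⟩ := Γ.exists_isIn_vert ((hz g).1 hg) fun h => by
    rw [← conjLoop_apply_refl z] at h
    exact hg1 (hα (Eq.trans (conjLoop_injective z h) (_root_.map_one α).symm))
  refine ⟨A, u, z.trans d, hu, hd.right_mem, fun g => ?_⟩
  rw [hz, conjLoop_trans, isIn_conjLoop_iff hd]

section Edge

variable {H' X' : Type*} [Group H'] [TopologicalSpace X'] {x' : X'}
  {β : H' ≃* FundamentalGroup X' x'} {f : H' →* H} {ι : C(X', X)}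
  {p : Path.Homotopic.Quotient (ι x') x}

/-- The image is carried by `ι '' A`: paths there lift through the embedding, and injectivity of `α`
identifies the elements. -/
theorem map (hα : Function.Injective α) (hι : Topology.IsEmbedding ι)
    (hf : ∀ a, α (f a) = conjLoop p (Path.Homotopic.Quotient.map (β a) ι)) {K : Subgroup H'}
    (hK : IsCarried β.toMonoidHom K) : IsCarried α (K.map f) := by
  obtain ⟨A, y, z, hy, hz⟩ := hK
  have key : ∀ a, conjLoop (p.symm.trans (z.map ι)) (α (f a)) =
      (conjLoop z (β a)).map ι := fun a => by
    rw [hf, conjLoop_trans, conjLoop_symm_conjLoop, map_conjLoop]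
  refine ⟨ι '' A, ι y, p.symm.trans (z.map ι), ⟨y, hy, rfl⟩, fun g => ⟨?_, fun h => ?_⟩⟩
  · rintro ⟨a, ha, rfl⟩
    rw [key]
    exact ((hz a).1 ha).map ι
  · obtain ⟨c, hc, hcg⟩ := h.exists_map hι
    have h1 : conjLoop z (β (β.symm (conjLoop z.symm c))) = c :=
      (congrArg _ (β.apply_symm_apply _)).trans (conjLoop_conjLoop_symm z c)
    refine ⟨β.symm (conjLoop z.symm c), (hz _).2 ?_, hα (conjLoop_injective
      (p.symm.trans (z.map ι)) ?_)⟩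
    · change IsIn A (conjLoop z (β (β.symm (conjLoop z.symm c))))
      rwa [h1]
    · rw [key, h1, hcg]

/-- The preimage is carried by `ι ⁻¹' A`. A nontrivial element forces the connecting path to factor
through a vertex of `A ∩ ι(X')`; based there, a loop homotopic into `A` and into `ι(X')` is
homotopic into the intersection and lifts. -/
theorem comap [T2Space X] [PathConnectedSpace X] {E : Type*} (Γ : TopGraph X E)
    (hα : Function.Injective α) (hι : Topology.IsEmbedding ι) (hf' : Function.Injective f)
    (hf : ∀ a, α (f a) = conjLoop p (Path.Homotopic.Quotient.map (β a) ι)) {K : Subgroup H}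
    (hK : IsCarried α K) : IsCarried β.toMonoidHom (K.comap f) := by
  by_cases hbot : K.comap f = ⊥
  · rw [hbot]
    exact bot β.injective
  obtain ⟨a, ha, ha1⟩ := (Subgroup.bot_or_exists_ne_one _).resolve_left hbot
  have hfa : f a ≠ 1 := fun h => ha1 (hf' (h.trans (_root_.map_one f).symm))
  obtain ⟨A, u, z, hu, huA, hz⟩ := hK.exists_vert Γ hα fun h => hfa (by
    rw [Subgroup.mem_comap, h] at ha; exact ha)
  have hrange : ∀ {y y' : X'} (c : Path.Homotopic.Quotient y y'), IsIn (ι '' Set.univ) (c.map ι) :=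
    fun c => (isIn_univ c).map ι
  have hb1 : Path.Homotopic.Quotient.map (β a) ι ≠ .refl _ := fun h => hfa (hα (by
    rw [hf, h, conjLoop_apply_refl, _root_.map_one]; rfl))
  obtain ⟨u₀, hu₀, d, hd⟩ := Γ.exists_isIn_vert (hrange (β a)) hb1
  have hpz : ∀ g, f g ∈ K ↔ IsIn A (conjLoop (p.trans z) (Path.Homotopic.Quotient.map (β g) ι)) :=
    fun g => by rw [hz, hf, conjLoop_trans]
  obtain ⟨w, hw, a₁, b₁, ha₁, hb₁, hab⟩ := Γ.exists_factor (z := d.symm.trans (p.trans z))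
    (c := conjLoop d (Path.Homotopic.Quotient.map (β a) ι)) hu₀ hu (hd.conjLoop (hrange (β a)))
    (by
      rw [← conjLoop_trans, trans_symm_cancel]
      exact (hpz a).1 ha)
    (fun h => by
      rw [← conjLoop_apply_refl d] at h
      exact hb1 (conjLoop_injective d h))
  have hab' : p.trans z = (d.trans a₁).trans b₁ := by
    rw [trans_assoc, ← hab, trans_symm_cancel]
  obtain ⟨w', -, rfl⟩ := (hd.trans ha₁).right_mem
  obtain ⟨c', -, hc'⟩ := (hd.trans ha₁).exists_map hι
  -- The lifted loop may be compared only after applying `ι`; injectivity of `f` and `α` makes `ι`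
  -- injective on loop classes.
  have hinj : ∀ g (e : Path.Homotopic.Quotient w' w'), e.map ι = (conjLoop c' (β g)).map ι →
      e = conjLoop c' (β g) := by
    intro g e he
    have h1 : conjLoop c' (β (β.symm (conjLoop c'.symm e))) = e :=
      (congrArg _ (β.apply_symm_apply _)).trans (conjLoop_conjLoop_symm c' e)
    rw [← h1, map_conjLoop, map_conjLoop] at he
    have h2 := conjLoop_injective _ he
    have h3 : β.symm (conjLoop c'.symm e) = g := hf' (hα (by rw [hf, hf, h2]))
    rw [← h1, h3]
  refine ⟨ι ⁻¹' A, w', c', hb₁.left_mem, fun g => ?_⟩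
  change f g ∈ K ↔ IsIn (ι ⁻¹' A) (conjLoop c' (β g))
  rw [hpz, hab', conjLoop_trans, isIn_conjLoop_iff hb₁, ← hc', ← map_conjLoop]
  constructor
  · intro h
    have h1 := Γ.isIn_inter hw hw h (hrange _)
    rw [Set.inter_comm, ← Set.image_inter_preimage, Set.univ_inter] at h1
    obtain ⟨e, he, heq⟩ := h1.exists_map hι
    exact hinj g e heq ▸ he
  · intro h
    obtain ⟨δ, h1, h2⟩ := h.map ι
    exact ⟨δ, h1.trans (Set.image_preimage_subset _ _), h2⟩

end Edge

end IsCarried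

namespace TopGraph

open Path.Homotopic.Quotient

variable {X E : Type*} [TopologicalSpace X] [T2Space X] [PathConnectedSpace X] (Γ : TopGraph X E)

/-- The words of loops, moved to a vertex, in the free group on the edges. -/
noncomputable def wordHom {x u : X} (hu : u ∈ Γ.verts) (p : Path.Homotopic.Quotient x u) :
    FundamentalGroup X x →* FreeGroup E where
  toFun g := (Γ.word (conjLoop p g))⁻¹
  map_one' := by
    rw [FundamentalGroup.one_def, conjLoop_apply_refl, word_refl, inv_one]
  map_mul' g h := by
    rw [FundamentalGroup.mul_def, ← mul_inv_rev, ← Γ.word_trans hu hu]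
    simp only [conjLoop, trans_assoc, trans_symm_cancel]

theorem wordHom_injective {x u : X} (hu : u ∈ Γ.verts) (p : Path.Homotopic.Quotient x u) :
    Function.Injective (Γ.wordHom hu p) := fun _ _ h =>
  conjLoop_injective p (Γ.word_injective hu hu (inv_injective h))

theorem exists_isLetterConj {H : Type*} [Group H] {x u : X} (hu : u ∈ Γ.verts)
    (p : Path.Homotopic.Quotient x u) {α : H →* FundamentalGroup X x} (hα : Function.Injective α)
    {K : Subgroup H} (hK : IsCarried α K) :
    ∃ L, FreeGroup.IsLetterConj L ∧ K = L.comap ((Γ.wordHom hu p).comp α) := by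
  by_cases hbot : K = ⊥
  · refine ⟨⊥, ⟨1, ∅, by rw [FreeGroup.letterSubgroup_empty, conjSubgroup_one]⟩, ?_⟩
    rw [hbot, MonoidHom.comap_bot]
    exact ((MonoidHom.ker_eq_bot_iff ((Γ.wordHom hu p).comp α)).2 ((Γ.wordHom_injective hu p).comp hα)).symm
  obtain ⟨A, w, z, hw, hwA, hz⟩ := hK.exists_vert Γ hα hbot
  refine ⟨_, ⟨Γ.word (p.symm.trans z), Γ.edgesIn A, rfl⟩, ?_⟩
  ext g
  rw [hz, Γ.isIn_iff_word hw hw hwA, Subgroup.mem_comap, mem_conjSubgroup, ← inv_mem_iff]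
  have : conjLoop z (α g) = conjLoop (p.symm.trans z) (conjLoop p (α g)) := by
    rw [conjLoop_trans, conjLoop_symm_conjLoop]
  rw [this, Γ.word_conjLoop hu hw]
  simp [wordHom, mul_assoc]

end TopGraph

end

/-! ### Paths in a graph of groups, and an auxiliary HNN extension. -/

section

/-- On a tree, a group-valued function on oriented edges is the coboundary of a function on
vertices. -/
theorem SimpleGraph.IsTree.exists_potential {V K : Type*} [Group K] {G : SimpleGraph V}
    (hG : G.IsTree) (τ : V → V → K) (hτ : ∀ a b, G.Adj a b → τ b a = (τ a b)⁻¹) :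
    ∃ γ : V → K, ∀ a b, G.Adj a b → γ b = γ a * τ a b := by
  obtain ⟨r⟩ := hG.connected.nonempty
  choose P hP using fun v => (hG.existsUnique_path r v).exists
  let F : ∀ {u v : V}, G.Walk u v → K := fun p => (p.darts.map fun d => τ d.fst d.snd).prod
  have hF : ∀ {u v w : V} (p : G.Walk u v) (h : G.Adj v w), F (p.concat h) = F p * τ v w := by
    intro u v w p h
    simp [F, SimpleGraph.Walk.darts_concat]
  refine ⟨fun v => F (P v), fun a b hab => ?_⟩
  -- In a tree, of the paths from the root to two adjacent vertices one extends the other by an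
  -- edge.
  by_cases hb : b ∈ (P a).support
  · change F (P b) = F (P a) * τ a b
    rw [hG.isAcyclic.path_concat (hP b) (hP a) hab.symm hb, hF, hτ a b hab, inv_mul_cancel_right]
  · have ha := hG.isAcyclic.mem_support_of_ne_mem_support_of_adj_of_isPath (hP b) (hP a)
      hab.symm hb
    change F (P b) = F (P a) * τ a b
    rw [hG.isAcyclic.path_concat (hP a) (hP b) hab ha, hF]

namespace GraphOfGroups

variable {V : Type u₁} {E : Type u₂} (𝒢 : GraphOfGroups.{u₁, u₂, u₃, u₄} V E)

/-- The origin of an oriented edge. -/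
def origin (e : E) : Bool → V
  | true => 𝒢.src e
  | false => 𝒢.tgt e

/-- The inclusion of an edge group into the vertex group at the origin of the oriented edge. -/
def edgeHom (e : E) : ∀ b, 𝒢.edge e →* 𝒢.vert (𝒢.origin e b)
  | true => 𝒢.toSrc e
  | false => 𝒢.toTgt e

theorem edgeHom_injective (e : E) (b : Bool) : Function.Injective (𝒢.edgeHom e b) := by
  cases b
  exacts [𝒢.toTgt_injective e, 𝒢.toSrc_injective e]

/-- Paths in a graph of groups: alternating sequences of elements of vertex groups and of edges. -/
inductive GPath : V → V → Type (max u₁ u₂ u₃)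
  | last {v : V} (g : 𝒢.vert v) : GPath v v
  | cons (e : E) (b : Bool) {w : V} (g : 𝒢.vert (𝒢.origin e b))
      (p : GPath (𝒢.origin e (!b)) w) : GPath (𝒢.origin e b) w

namespace GPath

variable {𝒢}

/-- A path is reduced if it contains no backtracking. -/
def IsRed : ∀ {v w : V}, 𝒢.GPath v w → Prop
  | _, _, last _ => True
  | _, _, cons e b _ p => IsRed p ∧ ∀ a p', p ≠ cons e (!b) (𝒢.edgeHom e (!b) a) p'

/-- Multiplication of a path by an element of the initial vertex group. -/
def lmul : ∀ {v w : V}, 𝒢.GPath v w → 𝒢.vert v → 𝒢.GPath v w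
  | _, _, last g, x => last (x * g)
  | _, _, cons e b g p, x => cons e b (x * g) p

/-- Multiplication of a path by an element of the final vertex group. -/
def rmul : ∀ {v w : V}, 𝒢.GPath v w → 𝒢.vert w → 𝒢.GPath v w
  | _, _, last g, y => last (g * y)
  | _, _, cons e b g p, y => cons e b g (rmul p y)

/-- The subgroup of elements of the initial vertex group that can be pushed along a path. -/
def sub : ∀ {v w : V}, 𝒢.GPath v w → Subgroup (𝒢.vert v)
  | _, _, last _ => ⊤
  | _, _, cons e b g p =>
    conjSubgroup g (((sub p).comap (𝒢.edgeHom e (!b))).map (𝒢.edgeHom e b))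

theorem IsRed.lmul {v w : V} {p : 𝒢.GPath v w} (hp : p.IsRed) (x : 𝒢.vert v) :
    (p.lmul x).IsRed := by
  cases p
  exacts [trivial, hp]

theorem rmul_rmul_inv {v w : V} (p : 𝒢.GPath v w) (y : 𝒢.vert w) : (p.rmul y).rmul y⁻¹ = p := by
  induction p with
  | last g => simp [rmul]
  | cons e b g p ih => simp [rmul, ih]

theorem IsRed.rmul {v w : V} {p : 𝒢.GPath v w} (hp : p.IsRed) (y : 𝒢.vert w) :
    (p.rmul y).IsRed := by
  induction p with
  | last g => trivial
  | cons e b g p ih =>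
    refine ⟨ih hp.1 y, fun a p' h => hp.2 a (p'.rmul y⁻¹) ?_⟩
    rw [← rmul_rmul_inv p y, h]
    rfl

end GPath

section Wreath

set_option linter.unusedSectionVars false

/-- The product of all vertex groups. -/
abbrev VertProd : Type _ := ∀ v, 𝒢.vert v

/-- A permutational wreath product in which the edge groups of different edges can be made to
commute. -/
abbrev Wreath : Type _ := (Option E → 𝒢.VertProd) ⋊[mulAutArrow] Equiv.Perm (Option E)

variable [DecidableEq V] [DecidableEq E]

/-- The inclusion of a vertex group into the distinguished factor of the wreath product. -/
def vertEmb (v : V) : 𝒢.vert v →* 𝒢.Wreath :=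
  SemidirectProduct.inl.comp ((MonoidHom.mulSingle (fun _ : Option E => 𝒢.VertProd) none).comp
    (MonoidHom.mulSingle 𝒢.vert v))

/-- The element of the wreath product exchanging the distinguished factor with that of an edge. -/
def swapElt (e : E) : 𝒢.Wreath := SemidirectProduct.inr (Equiv.swap none (some e))

/-- The product of the edge groups, embedded factorwise in the wreath product. -/
def edgeProdHom (b : Bool) : (∀ e, 𝒢.edge e) →* 𝒢.Wreath :=
  SemidirectProduct.inl.comp (MonoidHom.pi fun o : Option E => match o with
    | none => 1
    | some e => ((MonoidHom.mulSingle 𝒢.vert (𝒢.origin e b)).comp (𝒢.edgeHom e b)).comp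
        (Pi.evalMonoidHom _ e))

theorem edgeProdHom_left_some (b : Bool) (a : ∀ e, 𝒢.edge e) (e : E) :
    (𝒢.edgeProdHom b a).left (some e) =
      Pi.mulSingle (𝒢.origin e b) (𝒢.edgeHom e b (a e)) := rfl

theorem edgeProdHom_left_none (b : Bool) (a : ∀ e, 𝒢.edge e) :
    (𝒢.edgeProdHom b a).left none = 1 := rfl

theorem edgeProdHom_right (b : Bool) (a : ∀ e, 𝒢.edge e) : (𝒢.edgeProdHom b a).right = 1 := rfl

theorem edgeProdHom_injective (b : Bool) : Function.Injective (𝒢.edgeProdHom b) := by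
  intro a a' h
  ext e
  have h1 := congrFun (congrArg SemidirectProduct.left h) (some e)
  rw [edgeProdHom_left_some, edgeProdHom_left_some] at h1
  exact 𝒢.edgeHom_injective e b (Pi.mulSingle_injective _ h1)

theorem swapElt_mul_self (e : E) : 𝒢.swapElt e * 𝒢.swapElt e = 1 := by
  rw [swapElt, ← map_mul, Equiv.swap_mul_self, map_one]

theorem swapElt_inv (e : E) : (𝒢.swapElt e)⁻¹ = 𝒢.swapElt e :=
  inv_eq_of_mul_eq_one_left (𝒢.swapElt_mul_self e)

theorem left_swap_mul (e : E) {v : V} (g : 𝒢.vert v) (e' : E) (o : Option E) :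
    (𝒢.swapElt e * (𝒢.vertEmb v g * 𝒢.swapElt e')).left o =
      (Pi.mulSingle none (Pi.mulSingle v g) : Option E → 𝒢.VertProd)
        (Equiv.swap none (some e) o) := by
  simp only [swapElt, vertEmb, MonoidHom.comp_apply, SemidirectProduct.mul_left,
    SemidirectProduct.left_inr, SemidirectProduct.right_inr, SemidirectProduct.left_inl,
    SemidirectProduct.right_inl, map_one, mul_one, one_mul]
  change Pi.mulSingle none _ ((Equiv.swap none (some e))⁻¹ o) = _
  rw [Equiv.swap_inv]
  rfl

/-- The swap moves the edge group from the distinguished coordinate to the coordinate of its own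
edge, so that all edge groups together form a direct product. -/
theorem swap_mul_edgeHom (e : E) (b : Bool) (a : 𝒢.edge e) :
    𝒢.swapElt e * (𝒢.vertEmb _ (𝒢.edgeHom e b a) * 𝒢.swapElt e) =
      𝒢.edgeProdHom b (Pi.mulSingle e a) := by
  ext o : 2
  · rw [left_swap_mul]
    rcases o with - | e'
    · rw [edgeProdHom_left_none, Equiv.swap_apply_left, Pi.mulSingle_eq_of_ne (by simp)]
    · rw [edgeProdHom_left_some]
      by_cases h : e' = e
      · subst h
        rw [Equiv.swap_apply_right, Pi.mulSingle_eq_same, Pi.mulSingle_eq_same]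
      · rw [Equiv.swap_apply_of_ne_of_ne (by simp) (by simpa using h),
          Pi.mulSingle_eq_of_ne (by simp), Pi.mulSingle_eq_of_ne h, map_one, Pi.mulSingle_one]
  · simp [swapElt, vertEmb, edgeProdHom_right]

/-- The permutation part identifies the edges, the coordinate of `e` identifies the element. The
equation is stated in `VertProd` because `v` is not determined when `g = 1`. -/
theorem eq_of_swap_mul_mem {e e' : E} {b : Bool} {v : V} {g : 𝒢.vert v}
    (h : 𝒢.swapElt e * (𝒢.vertEmb v g * 𝒢.swapElt e') ∈ (𝒢.edgeProdHom b).range) :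
    e' = e ∧ ∃ a, (Pi.mulSingle v g : 𝒢.VertProd) =
      Pi.mulSingle (𝒢.origin e b) (𝒢.edgeHom e b a) := by
  obtain ⟨a, ha⟩ := h
  constructor
  · have h1 := congrArg SemidirectProduct.right ha
    rw [edgeProdHom_right] at h1
    simp only [swapElt, vertEmb, MonoidHom.comp_apply, SemidirectProduct.mul_right,
      SemidirectProduct.right_inr, SemidirectProduct.right_inl, one_mul] at h1
    have h2 := congrArg (fun σ : Equiv.Perm (Option E) => σ (some e')) h1
    simp only [Equiv.Perm.one_apply, Equiv.Perm.mul_apply, Equiv.swap_apply_right,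
      Equiv.swap_apply_left] at h2
    exact Option.some_injective _ h2
  · refine ⟨a e, ?_⟩
    have h1 := congrFun (congrArg SemidirectProduct.left ha) (some e)
    rw [left_swap_mul, Equiv.swap_apply_right, Pi.mulSingle_eq_same, edgeProdHom_left_some] at h1
    exact h1.symm

/-- The isomorphism between the two copies of the product of the edge groups. -/
noncomputable def edgeProdEquiv : (𝒢.edgeProdHom false).range ≃* (𝒢.edgeProdHom true).range :=
  (MonoidHom.ofInjective (𝒢.edgeProdHom_injective false)).symm.trans
    (MonoidHom.ofInjective (𝒢.edgeProdHom_injective true))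

theorem edgeProdEquiv_apply (a : ∀ e, 𝒢.edge e) :
    𝒢.edgeProdEquiv ⟨𝒢.edgeProdHom false a, a, rfl⟩ = ⟨𝒢.edgeProdHom true a, a, rfl⟩ := by
  have : (⟨𝒢.edgeProdHom false a, a, rfl⟩ : (𝒢.edgeProdHom false).range) =
    MonoidHom.ofInjective (𝒢.edgeProdHom_injective false) a := rfl
  rw [this, edgeProdEquiv, MulEquiv.trans_apply, MulEquiv.symm_apply_apply]
  rfl

/-- An HNN extension containing conjugates of all stable letters. -/
abbrev BigHNN : Type _ :=
  HNNExtension 𝒢.Wreath (𝒢.edgeProdHom false).range (𝒢.edgeProdHom true).range 𝒢.edgeProdEquiv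

/-- The exponent of the stable letter along an oriented edge. -/
def orient (b : Bool) : ℤˣ := if b then 1 else -1

theorem toSubgroup_orient (b : Bool) :
    HNNExtension.toSubgroup (𝒢.edgeProdHom false).range (𝒢.edgeProdHom true).range (orient b) =
      (𝒢.edgeProdHom (!b)).range := by
  cases b <;> rfl

theorem toSubgroup_neg_orient (b : Bool) :
    HNNExtension.toSubgroup (𝒢.edgeProdHom false).range (𝒢.edgeProdHom true).range (-orient b) =
      (𝒢.edgeProdHom b).range := by
  cases b
  · simp [orient]
  · simp [orient]

theorem t_mul_edgeProdHom (a : ∀ e, 𝒢.edge e) :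
    (HNNExtension.t * HNNExtension.of (𝒢.edgeProdHom false a) : 𝒢.BigHNN) =
      HNNExtension.of (𝒢.edgeProdHom true a) * HNNExtension.t := by
  have := HNNExtension.t_mul_of (φ := 𝒢.edgeProdEquiv) ⟨𝒢.edgeProdHom false a, a, rfl⟩
  rwa [edgeProdEquiv_apply] at this

theorem edgeProdHom_mul_zpow (b : Bool) (a : ∀ e, 𝒢.edge e) :
    (HNNExtension.of (𝒢.edgeProdHom b a) * HNNExtension.t ^ (orient b : ℤ) : 𝒢.BigHNN) =
      HNNExtension.t ^ (orient b : ℤ) * HNNExtension.of (𝒢.edgeProdHom (!b) a) := by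
  cases b
  · have h := 𝒢.t_mul_edgeProdHom a
    simp only [orient, Bool.false_eq_true, if_false, Units.val_neg, Units.val_one, zpow_neg,
      zpow_one, Bool.not_false]
    rw [mul_inv_eq_iff_eq_mul, mul_assoc, ← h, inv_mul_cancel_left]
  · simpa [orient] using (𝒢.t_mul_edgeProdHom a).symm

/-- The stable letter of an oriented edge in the big HNN extension. -/
noncomputable def bigLetter (e : E) (b : Bool) : 𝒢.BigHNN :=
  HNNExtension.of (𝒢.swapElt e) * HNNExtension.t ^ (orient b : ℤ) *
    HNNExtension.of (𝒢.swapElt e)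

theorem bigLetter_not (e : E) (b : Bool) : 𝒢.bigLetter e (!b) = (𝒢.bigLetter e b)⁻¹ := by
  have h : (HNNExtension.of (𝒢.swapElt e) : 𝒢.BigHNN)⁻¹ = HNNExtension.of (𝒢.swapElt e) := by
    rw [← map_inv, swapElt_inv]
  rw [bigLetter, bigLetter, mul_inv_rev, mul_inv_rev, h, mul_assoc]
  cases b <;> simp [orient]

theorem vertEmb_mul_bigLetter (e : E) (b : Bool) (a : 𝒢.edge e) :
    HNNExtension.of (𝒢.vertEmb _ (𝒢.edgeHom e b a)) * 𝒢.bigLetter e b =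
      𝒢.bigLetter e b * HNNExtension.of (𝒢.vertEmb _ (𝒢.edgeHom e (!b) a)) := by
  have h : ∀ b', 𝒢.vertEmb _ (𝒢.edgeHom e b' a) * 𝒢.swapElt e =
      𝒢.swapElt e * 𝒢.edgeProdHom b' (Pi.mulSingle e a) := fun b' => by
    rw [← swap_mul_edgeHom, ← mul_assoc (𝒢.swapElt e), swapElt_mul_self, one_mul]
  have h' : 𝒢.swapElt e * 𝒢.vertEmb _ (𝒢.edgeHom e (!b) a) =
      𝒢.edgeProdHom (!b) (Pi.mulSingle e a) * 𝒢.swapElt e := by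
    rw [← swap_mul_edgeHom, mul_assoc, mul_assoc, swapElt_mul_self, mul_one]
  rw [bigLetter, mul_assoc, mul_assoc, mul_assoc, ← map_mul, h', ← mul_assoc, ← mul_assoc,
    ← map_mul, h, map_mul, map_mul, mul_assoc _ _ (HNNExtension.t ^ _), edgeProdHom_mul_zpow]
  simp only [mul_assoc]

end Wreath

end GraphOfGroups

end

/-! ### Normal forms, and intersections of vertex groups with conjugates. -/

section

namespace GraphOfGroups

variable {V : Type u₁} {E : Type u₂} {𝒢 : GraphOfGroups.{u₁, u₂, u₃, u₄} V E}

namespace GPath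

section Big

variable [DecidableEq V] [DecidableEq E]

/-- The element of the big HNN extension represented by a path. -/
noncomputable def bigVal : ∀ {v w : V}, 𝒢.GPath v w → 𝒢.BigHNN
  | _, _, last g => HNNExtension.of (𝒢.vertEmb _ g)
  | _, _, cons e b g p => HNNExtension.of (𝒢.vertEmb _ g) * 𝒢.bigLetter e b * bigVal p

/-- The head of the word in the HNN extension attached to a path. -/
def wordHead : ∀ {v w : V}, 𝒢.GPath v w → 𝒢.Wreath
  | _, _, last g => 𝒢.vertEmb _ g
  | _, _, cons e _ g _ => 𝒢.vertEmb _ g * 𝒢.swapElt e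

/-- The list of letters of the word in the HNN extension attached to a path. -/
def wordList : ∀ {v w : V}, 𝒢.GPath v w → List (ℤˣ × 𝒢.Wreath)
  | _, _, last _ => []
  | _, _, cons e b _ p => (orient b, 𝒢.swapElt e * wordHead p) :: wordList p

theorem bigVal_eq {v w : V} (p : 𝒢.GPath v w) :
    p.bigVal = HNNExtension.of p.wordHead * (p.wordList.map fun x =>
      (HNNExtension.t ^ (x.1 : ℤ) * HNNExtension.of x.2 : 𝒢.BigHNN)).prod := by
  induction p with
  | last g => simp [bigVal, wordHead, wordList]
  | cons e b g p ih =>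
    simp only [bigVal, wordHead, wordList, ih, List.map_cons, List.prod_cons, bigLetter, map_mul,
      mul_assoc]

/-- A pinch in the HNN word can only come from a backtrack of the path. -/
theorem exists_cons_of_mem {v w : V} (q : 𝒢.GPath v w) {e : E} {b : Bool}
    (hv : v = 𝒢.origin e (!b)) {y : ℤˣ × 𝒢.Wreath} (hy : y ∈ q.wordList.head?)
    (hmem : 𝒢.swapElt e * q.wordHead ∈ (𝒢.edgeProdHom (!b)).range) (hne : orient b ≠ y.1) :
    ∃ a p', hv ▸ q = cons e (!b) (𝒢.edgeHom e (!b) a) p' := by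
  cases q with
  | last g => simp [wordList] at hy
  | cons e' b' g q =>
    obtain ⟨rfl, a, ha⟩ := 𝒢.eq_of_swap_mul_mem hmem
    have hb : b' = !b := by
      simp only [wordList, List.head?_cons, Option.mem_def, Option.some.injEq] at hy
      rw [← hy] at hne
      cases b <;> cases b' <;> simp_all
    subst hb
    exact ⟨a, q, by rw [Pi.mulSingle_injective _ ha]⟩

theorem IsRed.isChain {v w : V} {p : 𝒢.GPath v w} (hp : p.IsRed) :
    p.wordList.IsChain fun x y => x.2 ∈ HNNExtension.toSubgroup (𝒢.edgeProdHom false).range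
      (𝒢.edgeProdHom true).range x.1 → x.1 = y.1 := by
  induction p with
  | last g => exact List.isChain_nil
  | cons e b g p ih =>
    refine List.isChain_cons.2 ⟨fun y hy hmem => ?_, ih hp.1⟩
    rw [toSubgroup_orient] at hmem
    by_contra hne
    obtain ⟨a, p', h⟩ := exists_cons_of_mem p rfl hy hmem hne
    exact hp.2 a p' h

/-- The reduced word in the HNN extension attached to a reduced path. -/
def word {v w : V} (p : 𝒢.GPath v w) (hp : p.IsRed) :
    HNNExtension.NormalWord.ReducedWord 𝒢.Wreath (𝒢.edgeProdHom false).range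
      (𝒢.edgeProdHom true).range where
  head := p.wordHead
  toList := p.wordList
  chain := hp.isChain

theorem bigVal_lmul {v w : V} (p : 𝒢.GPath v w) (x : 𝒢.vert v) :
    (p.lmul x).bigVal = HNNExtension.of (𝒢.vertEmb v x) * p.bigVal := by
  cases p <;> simp [lmul, bigVal, mul_assoc]

theorem bigVal_rmul {v w : V} (p : 𝒢.GPath v w) (y : 𝒢.vert w) :
    (p.rmul y).bigVal = p.bigVal * HNNExtension.of (𝒢.vertEmb w y) := by
  induction p with
  | last g => simp [rmul, bigVal]
  | cons e b g p ih => simp [rmul, bigVal, ih, mul_assoc]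

/-- `p.lmul x` and `p.rmul y` give reduced words with equal value. By uniqueness their heads differ
by an element of the associated subgroup, so `x` conjugated by `g` lies in the edge group; cancel
the letter and continue. -/
theorem IsRed.mem_sub {v w : V} {p : 𝒢.GPath v w} (hp : p.IsRed) {x : 𝒢.vert v} {y : 𝒢.vert w}
    (h : HNNExtension.of (𝒢.vertEmb v x) * p.bigVal =
      p.bigVal * HNNExtension.of (𝒢.vertEmb w y)) : x ∈ p.sub := by
  induction p with
  | last g => trivial
  | cons e b g p ih =>
    have hl := hp.lmul x
    have hr := hp.rmul y
    have hprod : (((cons e b g p).lmul x).word hl).prod 𝒢.edgeProdEquiv =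
        (((cons e b g p).rmul y).word hr).prod 𝒢.edgeProdEquiv :=
      (bigVal_eq _).symm.trans (((bigVal_lmul _ x).trans (h.trans (bigVal_rmul _ y).symm)).trans
        (bigVal_eq _))
    have hhead : orient b ∈ (((cons e b g p).lmul x).word hl).toList.head?.map Prod.fst := rfl
    have hmem := (HNNExtension.ReducedWord.map_fst_eq_and_of_prod_eq 𝒢.edgeProdEquiv hprod).2
      (orient b) hhead
    rw [toSubgroup_neg_orient] at hmem
    have h2 : (((cons e b g p).lmul x).word hl).head⁻¹ * (((cons e b g p).rmul y).word hr).head =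
        𝒢.swapElt e * (𝒢.vertEmb _ ((x * g)⁻¹ * g) * 𝒢.swapElt e) := by
      change (𝒢.vertEmb _ (x * g) * 𝒢.swapElt e)⁻¹ * (𝒢.vertEmb _ g * 𝒢.swapElt e) = _
      rw [mul_inv_rev, swapElt_inv, map_mul _ (x * g)⁻¹ g, map_inv, mul_assoc, mul_assoc]
    rw [h2] at hmem
    obtain ⟨-, a, ha⟩ := 𝒢.eq_of_swap_mul_mem hmem
    have ha' : (x * g)⁻¹ * g = 𝒢.edgeHom e b a := Pi.mulSingle_injective _ ha
    have hx : g⁻¹ * x * g = 𝒢.edgeHom e b a⁻¹ := by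
      rw [map_inv, ← ha']
      group
    refine mem_conjSubgroup.2 ⟨a⁻¹, ih (y := y) hp.1 ?_, hx.symm⟩
    have h3 : x * g = g * 𝒢.edgeHom e b a⁻¹ := by
      rw [← hx]
      group
    have h4 : HNNExtension.of (𝒢.vertEmb _ (x * g)) * 𝒢.bigLetter e b * p.bigVal =
        HNNExtension.of (𝒢.vertEmb _ g) * 𝒢.bigLetter e b * p.bigVal *
          HNNExtension.of (𝒢.vertEmb _ y) := by
      simpa only [bigVal, map_mul, mul_assoc] using h
    rw [h3, map_mul, map_mul, mul_assoc _ _ (𝒢.bigLetter e b), vertEmb_mul_bigLetter] at h4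
    simp only [mul_assoc, mul_right_inj] at h4
    exact h4

end Big

end GPath

section FundGroup

variable (𝒢) (T : Set E)

/-- The image in the fundamental group of the stable letter of an oriented edge. -/
def stableLetter (e : E) (b : Bool) : 𝒢.FundGroup T :=
  QuotientGroup.mk' _ (if b then 𝒢.letter e else (𝒢.letter e)⁻¹)

theorem stableLetter_not (e : E) (b : Bool) :
    𝒢.stableLetter T e (!b) = (𝒢.stableLetter T e b)⁻¹ := by
  cases b <;> simp [stableLetter]

theorem mk_relator {r : 𝒢.FreeProd} (hr : r ∈ 𝒢.relators T) :
    (QuotientGroup.mk' (Subgroup.normalClosure (𝒢.relators T))) r = 1 :=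
  (QuotientGroup.eq_one_iff r).2 (Subgroup.subset_normalClosure hr)

theorem stableLetter_of_mem {e : E} (he : e ∈ T) (b : Bool) : 𝒢.stableLetter T e b = 1 := by
  have h : 𝒢.stableLetter T e true = 1 := 𝒢.mk_relator T (Or.inr ⟨e, he, rfl⟩)
  cases b
  · exact (𝒢.stableLetter_not T e true).trans (by rw [h, inv_one])
  · exact h

theorem vertexHom_mul_stableLetter (e : E) (b : Bool) (a : 𝒢.edge e) :
    𝒢.vertexHom T _ (𝒢.edgeHom e b a) * 𝒢.stableLetter T e b =
      𝒢.stableLetter T e b * 𝒢.vertexHom T _ (𝒢.edgeHom e (!b) a) := by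
  have h : (𝒢.stableLetter T e true)⁻¹ * 𝒢.vertexHom T _ (𝒢.toSrc e a) *
      𝒢.stableLetter T e true * (𝒢.vertexHom T _ (𝒢.toTgt e a))⁻¹ = 1 :=
    𝒢.mk_relator T (Or.inl ⟨e, a, rfl⟩)
  rw [mul_inv_eq_one, mul_assoc, inv_mul_eq_iff_eq_mul] at h
  cases b
  · rw [← Bool.not_true, stableLetter_not]
    rw [mul_inv_eq_iff_eq_mul, mul_assoc, eq_inv_mul_iff_mul_eq]
    exact h.symm
  · exact h

variable {𝒢 T}

theorem fundGroup_induction {C : 𝒢.FundGroup T → Prop} (hvert : ∀ v x, C (𝒢.vertexHom T v x))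
    (hletter : ∀ e b, C (𝒢.stableLetter T e b)) (hone : C 1) (hmul : ∀ x y, C x → C y → C (x * y))
    (g : 𝒢.FundGroup T) : C g := by
  obtain ⟨g, rfl⟩ := QuotientGroup.mk'_surjective _ g
  induction g using Monoid.Coprod.induction_on with
  | inl x =>
    induction x using Monoid.CoprodI.induction_on with
    | one => simpa using hone
    | of v x => exact hvert v x
    | mul x y hx hy => rw [map_mul, map_mul]; exact hmul _ _ hx hy
  | inr x =>
    induction x using FreeGroup.induction_on with
    | C1 => simpa using hone
    | of e => exact hletter e true
    | inv_of e _ => exact hletter e false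
    | mul x y hx hy => rw [map_mul, map_mul]; exact hmul _ _ hx hy
  | mul x y hx hy => rw [map_mul]; exact hmul _ _ hx hy

namespace GPath

variable (T) in
/-- The element of the fundamental group represented by a path. -/
def val : ∀ {v w : V}, 𝒢.GPath v w → 𝒢.FundGroup T
  | _, _, last g => 𝒢.vertexHom T _ g
  | _, _, cons e b g p => 𝒢.vertexHom T _ g * 𝒢.stableLetter T e b * val p

theorem val_lmul {v w : V} (p : 𝒢.GPath v w) (x : 𝒢.vert v) :
    (p.lmul x).val T = 𝒢.vertexHom T v x * p.val T := by
  cases p <;> simp only [lmul, val, map_mul, mul_assoc]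

theorem exists_comp {u v w : V} (p : 𝒢.GPath u v) (q : 𝒢.GPath v w) :
    ∃ r : 𝒢.GPath u w, r.val T = p.val T * q.val T := by
  induction p with
  | last g => exact ⟨q.lmul g, val_lmul q g⟩
  | cons e b g p ih =>
    obtain ⟨r, hr⟩ := ih q
    exact ⟨cons e b g r, by rw [val, val, hr, mul_assoc _ (p.val T)]⟩

theorem exists_isRed {v w : V} (p : 𝒢.GPath v w) : ∃ q : 𝒢.GPath v w, q.IsRed ∧ q.val T = p.val T := by
  induction p with
  | last g => exact ⟨last g, trivial, rfl⟩
  | @cons e b w g p ih =>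
    obtain ⟨q, hq, hqp⟩ := ih
    by_cases h : ∃ a p', q = cons e (!b) (𝒢.edgeHom e (!b) a) p'
    · obtain ⟨a, p', rfl⟩ := h
      -- `p'` starts at `origin e (!!b)`; a variable `b'` equal to `b` avoids transporting the path
      -- along the double negation.
      have key : ∀ b' (hb' : b' = b) (r : 𝒢.GPath (𝒢.origin e b') w), r.IsRed →
          𝒢.vertexHom T _ (𝒢.edgeHom e (!b) a) * 𝒢.stableLetter T e (!b) * r.val T = p.val T →
          ∃ q : 𝒢.GPath (𝒢.origin e b) w, q.IsRed ∧ q.val T = (cons e b g p).val T := by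
        rintro b' rfl r hr hrp
        refine ⟨r.lmul (g * 𝒢.edgeHom e b' a), hr.lmul _, ?_⟩
        rw [val_lmul, val, ← hrp, stableLetter_not, map_mul]
        simp only [← mul_assoc]
        rw [mul_assoc _ _ (𝒢.vertexHom T _ (𝒢.edgeHom e (!b') a)), ← vertexHom_mul_stableLetter]
        simp only [← mul_assoc, mul_inv_cancel_right]
      exact key _ (Bool.not_not b) p' hq.1 hqp
    · push Not at h
      exact ⟨cons e b g q, ⟨hq, h⟩, by rw [val, val, hqp]⟩

/-- The converse of `IsRed.mem_sub`, valid for every path and already in the fundamental group. -/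
theorem exists_push {v w : V} (p : 𝒢.GPath v w) {x : 𝒢.vert v} (hx : x ∈ p.sub) :
    ∃ y, 𝒢.vertexHom T v x * p.val T = p.val T * 𝒢.vertexHom T w y := by
  induction p with
  | last g => exact ⟨g⁻¹ * x * g, by simp only [val, ← map_mul]; congr 1; group⟩
  | @cons e b w g p ih =>
    obtain ⟨a, ha, hax⟩ := mem_conjSubgroup.1 hx
    obtain ⟨y, hy⟩ := ih ha
    refine ⟨y, ?_⟩
    have hxg : x * g = g * 𝒢.edgeHom e b a := by
      rw [hax]
      group
    simp only [val]
    rw [mul_assoc _ _ (𝒢.vertexHom T w y), ← hy, ← mul_assoc, ← mul_assoc, ← map_mul, hxg, map_mul,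
      mul_assoc _ _ (𝒢.stableLetter T e b), vertexHom_mul_stableLetter]
    simp only [mul_assoc]

end GPath

/-- Any two vertices are joined by a path of the graph of groups that represents the identity. -/
theorem IsSpanningTree.exists_val_eq_one (hT : 𝒢.IsSpanningTree T) (v w : V) :
    ∃ p : 𝒢.GPath v w, p.val T = 1 := by
  obtain ⟨p⟩ := hT.2.2.connected.preconnected v w
  induction p with
  | nil => exact ⟨.last 1, map_one _⟩
  | cons h p ih =>
    obtain ⟨q, hq⟩ := ih
    obtain ⟨⟨e, he, hs⟩, -⟩ := (SimpleGraph.fromEdgeSet_adj _).1 h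
    have key : ∀ b w (q : 𝒢.GPath (𝒢.origin e (!b)) w), q.val T = 1 →
        ∃ p : 𝒢.GPath (𝒢.origin e b) w, p.val T = 1 := fun b w q hq => ⟨.cons e b 1 q, by
      rw [GPath.val, hq, 𝒢.stableLetter_of_mem T he, map_one, one_mul, one_mul]⟩
    rcases Sym2.eq_iff.1 hs with ⟨rfl, rfl⟩ | ⟨rfl, rfl⟩
    exacts [key true _ q hq, key false _ q hq]

/-- Endpoints can be prescribed freely because tree edges represent the identity. -/
theorem IsSpanningTree.exists_val_eq (hT : 𝒢.IsSpanningTree T) (g : 𝒢.FundGroup T) :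
    ∀ v w : V, ∃ p : 𝒢.GPath v w, p.val T = g := by
  induction g using fundGroup_induction with
  | hvert u x =>
    intro v w
    obtain ⟨p, hp⟩ := hT.exists_val_eq_one v u
    obtain ⟨q, hq⟩ := hT.exists_val_eq_one u w
    obtain ⟨r, hr⟩ := GPath.exists_comp (T := T) p (q.lmul x)
    exact ⟨r, by rw [hr, GPath.val_lmul, hp, hq, one_mul, mul_one]⟩
  | hletter e b =>
    intro v w
    obtain ⟨p, hp⟩ := hT.exists_val_eq_one v (𝒢.origin e b)
    obtain ⟨q, hq⟩ := hT.exists_val_eq_one (𝒢.origin e (!b)) w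
    obtain ⟨r, hr⟩ := GPath.exists_comp (T := T) p (.cons e b 1 q)
    exact ⟨r, by rw [hr, GPath.val, hp, hq, one_mul, mul_one, map_one, one_mul]⟩
  | hone => exact hT.exists_val_eq_one
  | hmul x y hx hy =>
    intro v w
    obtain ⟨p, hp⟩ := hx v v
    obtain ⟨q, hq⟩ := hy v w
    obtain ⟨r, hr⟩ := GPath.exists_comp (T := T) p q
    exact ⟨r, by rw [hr, hp, hq]⟩

open Classical in
theorem IsSpanningTree.exists_bigPotential (hT : 𝒢.IsSpanningTree T) :
    ∃ γ : V → 𝒢.BigHNN, ∀ e ∈ T, γ (𝒢.tgt e) = γ (𝒢.src e) * 𝒢.bigLetter e true := by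
  -- The letter of the tree edge joining two vertices; `T` has neither loops nor multiple edges, so
  -- the choice is unambiguous.
  let τ : V → V → 𝒢.BigHNN := fun a b =>
    if h : ∃ q : E × Bool, q.1 ∈ T ∧ 𝒢.origin q.1 q.2 = a ∧ 𝒢.origin q.1 (!q.2) = b then
      𝒢.bigLetter h.choose.1 h.choose.2 else 1
  have hτ : ∀ e ∈ T, ∀ b, τ (𝒢.origin e b) (𝒢.origin e (!b)) = 𝒢.bigLetter e b := by
    intro e he b
    have h : ∃ q : E × Bool, q.1 ∈ T ∧ 𝒢.origin q.1 q.2 = 𝒢.origin e b ∧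
      𝒢.origin q.1 (!q.2) = 𝒢.origin e (!b) := ⟨(e, b), he, rfl, rfl⟩
    simp only [τ, dif_pos h]
    obtain ⟨h1, h2, h3⟩ := h.choose_spec
    generalize h.choose = q at h1 h2 h3
    obtain ⟨e', b'⟩ := q
    have hee : e' = e := by
      refine hT.2.1 h1 he ?_
      cases b <;> cases b' <;> simp_all [origin, Sym2.eq_swap]
    subst hee
    have hne := hT.1 e' he
    have hbb : b' = b := by
      cases b <;> cases b' <;> simp_all [origin]
    rw [hbb]
  have hadj : ∀ a b, (SimpleGraph.fromEdgeSet ((fun e => s(𝒢.src e, 𝒢.tgt e)) '' T)).Adj a b →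
      ∃ e ∈ T, ∃ c, a = 𝒢.origin e c ∧ b = 𝒢.origin e (!c) := by
    intro a b h
    obtain ⟨⟨e, he, hs⟩, -⟩ := (SimpleGraph.fromEdgeSet_adj _).1 h
    rcases Sym2.eq_iff.1 hs with ⟨rfl, rfl⟩ | ⟨rfl, rfl⟩
    exacts [⟨e, he, true, rfl, rfl⟩, ⟨e, he, false, rfl, rfl⟩]
  obtain ⟨γ, hγ⟩ := hT.2.2.exists_potential τ fun a b h => by
    obtain ⟨e, he, c, rfl, rfl⟩ := hadj a b h
    have h1 := hτ e he (!c)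
    rw [Bool.not_not] at h1
    rw [h1, hτ e he c, bigLetter_not]
  refine ⟨γ, fun e he => ?_⟩
  rw [← hτ e he true]
  exact hγ _ _ ((SimpleGraph.fromEdgeSet_adj _).2 ⟨⟨e, he, rfl⟩, hT.1 e he⟩)

open Classical in
/-- A homomorphism from the fundamental group which is conjugate to the standard inclusions. -/
theorem IsSpanningTree.exists_toBig (hT : 𝒢.IsSpanningTree T) :
    ∃ (Ψ : 𝒢.FundGroup T →* 𝒢.BigHNN) (γ : V → 𝒢.BigHNN),
      ∀ {v w : V} (p : 𝒢.GPath v w), Ψ (p.val T) = γ v * p.bigVal * (γ w)⁻¹ := by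
  obtain ⟨γ, hγ⟩ := hT.exists_bigPotential
  -- Conjugating each vertex group by the potential makes the letters of tree edges trivial.
  let Φ : 𝒢.FreeProd →* 𝒢.BigHNN := Monoid.Coprod.lift
    (Monoid.CoprodI.lift fun v => ((MulAut.conj (γ v)).toMonoidHom.comp HNNExtension.of).comp
      (𝒢.vertEmb v))
    (FreeGroup.lift fun e => γ (𝒢.src e) * 𝒢.bigLetter e true * (γ (𝒢.tgt e))⁻¹)
  have hΦv : ∀ {v : V} (x : 𝒢.vert v),
      Φ (𝒢.elt x) = γ v * HNNExtension.of (𝒢.vertEmb v x) * (γ v)⁻¹ := fun x => by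
    simp [Φ, elt]
  have hΦl : ∀ e, Φ (𝒢.letter e) = γ (𝒢.src e) * 𝒢.bigLetter e true * (γ (𝒢.tgt e))⁻¹ := fun e => by
    simp [Φ, letter]
  have hker : Subgroup.normalClosure (𝒢.relators T) ≤ Φ.ker := by
    refine Subgroup.normalClosure_le_normal ?_
    rintro _ (⟨e, a, rfl⟩ | ⟨e, he, rfl⟩)
    · have h := 𝒢.vertEmb_mul_bigLetter e true a
      simp only [SetLike.mem_coe, MonoidHom.mem_ker, map_mul, map_inv, hΦv, hΦl]
      have h' : HNNExtension.of (𝒢.vertEmb _ (𝒢.toSrc e a)) * 𝒢.bigLetter e true =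
        𝒢.bigLetter e true * HNNExtension.of (𝒢.vertEmb _ (𝒢.toTgt e a)) := h
      rw [mul_inv_eq_one]
      simp only [mul_inv_rev, inv_inv, mul_assoc, inv_mul_cancel_left]
      rw [← mul_assoc (HNNExtension.of _) (𝒢.bigLetter e true), h']
      simp only [mul_assoc, inv_mul_cancel_left]
    · rw [SetLike.mem_coe, MonoidHom.mem_ker, hΦl, hγ e he, mul_inv_cancel]
  refine ⟨QuotientGroup.lift _ Φ hker, γ, fun {v w} p => ?_⟩
  have hv : ∀ {v : V} (x : 𝒢.vert v), QuotientGroup.lift _ Φ hker (𝒢.vertexHom T v x) =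
      γ v * HNNExtension.of (𝒢.vertEmb v x) * (γ v)⁻¹ := fun x => hΦv x
  have hl : ∀ e b, QuotientGroup.lift _ Φ hker (𝒢.stableLetter T e b) =
      γ (𝒢.origin e b) * 𝒢.bigLetter e b * (γ (𝒢.origin e (!b)))⁻¹ := by
    intro e b
    cases b
    · have h1 := 𝒢.stableLetter_not T e true
      have h2 := 𝒢.bigLetter_not e true
      simp only [Bool.not_true] at h1 h2
      rw [h1, map_inv, h2]
      refine (congrArg _ (hΦl e)).trans ?_
      simp only [mul_inv_rev, inv_inv, mul_assoc]
      rfl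
    · exact hΦl e
  induction p with
  | last g => exact hv g
  | cons e b g p ih =>
    rw [GPath.val, map_mul, map_mul, ih, hv, hl, GPath.bigVal]
    simp only [mul_assoc, inv_mul_cancel_left]

/-- A family of subgroups of the vertex groups that is closed under conjugation and under transport
along the edges contains the intersections of conjugates of the vertex groups. -/
theorem IsSpanningTree.comap_conjSubgroup_mem (hT : 𝒢.IsSpanningTree T)
    (𝒦 : ∀ v, Set (Subgroup (𝒢.vert v))) (htop : ∀ v, ⊤ ∈ 𝒦 v)
    (hconj : ∀ v, ∀ K ∈ 𝒦 v, ∀ g, conjSubgroup g K ∈ 𝒦 v)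
    (hedge : ∀ e b, ∀ K ∈ 𝒦 (𝒢.origin e (!b)),
      (K.comap (𝒢.edgeHom e (!b))).map (𝒢.edgeHom e b) ∈ 𝒦 (𝒢.origin e b))
    (g : 𝒢.FundGroup T) (v w : V) :
    (conjSubgroup g (𝒢.vertexHom T w).range).comap (𝒢.vertexHom T v) ∈ 𝒦 v := by
  classical
  obtain ⟨p, rfl⟩ := hT.exists_val_eq g v w
  obtain ⟨q, hq, hqp⟩ := GPath.exists_isRed (T := T) p
  have hsub : q.sub ∈ 𝒦 v := by
    clear hqp hq
    induction q with
    | last g => exact htop _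
    | cons e b g q ih => exact hconj _ _ (hedge e b _ (ih q)) g
  convert hsub
  ext x
  rw [← hqp, Subgroup.mem_comap, mem_conjSubgroup]
  constructor
  -- Membership means `x q = q y` in the fundamental group. Under `Ψ` the potentials cancel, leaving
  -- the same equation in the HNN extension.
  · rintro ⟨y, hy⟩
    obtain ⟨Ψ, γ, hΨ⟩ := hT.exists_toBig
    refine hq.mem_sub (y := y) ?_
    have h1 : 𝒢.vertexHom T v x * q.val T = q.val T * 𝒢.vertexHom T w y := by
      rw [hy]
      group
    have h2 := congrArg Ψ h1
    have hx : Ψ (𝒢.vertexHom T v x) = _ := hΨ (GPath.last x)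
    have hy' : Ψ (𝒢.vertexHom T w y) = _ := hΨ (GPath.last y)
    rw [map_mul, map_mul, hx, hy', hΨ] at h2
    simp only [GPath.bigVal, mul_assoc, inv_mul_cancel_left, mul_right_inj] at h2
    rw [← mul_assoc, ← mul_assoc] at h2
    exact mul_right_cancel h2
  · intro hx
    obtain ⟨y, hy⟩ := q.exists_push (T := T) hx
    exact ⟨y, by rw [mul_assoc, hy, inv_mul_cancel_left]⟩

end FundGroup

end GraphOfGroups

end

/-! ### The lifting property and ranks of subgroups. -/

section

universe u

/-- A homomorphism with the left lifting property against surjective homomorphisms. -/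
def IsLifting {A F : Type*} [Group A] [Group F] (i : A →* F) : Prop :=
  ∀ (H Q : Type u) [Group H] [Group Q] (π : H →* Q) (f : F →* Q) (g : A →* H),
    Function.Surjective π → π.comp g = f.comp i → ∃ h : F →* H, π.comp h = f ∧ h.comp i = g

namespace IsLifting

theorem of_mulEquiv {A F : Type*} [Group A] [Group F] (e : A ≃* F) :
    IsLifting.{u} e.toMonoidHom := by
  intro H Q _ _ π f g _ h
  refine ⟨g.comp e.symm.toMonoidHom, ?_, ?_⟩
  · rw [← MonoidHom.comp_assoc, h]
    ext x
    simp
  · ext x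
    simp

theorem comp {A B C : Type*} [Group A] [Group B] [Group C] {i : A →* B} {j : B →* C}
    (hj : IsLifting.{u} j) (hi : IsLifting.{u} i) : IsLifting.{u} (j.comp i) := by
  intro H Q _ _ π f g hπ h
  obtain ⟨k, h1, h2⟩ := hi H Q π (f.comp j) g hπ h
  obtain ⟨l, h3, h4⟩ := hj H Q π f k hπ h1
  exact ⟨l, h3, by rw [← MonoidHom.comp_assoc, h4, h2]⟩

theorem range_subtype {A F : Type*} [Group A] [Group F] {i : A →* F}
    (hi : IsLifting.{u} i) (hinj : Function.Injective i) : IsLifting.{u} i.range.subtype := by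
  have := hi.comp (of_mulEquiv (MonoidHom.ofInjective hinj).symm)
  convert this
  ext x
  exact (congrArg Subtype.val ((MonoidHom.ofInjective hinj).apply_symm_apply x)).symm

theorem of_range_subtype {A F : Type*} [Group A] [Group F] {i : A →* F}
    (hi : IsLifting.{u} i.range.subtype) (hinj : Function.Injective i) : IsLifting.{u} i :=
  hi.comp (of_mulEquiv (MonoidHom.ofInjective hinj))

variable {F : Type u} [Group F] {A B : Subgroup F}

theorem top : IsLifting.{u} (⊤ : Subgroup F).subtype := of_mulEquiv Subgroup.topEquiv

theorem conj (hA : IsLifting.{u} A.subtype) (g : F) :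
    IsLifting.{u} (conjSubgroup g A).subtype := by
  have h := ((of_mulEquiv.{u} (MulAut.conj g)).comp hA).range_subtype
    ((MulAut.conj g).injective.comp A.subtype_injective)
  have hr : ((MulAut.conj g).toMonoidHom.comp A.subtype).range = conjSubgroup g A := by
    rw [MonoidHom.range_comp, Subgroup.range_subtype]
    rfl
  rwa [hr] at h

/-- The complementary factor is free, being a subgroup of a free group, so `f` lifts on it freely
while `g` is prescribed on `A`. -/
theorem of_isFreeFactor [IsFreeGroup F] (hA : IsFreeFactor A) : IsLifting.{u} A.subtype := by
  obtain ⟨B, hB⟩ := hA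
  intro H Q _ _ π f g hπ h
  choose s hs using hπ
  let φ := MulEquiv.ofBijective _ hB
  let k : B →* H := IsFreeGroup.lift fun x => s (f (IsFreeGroup.of x : B))
  have hk : π.comp k = f.comp B.subtype := IsFreeGroup.ext_hom fun x => by
    simp [k, hs]
  have hφ : φ.symm.toMonoidHom.comp (Monoid.Coprod.lift A.subtype B.subtype) = MonoidHom.id _ := by
    ext x
    · exact φ.symm_apply_apply (Monoid.Coprod.inl x)
    · exact φ.symm_apply_apply (Monoid.Coprod.inr x)
  refine ⟨(Monoid.Coprod.lift g k).comp φ.symm.toMonoidHom, ?_, ?_⟩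
  · refine (MonoidHom.cancel_right hB.2).1 ?_
    rw [MonoidHom.comp_assoc, MonoidHom.comp_assoc, hφ, MonoidHom.comp_id]
    refine Monoid.Coprod.hom_ext ?_ ?_
    · rw [MonoidHom.comp_assoc, MonoidHom.comp_assoc, Monoid.Coprod.lift_comp_inl,
        Monoid.Coprod.lift_comp_inl, h]
    · rw [MonoidHom.comp_assoc, MonoidHom.comp_assoc, Monoid.Coprod.lift_comp_inr,
        Monoid.Coprod.lift_comp_inr, hk]
  · have hA : A.subtype = (Monoid.Coprod.lift A.subtype B.subtype).comp Monoid.Coprod.inl := by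
      rw [Monoid.Coprod.lift_comp_inl]
    rw [MonoidHom.comp_assoc, hA, ← MonoidHom.comp_assoc _ _ φ.symm.toMonoidHom, hφ,
      MonoidHom.id_comp, Monoid.Coprod.lift_comp_inl]

end IsLifting

section Cocycle

variable {F : Type u} [Group F] (A B : Subgroup F)

/-- Representatives of cosets meeting `A` are taken in `A`, so that the cocycle of elements of `A`
at such cosets has values in `A ∩ B`. -/
theorem exists_coset_section : ∃ s : F ⧸ B → F, (∀ ω, (s ω : F ⧸ B) = ω) ∧ s (1 : F) = 1 ∧
    ∀ a ∈ A, s (a : F) ∈ A := by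
  classical
  refine ⟨fun ω => if ω = (1 : F) then 1 else if h : ∃ a ∈ A, (a : F ⧸ B) = ω then h.choose
    else ω.out, fun ω => ?_, if_pos rfl, fun a ha => ?_⟩
  · dsimp only
    split_ifs with h1 h2
    exacts [h1.symm, h2.choose_spec.2, ω.out_eq']
  · dsimp only
    have h : ∃ a' ∈ A, (a' : F ⧸ B) = a := ⟨a, ha, rfl⟩
    rw [dif_pos h]
    split_ifs
    exacts [A.one_mem, h.choose_spec.1]

/-- The element of a subgroup by which multiplication differs from a section of the cosets. -/
def cosetCocycle {B : Subgroup F} (s : F ⧸ B → F) (hs : ∀ ω, (s ω : F ⧸ B) = ω) (x : F)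
    (ω : F ⧸ B) : B :=
  ⟨(s (x • ω))⁻¹ * (x * s ω), QuotientGroup.eq.1 (by
    rw [hs]
    conv_lhs => rw [← hs ω]
    rfl)⟩

variable {B} {s : F ⧸ B → F} (hs : ∀ ω, (s ω : F ⧸ B) = ω)

theorem cosetCocycle_mul (x y : F) (ω : F ⧸ B) :
    cosetCocycle s hs (x * y) ω = cosetCocycle s hs x (y • ω) * cosetCocycle s hs y ω := by
  ext
  simp only [cosetCocycle, Subgroup.coe_mul, mul_smul]
  group

theorem cosetCocycle_one (ω : F ⧸ B) : cosetCocycle s hs 1 ω = 1 := by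
  ext
  simp [cosetCocycle]

/-- The wreath product with the permutation group of a set. -/
abbrev PermWreath (Ω H : Type*) [Group H] : Type _ := (Ω → H) ⋊[mulAutArrow] Equiv.Perm Ω

theorem PermWreath.mul_left_apply {Ω H : Type*} [Group H] (a b : PermWreath Ω H) (ω : Ω) :
    (a * b).left ω = a.left ω * b.left (a.right⁻¹ ω) := rfl

/-- The homomorphism induced on wreath products. -/
def PermWreath.map (Ω : Type*) {H Q : Type*} [Group H] [Group Q] (π : H →* Q) :
    PermWreath Ω H →* PermWreath Ω Q :=
  SemidirectProduct.map (π.compLeft Ω) (MonoidHom.id _) fun _ => by ext; rfl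

/-- The homomorphism to the wreath product induced from a subgroup. -/
def cocycleHom {Q : Type*} [Group Q] (f : B →* Q) : F →* PermWreath (F ⧸ B) Q where
  toFun x := ⟨fun ω => f (cosetCocycle s hs x (x⁻¹ • ω)), MulAction.toPerm x⟩
  map_one' := by
    ext ω
    · simp [cosetCocycle_one]
    · simp
  map_mul' x y := by
    ext ω
    · rw [PermWreath.mul_left_apply]
      change f (cosetCocycle s hs (x * y) ((x * y)⁻¹ • ω)) =
        f (cosetCocycle s hs x (x⁻¹ • ω)) * f (cosetCocycle s hs y (y⁻¹ • x⁻¹ • ω))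
      rw [cosetCocycle_mul, map_mul, mul_inv_rev, mul_smul, smul_inv_smul]
    · exact mul_smul x y ω

end Cocycle

/-- Induce `f` from `B` to a homomorphism from `F` to the wreath product of `Q` over `F ⧸ B`. On the
free group `A`, lift it to the wreath product of `H`, prescribing `g` on the orbit of the trivial
coset. The lifting property of `A` extends this to `F`; restrict to `B` and take the coordinate at
the trivial coset, which `B` fixes. -/
theorem IsLifting.subgroupOf {F : Type u} [Group F] [IsFreeGroup F] {A : Subgroup F}
    (hA : IsLifting.{u} A.subtype) (B : Subgroup F) : IsLifting.{u} (A.subgroupOf B).subtype := by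
  classical
  intro H Q _ _ π f g hπ hfg
  obtain ⟨s, hs, hs1, hsA⟩ := exists_coset_section A B
  let c := cosetCocycle s hs
  have hcA : ∀ a ∈ A, ∀ a' ∈ A, ((c a (a' : F) : B) : F) ∈ A := fun a ha a' ha' =>
    A.mul_mem (A.inv_mem (hsA _ (A.mul_mem ha ha'))) (A.mul_mem ha (hsA _ ha'))
  -- `g` extended by 1 outside `A`; only its values on `A ∩ B` are used.
  let gg : B → H := fun y => if h : (y : F) ∈ A then g ⟨y, h⟩ else 1
  have hgg : ∀ {y y' : B}, (y : F) ∈ A → (y' : F) ∈ A → gg (y * y') = gg y * gg y' := by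
    intro y y' h h'
    have h2 : ((y * y' : B) : F) ∈ A := A.mul_mem h h'
    simp only [gg, dif_pos h, dif_pos h', dif_pos h2, ← map_mul]
    rfl
  have hggf : ∀ {y : B}, (y : F) ∈ A → π (gg y) = f y := by
    intro y h
    simp only [gg, dif_pos h]
    exact DFunLike.congr_fun hfg ⟨y, h⟩
  -- Values over cosets meeting `A` are dictated by `g`; elsewhere any lift of `f` will do.
  have hex : ∀ (a : A) (ω : F ⧸ B), ∃ q : H, π q = f (c a ((a : F)⁻¹ • ω)) ∧
      ((∃ a' ∈ A, (a' : F ⧸ B) = ω) → q = gg (c a ((a : F)⁻¹ • ω))) := by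
    intro a ω
    by_cases h : ∃ a' ∈ A, (a' : F ⧸ B) = ω
    · refine ⟨_, ?_, fun _ => rfl⟩
      obtain ⟨a', ha', rfl⟩ := h
      exact hggf (hcA _ a.2 _ (A.mul_mem (A.inv_mem a.2) ha'))
    · obtain ⟨q, hq⟩ := hπ (f (c a ((a : F)⁻¹ • ω)))
      exact ⟨q, hq, fun h' => absurd h' h⟩
  choose L hL1 hL2 using hex
  let Ψ : A →* PermWreath (F ⧸ B) H :=
    IsFreeGroup.lift fun x => ⟨L (IsFreeGroup.of x), MulAction.toPerm (IsFreeGroup.of x : A).1⟩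
  have hΨ : (PermWreath.map _ π).comp Ψ = (cocycleHom hs f).comp A.subtype := by
    refine IsFreeGroup.ext_hom fun x => ?_
    rw [MonoidHom.comp_apply, IsFreeGroup.lift_of]
    ext ω
    · exact hL1 _ _
    · rfl
  have hright : ∀ a, (Ψ a).right = MulAction.toPerm (a : F) := fun a =>
    congrArg SemidirectProduct.right (DFunLike.congr_fun hΨ a)
  have hone : gg 1 = 1 := by
    have h1 := hgg (y := 1) (y' := 1) A.one_mem A.one_mem
    rwa [mul_one, left_eq_mul] at h1
  have hΨg : ∀ (a : A), ∀ a' ∈ A, (Ψ a).left ((a : F) • ((a' : F) : F ⧸ B)) = gg (c a (a' : F)) := by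
    intro a
    obtain ⟨z, rfl⟩ := (IsFreeGroup.mulEquiv A).surjective a
    have hof : ∀ x, ∀ a' ∈ A, (Ψ (IsFreeGroup.of x)).left (((IsFreeGroup.of x : A) : F) •
        ((a' : F) : F ⧸ B)) = gg (c (IsFreeGroup.of x : A) (a' : F)) := by
      intro x a' ha'
      have h : Ψ (IsFreeGroup.of x) = ⟨L (IsFreeGroup.of x), _⟩ := IsFreeGroup.lift_of _ _
      have h2 := hL2 (IsFreeGroup.of x) (((IsFreeGroup.of x : A) : F) • ((a' : F) : F ⧸ B))
        ⟨_, A.mul_mem (IsFreeGroup.of x : A).2 ha', rfl⟩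
      rw [inv_smul_smul] at h2
      exact (congrFun (congrArg SemidirectProduct.left h) _).trans h2
    induction z using FreeGroup.induction_on with
    | C1 =>
      intro a' ha'
      rw [map_one, map_one]
      simp only [c, OneMemClass.coe_one, cosetCocycle_one, hone]
      rfl
    | of x => exact hof x
    | inv_of x _ =>
      intro a' ha'
      rw [map_inv]
      change (Ψ (IsFreeGroup.of x)⁻¹).left ((((IsFreeGroup.of x)⁻¹ : A) : F) •
        ((a' : F) : F ⧸ B)) = gg (c ((IsFreeGroup.of x)⁻¹ : A) (a' : F))
      generalize hy : (IsFreeGroup.of x : A) = y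
      have h1 := hof x _ (A.mul_mem (A.inv_mem y.2) ha')
      rw [hy] at h1
      have h2 : (y : F) • (((y : F)⁻¹ * a' : F) : F ⧸ B) = (a' : F) :=
        smul_inv_smul (y : F) ((a' : F) : F ⧸ B)
      rw [h2] at h1
      have h3 : (Ψ (y * y⁻¹)).left (a' : F) = 1 := by
        rw [mul_inv_cancel, map_one]
        rfl
      rw [map_mul, PermWreath.mul_left_apply, hright, h1] at h3
      have h4 : c (y * (y : F)⁻¹) (a' : F) = 1 := by
        rw [mul_inv_cancel]
        exact cosetCocycle_one hs _
      have h5 : gg (c y (((y : F)⁻¹ * a' : F) : F ⧸ B)) * gg (c (y : F)⁻¹ (a' : F)) = 1 := by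
        rw [← hgg (hcA _ y.2 _ (A.mul_mem (A.inv_mem y.2) ha')) (hcA _ (A.inv_mem y.2) _ ha'),
          ← hone, ← h4]
        exact congrArg gg (cosetCocycle_mul hs (y : F) (y : F)⁻¹ (a' : F)).symm
      exact mul_left_cancel (h3.trans h5.symm)
    | mul x y hx hy =>
      intro a' ha'
      rw [map_mul, map_mul, PermWreath.mul_left_apply, hright]
      generalize IsFreeGroup.mulEquiv A x = u at hx
      generalize IsFreeGroup.mulEquiv A y = v at hy
      rw [Subgroup.coe_mul, mul_smul]
      have h1 : ((MulAction.toPerm (u : F))⁻¹ : Equiv.Perm (F ⧸ B))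
          ((u : F) • (v : F) • ((a' : F) : F ⧸ B)) = (v : F) • ((a' : F) : F ⧸ B) := by
        rw [Equiv.Perm.inv_eq_iff_eq]
        rfl
      rw [h1, hy a' ha']
      refine (congrArg (· * _) (hx (v * a') (A.mul_mem v.2 ha'))).trans ?_
      rw [← hgg (hcA _ u.2 _ (A.mul_mem v.2 ha')) (hcA _ v.2 _ ha')]
      exact congrArg gg (cosetCocycle_mul hs (u : F) (v : F) (a' : F)).symm
  obtain ⟨Φ, hΦ1, hΦ2⟩ := hA _ _ (PermWreath.map _ π) (cocycleHom hs f) Ψ (fun q => by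
    refine ⟨⟨fun ω => (hπ (q.left ω)).choose, q.right⟩, ?_⟩
    ext ω
    · exact (hπ (q.left ω)).choose_spec
    · rfl) hΨ
  have hΦr : ∀ x, (Φ x).right = MulAction.toPerm x := fun x =>
    congrArg SemidirectProduct.right (DFunLike.congr_fun hΦ1 x)
  have hfix : ∀ b : B, (b : F)⁻¹ • ((1 : F) : F ⧸ B) = (1 : F) := fun b =>
    QuotientGroup.eq.2 (by simp)
  have hc1 : ∀ b : B, c b ((b : F)⁻¹ • ((1 : F) : F ⧸ B)) = b := by
    intro b
    have h2 : (b : F) • ((1 : F) : F ⧸ B) = (1 : F) := QuotientGroup.eq.2 (by simp)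
    ext
    simp only [c, cosetCocycle, hfix, h2, hs1]
    simp
  refine ⟨⟨⟨fun b => (Φ b).left (1 : F), ?_⟩, fun b b' => ?_⟩, ?_, ?_⟩
  · simp
  · dsimp only
    rw [Subgroup.coe_mul, map_mul, PermWreath.mul_left_apply, hΦr]
    exact congrArg (fun ω => (Φ b).left (1 : F) * (Φ b').left ω) (hfix b)
  · ext b
    have h := congrFun (congrArg SemidirectProduct.left (DFunLike.congr_fun hΦ1 (b : F))) (1 : F)
    exact h.trans (congrArg f (hc1 b))
  · ext y
    have h := DFunLike.congr_fun hΦ2 ⟨(y : B), y.2⟩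
    have h2 := hΨg ⟨(y : B), y.2⟩ 1 A.one_mem
    have h3 : ((y : B) : F) • ((1 : F) : F ⧸ B) = (1 : F) := QuotientGroup.eq.2 (by simp)
    have h4 := hc1 y
    rw [hfix] at h4
    rw [h3] at h2
    refine (congrFun (congrArg SemidirectProduct.left h) (1 : F)).trans (h2.trans ?_)
    exact (congrArg gg h4).trans (dif_pos y.2)

namespace IsLifting

variable {F : Type u} [Group F] [IsFreeGroup F] {A B : Subgroup F}

theorem inf (hA : IsLifting.{u} A.subtype) (hB : IsLifting.{u} B.subtype) :
    IsLifting.{u} (A ⊓ B).subtype := by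
  have h := (hB.comp (hA.subgroupOf B)).range_subtype
    (B.subtype_injective.comp (Subgroup.subtype_injective _))
  rwa [MonoidHom.range_comp, Subgroup.range_subtype, Subgroup.subgroupOf_map_subtype] at h

/-- `A ∩ j(D)` has the lifting property in `j(D) ≅ D`, and composing with `j'` preserves it. -/
theorem map_comap {F' D : Type*} [Group F'] [Group D] {j : D →* F} {j' : D →* F'}
    (hj : Function.Injective j) (hj' : Function.Injective j') (hlift : IsLifting.{u} j')
    (hA : IsLifting.{u} A.subtype) : IsLifting.{u} ((A.comap j).map j').subtype := by
  let e := MonoidHom.ofInjective hj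
  have h := (hlift.comp ((of_mulEquiv e.symm).comp (hA.subgroupOf j.range))).range_subtype
    (hj'.comp (e.symm.injective.comp (Subgroup.subtype_injective _)))
  have hr : (j'.comp (e.symm.toMonoidHom.comp (A.subgroupOf j.range).subtype)).range =
      (A.comap j).map j' := by
    rw [MonoidHom.range_comp, MonoidHom.range_comp, Subgroup.range_subtype]
    congr 1
    ext d
    constructor
    · rintro ⟨y, hy, rfl⟩
      change j (e.symm y) ∈ A
      have : j (e.symm y) = y := congrArg Subtype.val (e.apply_symm_apply y)
      rwa [this]
    · intro hd
      exact ⟨e d, hd, e.symm_apply_apply d⟩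
  rwa [hr] at h

end IsLifting

/-- Free groups are residually finite. -/
theorem FreeGroup.exists_finite_ne_one {α : Type u} {x : FreeGroup α} (hx : x ≠ 1) :
    ∃ (Q : Type u) (_ : Group Q) (_ : Finite Q) (f : FreeGroup α →* Q), f x ≠ 1 := by
  classical
  let S : Set (FreeGroup α) := FreeGroup.mk '' {t | t <:+ x.toWord}
  have hS : S.Finite := ((x.toWord.tails.finite_toSet).subset fun t ht => by simpa using ht).image _
  have : Finite S := hS
  -- Left multiplication by a letter is a partial injection of the finite set of suffixes of `x`;
  -- extended to permutations, the letters of `x` carry 1 to `x`.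
  have hσ : ∀ a : α, ∃ σ : Equiv.Perm S, ∀ s s' : S, FreeGroup.of a * (s : FreeGroup α) = s' →
      σ s = s' := by
    intro a
    obtain ⟨σ, hσ⟩ := Equiv.Perm.exists_extending_pair
      (fun q : {s : S // FreeGroup.of a * (s : FreeGroup α) ∈ S} => q.1)
      (fun q => ⟨FreeGroup.of a * q.1, q.2⟩) Subtype.val_injective
      (fun q q' h => Subtype.ext (Subtype.ext (mul_left_cancel (congrArg Subtype.val h))))
    refine ⟨σ, fun s s' h => ?_⟩
    have hs : FreeGroup.of a * (s : FreeGroup α) ∈ S := h ▸ s'.2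
    exact (hσ ⟨s, hs⟩).trans (Subtype.ext h)
  choose σ hσ using hσ
  have h1 : (1 : FreeGroup α) ∈ S := ⟨[], List.nil_suffix, rfl⟩
  have key : ∀ t, (ht : t <:+ x.toWord) →
      FreeGroup.lift σ (FreeGroup.mk t) ⟨1, h1⟩ = ⟨FreeGroup.mk t, t, ht, rfl⟩ := by
    intro t
    induction t with
    | nil => exact fun _ => rfl
    | cons q t ih =>
      intro ht
      have ht' : t <:+ x.toWord := (List.suffix_cons q t).trans ht
      have hcons : FreeGroup.mk (q :: t) = FreeGroup.mk [q] * FreeGroup.mk t := rfl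
      rw [show FreeGroup.lift σ (FreeGroup.mk (q :: t)) =
        FreeGroup.lift σ (FreeGroup.mk [q]) * FreeGroup.lift σ (FreeGroup.mk t) by
          rw [hcons, _root_.map_mul], Equiv.Perm.mul_apply, ih ht']
      rcases q with ⟨a, - | -⟩
      · have h : FreeGroup.lift σ (FreeGroup.mk [(a, false)]) = (σ a)⁻¹ := by
          simp [FreeGroup.lift_mk]
        rw [h, Equiv.Perm.inv_eq_iff_eq, eq_comm]
        refine hσ a _ _ ?_
        change FreeGroup.of a * ((FreeGroup.of a)⁻¹ * FreeGroup.mk t) = FreeGroup.mk t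
        rw [mul_inv_cancel_left]
      · have h : FreeGroup.lift σ (FreeGroup.mk [(a, true)]) = σ a := by
          simp [FreeGroup.lift_mk]
        rw [h]
        exact hσ a _ _ rfl
  refine ⟨Equiv.Perm S, inferInstance, inferInstance, FreeGroup.lift σ, fun h => hx ?_⟩
  have h2 := key x.toWord List.suffix_rfl
  have hk : FreeGroup.lift σ (FreeGroup.mk x.toWord) = 1 := by rw [FreeGroup.mk_toWord, h]
  rw [hk] at h2
  have h3 : 1 = FreeGroup.mk x.toWord := congrArg Subtype.val h2
  rw [h3, FreeGroup.mk_toWord]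

theorem IsFreeGroup.exists_finite_ne_one {F : Type u} [Group F] [IsFreeGroup F] {x : F}
    (hx : x ≠ 1) : ∃ (Q : Type u) (_ : Group Q) (_ : Finite Q) (f : F →* Q), f x ≠ 1 := by
  obtain ⟨Q, _, hQ, f, hf⟩ := FreeGroup.exists_finite_ne_one
    (x := IsFreeGroup.toFreeGroup F x) (by simpa using hx)
  exact ⟨Q, _, hQ, f.comp (IsFreeGroup.toFreeGroup F).toMonoidHom, hf⟩

theorem IsFreeGroup.card_monoidHom (F : Type u) [Group F] [IsFreeGroup F] (Q : Type u) [Group Q]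
    [Finite (IsFreeGroup.Generators F)] :
    Nat.card (F →* Q) = Nat.card Q ^ Nat.card (IsFreeGroup.Generators F) := by
  rw [← Nat.card_congr (IsFreeGroup.lift (G := F) (H := Q)), Nat.card_fun]

theorem Group.FG.finite_monoidHom (F : Type u) [Group F] [Group.FG F] (Q : Type u) [Group Q]
    [Finite Q] : Finite (F →* Q) := by
  obtain ⟨s, hs⟩ := Group.FG.out (G := F)
  refine Finite.of_injective (fun (f : F →* Q) (x : s) => f x) fun f g h => ?_
  exact MonoidHom.eq_of_eqOn_dense hs fun x hx => congrFun h ⟨x, hx⟩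

theorem IsFreeGroup.finite_generators (F : Type u) [Group F] [IsFreeGroup F]
    (h : ∀ (Q : Type u) [Group Q] [Finite Q], Finite (F →* Q)) :
    Finite (IsFreeGroup.Generators F) := by
  let Q : Type u := ULift (Multiplicative (ZMod 2))
  have hfin : Finite (IsFreeGroup.Generators F → Q) :=
    @Finite.of_equiv _ _ (h Q) IsFreeGroup.lift.symm
  by_contra hinf
  rw [not_finite_iff_infinite] at hinf
  exact not_finite (IsFreeGroup.Generators F → Q)

namespace IsLifting

variable {F : Type u} [Group F] {A B : Subgroup F}

theorem exists_extend (hA : IsLifting.{u} A.subtype) {Q : Type u} [Group Q] (g : A →* Q) :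
    ∃ f : F →* Q, f.comp A.subtype = g := by
  obtain ⟨f, -, hf⟩ := hA Q PUnit (1 : Q →* PUnit.{u + 1}) 1 g (fun _ => ⟨1, rfl⟩) rfl
  exact ⟨f, hf⟩

variable [Group.FG F]

theorem finite_monoidHom (hA : IsLifting.{u} A.subtype) (Q : Type u) [Group Q] [Finite Q] :
    Finite (A →* Q) := by
  have := Group.FG.finite_monoidHom F Q
  exact Finite.of_surjective (fun f : F →* Q => f.comp A.subtype) fun g => hA.exists_extend g

variable [IsFreeGroup F]

theorem finite_generators (hA : IsLifting.{u} A.subtype) : Finite (IsFreeGroup.Generators A) :=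
  IsFreeGroup.finite_generators A fun Q _ _ => hA.finite_monoidHom Q

/-- Let `ρ` retract `F` onto `A` and let `x` lie in `B` but not in `A`. A finite quotient `q`
separating `x` from `ρ x` makes `q` and `q ∘ ρ` two homomorphisms on `B` that agree on `A`. So `|Q|
^ rank A < |Q| ^ rank B`. -/
theorem card_generators_lt (hA : IsLifting.{u} A.subtype) (hB : IsLifting.{u} B.subtype)
    (hAB : A < B) :
    Nat.card (IsFreeGroup.Generators A) < Nat.card (IsFreeGroup.Generators B) := by
  have := hA.finite_generators
  have := hB.finite_generators
  obtain ⟨x, hxB, hxA⟩ := SetLike.exists_of_lt hAB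
  obtain ⟨ρ, hρ⟩ := hA.exists_extend (MonoidHom.id A)
  have hρ' : ∀ a : A, ρ a = a := fun a => DFunLike.congr_fun hρ a
  obtain ⟨Q, _, _, q, hq⟩ := IsFreeGroup.exists_finite_ne_one (x := ((ρ x : A) : F)⁻¹ * x) (by
    intro h
    rw [inv_mul_eq_one] at h
    exact hxA (h ▸ (ρ x).2))
  have hfin := hB.finite_monoidHom Q
  have hsurj : Function.Surjective fun f : B →* Q => f.comp (Subgroup.inclusion hAB.le) := by
    intro g
    obtain ⟨f, rfl⟩ := hA.exists_extend g
    exact ⟨f.comp B.subtype, rfl⟩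
  have hninj : ¬ Function.Injective fun f : B →* Q => f.comp (Subgroup.inclusion hAB.le) := by
    intro hinj
    have h : q.comp B.subtype = (q.comp (A.subtype.comp ρ)).comp B.subtype := by
      refine hinj ?_
      ext a
      exact (congrArg (fun a' : A => q a') (hρ' a)).symm
    have h2 : q x = q (ρ x) := DFunLike.congr_fun h ⟨x, hxB⟩
    rw [map_mul, map_inv, h2, inv_mul_cancel] at hq
    exact hq rfl
  have hlt : Nat.card (A →* Q) < Nat.card (B →* Q) := by
    refine lt_of_le_of_ne (Nat.card_le_card_of_surjective _ hsurj) fun h => hninj ?_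
    exact ((Nat.bijective_iff_surjective_and_card _).2 ⟨hsurj, h.symm⟩).1
  rw [IsFreeGroup.card_monoidHom, IsFreeGroup.card_monoidHom] at hlt
  by_contra hle
  exact absurd (Nat.pow_le_pow_right Nat.card_pos (not_lt.1 hle)) (not_le.2 hlt)

theorem card_generators_le (hA : IsLifting.{u} A.subtype) :
    Nat.card (IsFreeGroup.Generators A) ≤
      Nat.card (IsFreeGroup.Generators (⊤ : Subgroup F)) := by
  rcases eq_or_ne A ⊤ with rfl | h
  · exact le_rfl
  · exact (hA.card_generators_lt top (lt_top_iff_ne_top.2 h)).le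

end IsLifting

end

/-! ### The two finiteness statements. -/

section

theorem conjClassUnder_conjSubgroup {G : Type*} [Group G] {H : Subgroup G} {h : G} (hh : h ∈ H)
    (K : Subgroup G) : conjClassUnder H (conjSubgroup h K) = conjClassUnder H K := by
  ext L
  constructor
  · rintro ⟨g, hg, rfl⟩
    exact ⟨g * h, H.mul_mem hg hh, (conjSubgroup_mul g h K).symm⟩
  · rintro ⟨g, hg, rfl⟩
    exact ⟨g * h⁻¹, H.mul_mem hg (H.inv_mem hh), by
      rw [← conjSubgroup_mul, inv_mul_cancel_right]⟩

theorem comap_biInf {G G' ι : Type*} [Group G] [Group G'] (f : G →* G') (P : ι → Prop)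
    (K : ι → Subgroup G') : (⨅ (p) (_ : P p), K p).comap f = ⨅ (p) (_ : P p), (K p).comap f := by
  ext x
  simp only [Subgroup.mem_comap, Subgroup.mem_iInf]

theorem isLifting_iInf {F : Type u₃} [Group F] [IsFreeGroup F] {ι : Type*} (A : Finset ι)
    (K : ι → Subgroup F) (hK : ∀ p, IsLifting.{u₃} (K p).subtype) :
    IsLifting.{u₃} (⨅ p ∈ A, K p).subtype := by
  classical
  induction A using Finset.induction_on with
  | empty =>
    have h : ⨅ p ∈ (∅ : Finset ι), K p = ⊤ := by simp
    rw [h]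
    exact IsLifting.top
  | insert p A _ ih =>
    rw [Finset.iInf_insert]
    exact (hK p).inf ih

namespace GraphOfGroups

variable {V : Type u₁} {E : Type u₂} {𝒢 : GraphOfGroups.{u₁, u₂, u₃, u₄} V E} {T : Set E}
  {G : Type*} [Group G]

theorem vertexGroup_eq_map (φ : 𝒢.FundGroup T ≃* G) (v : V) :
    𝒢.vertexGroup φ v = (𝒢.vertexHom T v).range.map φ.toMonoidHom :=
  MonoidHom.range_comp _ _

theorem comap_conjSubgroup_vertexGroup (φ : 𝒢.FundGroup T ≃* G) (g : G) (v w : V) :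
    (conjSubgroup g (𝒢.vertexGroup φ w)).comap (φ.toMonoidHom.comp (𝒢.vertexHom T v)) =
      (conjSubgroup (φ.symm g) (𝒢.vertexHom T w).range).comap (𝒢.vertexHom T v) := by
  have h : g = φ.toMonoidHom (φ.symm g) := (φ.apply_symm_apply g).symm
  rw [vertexGroup_eq_map]
  conv_lhs => rw [h]
  rw [← map_conjSubgroup, ← Subgroup.comap_comap,
    Subgroup.comap_map_eq_self_of_injective φ.injective]

theorem hasFiniteCommensurableDepth [Finite V] (h𝒢 : 𝒢.IsFGFree) (hT : 𝒢.IsSpanningTree T)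
    (φ : 𝒢.FundGroup T ≃* G) (hclean : 𝒢.IsAlgebraicallyClean) :
    HasFiniteCommensurableDepth (𝒢.vertexGroup φ) := by
  have hfree : ∀ v, IsFreeGroup (𝒢.vert v) := fun v => (h𝒢.1 v).1
  have hfg : ∀ v, Group.FG (𝒢.vert v) := fun v => (h𝒢.1 v).2
  have hedge : ∀ e b, IsLifting.{u₃} (𝒢.edgeHom e b) := by
    rintro e (- | -)
    · exact .of_range_subtype (.of_isFreeFactor (hclean e).2) (𝒢.toTgt_injective e)
    · exact .of_range_subtype (.of_isFreeFactor (hclean e).1) (𝒢.toSrc_injective e)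
  have hmem := hT.comap_conjSubgroup_mem (fun v => {K | IsLifting.{u₃} K.subtype})
    (fun v => IsLifting.top) (fun v K hK g => IsLifting.conj hK g)
    (fun e b K hK => IsLifting.map_comap (𝒢.edgeHom_injective e (!b)) (𝒢.edgeHom_injective e b)
      (hedge e b) hK)
  obtain ⟨N, hN⟩ := (Set.finite_range fun v =>
    Nat.card (IsFreeGroup.Generators (⊤ : Subgroup (𝒢.vert v)))).bddAbove
  refine lt_of_le_of_lt (iSup₂_le fun d hd => ?_) (ENat.natCast_lt_top (N + 1))
  obtain ⟨L, hL, hLA⟩ := hd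
  refine Nat.cast_le.2 ?_
  rcases d with - | d
  · exact Nat.zero_le _
  -- The largest term of the chain lies in one conjugate of a vertex group, so the whole chain can
  -- be pulled back to that vertex group without losing strictness.
  obtain ⟨A, ⟨⟨w, h⟩, hwh⟩, hA⟩ := hLA (Fin.last d)
  let ψ : 𝒢.vert w →* G :=
    (MulAut.conj h).toMonoidHom.comp (φ.toMonoidHom.comp (𝒢.vertexHom T w))
  have hψ : ∀ g u, (conjSubgroup g (𝒢.vertexGroup φ u)).comap ψ =
      (conjSubgroup (h⁻¹ * g) (𝒢.vertexGroup φ u)).comap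
        (φ.toMonoidHom.comp (𝒢.vertexHom T w)) := by
    intro g u
    ext x
    simp only [Subgroup.mem_comap, mem_conjSubgroup, ψ, MonoidHom.comp_apply]
    simp [mul_assoc]
  have hlift : ∀ i, IsLifting.{u₃} ((L i).comap ψ).subtype := by
    intro i
    obtain ⟨B, -, hB⟩ := hLA i
    rw [hB, comap_biInf ψ (· ∈ B)]
    refine isLifting_iInf B _ fun p => ?_
    rw [hψ, comap_conjSubgroup_vertexGroup]
    exact hmem _ _ _
  have hrange : ∀ i, L i ≤ ψ.range := by
    intro i
    refine (hL.monotone (Fin.le_last i)).trans ?_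
    rw [hA, MonoidHom.range_comp]
    exact iInf₂_le (w, h) hwh
  have hlt : ∀ i j, i < j → (L i).comap ψ < (L j).comap ψ := by
    intro i j hij
    refine lt_of_le_of_ne (Subgroup.comap_mono (hL hij).le) fun heq => ?_
    obtain ⟨x, hxj, hxi⟩ := SetLike.exists_of_lt (hL hij)
    obtain ⟨y, rfl⟩ := hrange j hxj
    have : y ∈ (L j).comap ψ := hxj
    rw [← heq] at this
    exact hxi this
  -- Ranks take values from 0 to `N`, which allows `N + 1` terms.
  let r : Fin (d + 1) → Fin (N + 1) := fun i =>
    ⟨Nat.card (IsFreeGroup.Generators ((L i).comap ψ)),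
      Nat.lt_succ_of_le ((hlift i).card_generators_le.trans (hN ⟨w, rfl⟩))⟩
  have hr : StrictMono r := fun i j hij => (hlift i).card_generators_lt (hlift j) (hlt i j hij)
  simpa using Fintype.card_le_of_injective r hr.injective

open Path.Homotopic.Quotient in
theorem hasFiniteStature (h𝒢 : 𝒢.IsFGFree) (hT : 𝒢.IsSpanningTree T) (φ : 𝒢.FundGroup T ≃* G)
    (hclean : IsGeometricallyClean.{u₁, u₂, u₃, u₄, u₅, u₆} 𝒢) :
    HasFiniteStature (𝒢.vertexGroup φ) := by
  classical
  obtain ⟨𝒳, ⟨x, y, p, q, α, β, hαβ⟩, hgraph, -, hemb⟩ := hclean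
  have hT2 : ∀ v, T2Space (𝒳.vert v) := fun v => (hgraph v).1
  choose EX hEX using fun v => (hgraph v).exists_topGraph
  let Γ : ∀ v, TopGraph (𝒳.vert v) (EX v) := fun v => (hEX v).some
  have hsrc : ∀ e a, (α (𝒢.src e)).toMonoidHom (𝒢.toSrc e a) =
      conjLoop (p e).cls (Path.Homotopic.Quotient.map (β e a) (𝒳.toSrc e)) := fun e a => by
    rw [← fundamentalGroupMulEquivOfPath_apply]
    exact (hαβ e a).1
  have htgt : ∀ e a, (α (𝒢.tgt e)).toMonoidHom (𝒢.toTgt e a) =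
      conjLoop (q e).cls (Path.Homotopic.Quotient.map (β e a) (𝒳.toTgt e)) := fun e a => by
    rw [← fundamentalGroupMulEquivOfPath_apply]
    exact (hαβ e a).2
  have hmem := hT.comap_conjSubgroup_mem (fun v => {K | IsCarried (α v).toMonoidHom K})
    (fun v => IsCarried.top _) (fun v K hK g => IsCarried.conj hK g) (by
      rintro e (- | -) K hK
      · exact (IsCarried.comap (Γ _) (α (𝒢.src e)).injective (hemb e).1 (𝒢.toSrc_injective e)
          (hsrc e) hK).map (α (𝒢.tgt e)).injective (hemb e).2 (htgt e)
      · exact (IsCarried.comap (Γ _) (α (𝒢.tgt e)).injective (hemb e).2 (𝒢.toTgt_injective e)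
          (htgt e) hK).map (α (𝒢.src e)).injective (hemb e).1 (hsrc e))
  intro v
  have hfg : Group.FG (𝒢.vert v) := (h𝒢.1 v).2
  obtain ⟨u, hu⟩ := (Γ v).exists_mem_verts
  let c : Path.Homotopic.Quotient (x v) u := (PathConnectedSpace.somePath (x v) u).cls
  let W : 𝒢.vert v →* FreeGroup (EX v) := ((Γ v).wordHom hu c).comp (α v).toMonoidHom
  have hW : Function.Injective W := ((Γ v).wordHom_injective hu c).comp (α v).injective
  obtain ⟨R, hR, hRW⟩ := FreeGroup.exists_finite_comap_classes W hW
  let j : 𝒢.vert v →* G := φ.toMonoidHom.comp (𝒢.vertexHom T v)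
  refine (hR.image fun r => conjClassUnder (𝒢.vertexGroup φ v) (r.map j)).subset ?_
  rintro _ ⟨K, ⟨hinf, A, hK⟩, rfl⟩
  choose M hM hMW using fun a : V × G =>
    (Γ v).exists_isLetterConj hu c (α v).injective (hmem (φ.symm a.2) v a.1)
  -- The index set may be infinite, and may be empty, in which case both sides are the whole group.
  have hcomap : (⨅ a ∈ A, conjSubgroup a.2 (𝒢.vertexGroup φ a.1)).comap j =
      (sInf (M '' A)).comap W := by
    rw [sInf_image, comap_biInf j (· ∈ A), comap_biInf W (· ∈ A)]
    refine iInf_congr fun a => iInf_congr fun _ => ?_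
    rw [comap_conjSubgroup_vertexGroup]
    exact hMW a
  have hKmap : K = ((sInf (M '' A)).comap W).map j := by
    rw [← hcomap, Subgroup.map_comap_eq]
    exact hK
  -- Infiniteness of `K` enters only through nontriviality.
  have hbot : (sInf (M '' A)).comap W ≠ ⊥ := by
    intro h
    rw [h, Subgroup.map_bot] at hKmap
    subst hKmap
    exact not_finite (⊥ : Subgroup G)
  obtain ⟨g, r, hr, hgr⟩ := hRW _ (FreeGroup.isLetterConj_sInf (by
    rintro _ ⟨a, -, rfl⟩
    exact hM a)) hbot
  refine ⟨r, hr, ?_⟩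
  rw [hKmap, hgr, map_conjSubgroup]
  exact (conjClassUnder_conjSubgroup (H := 𝒢.vertexGroup φ v) ⟨g, rfl⟩ _).symm

end GraphOfGroups

theorem mainTheorem6 {V : Type u₁} {E : Type u₂} [Finite V] [Finite E]
    (𝒢 : GraphOfGroups.{u₁, u₂, u₃, u₄} V E) (h𝒢 : 𝒢.IsFGFree)
    {T : Set E} (hT : 𝒢.IsSpanningTree T)
    {G : Type*} [Group G] (φ : 𝒢.FundGroup T ≃* G) :
    (𝒢.IsAlgebraicallyClean → HasFiniteCommensurableDepth (𝒢.vertexGroup φ)) ∧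
    (GraphOfGroups.IsGeometricallyClean.{u₁, u₂, u₃, u₄, u₅, u₆} 𝒢 →
      HasFiniteStature (𝒢.vertexGroup φ)) :=
  ⟨GraphOfGroups.hasFiniteCommensurableDepth h𝒢 hT φ, GraphOfGroups.hasFiniteStature h𝒢 hT φ⟩

end
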